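/- Notation. Work in $\mathbb R^n$ with Lebesgue measure $|\cdot|$; cubes have sides parallel to the axes, $Q$ denotes a cube, and $u(E)=\int_E u\,dx$. For $0\le\alpha<n$, $1\le s<\infty$ put $\langle f\rangle_{\alpha,s,Q}=\big(|Q|^{\alpha/n-1}\int_Q|f|^s\,dx\big)^{1/s}$ and $\langle f\rangle_{s,Q}=\langle f\rangle_{0,s,Q}$. A dyadic grid is a collection of cubes with side lengths $2^k$, $k\in\mathbb Z$, any two of which are nested or disjoint, such that for each $k$ the cubes of side length $2^k$ partition $\mathbb R^n$. A subcollection $\mathcal S$ of a dyadic grid is $\eta$-sparse if there are pairwise disjoint measurable $E_Q\subseteq Q$ ($Q\in\mathcal S$) with $|E_Q|\ge\eta|Q|$. The shifted dyadic cubes are $2^{-k}([0,1)^n+m+(-1)^k a/3)$, $k\in\mathbb Z$, $m\in\mathbb Z^n$, $a\in\{0,1,2\}^n$. Let $T$ be a linear or sublinear operator, initially defined on $C_c^\infty$, with locally integrable values. We write $T\in S^\alpha(p_0,q_0)$, with sparseness parameter $0<\eta\le1$, number $N$ and constant $B$, if for all $f,g\in C_c^\infty$ there are $\eta$-sparse collections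 $\mathcal S_1,\dots,\mathcal S_N$, each contained in some dyadic grid (both may depend on $f,g$), with $$\Big|\int Tf\,g\,dx\Big|\le B\sum_{j=1}^N\sum_{Q\in\mathcal S_j}\langle f\rangle_{p_0,Q}\,\langle g\rangle_{\alpha,q_0',Q}\,|Q| .$$ For a weight $w\ge0$ and $1\le p\le q<\infty$ put $$[w]_{A^{\mathcal R}_{p,q}}=\sup_Q\sup_{E\subseteq Q}\frac{|E|}{|Q|^{1-(1/p-1/q)}}\,\frac{(w^q(Q))^{1/q}}{(w^p(E))^{1/p}},$$ and $w\in A^{\mathcal R}_{p,q}$ if this is finite. For $1<s<\infty$ put $[w]_{RH_s}=\sup_Q\langle w\rangle_{s,Q}/\langle w\rangle_{1,Q}$, and $w\in RH_s$ if this is finite; $RH_1=A_\infty=\bigcup_{p\ge1}A_p$ and $[w]_{RH_1}=1$. For $0<\eta\le 1$ put $$D^\eta_w=\sup\Big\{\frac{w(Q)}{w(E)}:\ Q\text{ a shifted dyadic cube},\ E\subseteq Q\text{ measurable},\ |E|\ge\eta|Q|\Big\}.$$ Finally $\|f\|_{L^{p,1}(u)}=p\int_0^\infty u(\{|f|>y\})^{1/p}\,dy$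 and $\|f\|_{L^{q,\infty}(u)}=\sup_{y>0}y\,u(\{|f|>y\})^{1/q}$. **Theorem 1.1.** Let $1\le p_0\le p\le q<q_0\le\infty$, $0\le\alpha<n$, $1/p-1/q=\alpha/(nq_0')$ and $0<\eta\le1$. Let $T\in S^\alpha(p_0,q_0)$ with sparseness parameter $\eta$, $w^{p_0}\in A^{\mathcal R}_{p/p_0,q/p_0}$ and $w^q\in RH_{(q_0/q)'}$. Then $T$ extends to a (sub)linear operator (linear if $T$ is linear) that is bounded from $L^{p,1}(w^p)$ to $L^{q,\infty}(w^q)$, with norm at most $$C\,[w^{p_0}]_{A^{\mathcal R}_{p/p_0,q/p_0}}^{1/p_0}\,[w^q]_{RH_{(q_0/q)'}}^{(q_0/q)'+1/q}\,D^\eta_{w^q}\,\big(D^{2^{-n}}_{w^q}\big)^{1/q},$$ and moreover $$D^\eta_{w^q}\le C\,[w^{p_0}]_{A^{\mathcal R}_{p/p_0,q/p_0}}^{q/p_0}.$$ Here $C$ depends only on $n,p_0,q_0,p,q,\alpha,\eta$, on the number $N$ and constant $B$ in the sparse domination of $T$, and on the scalar field; it does not depend on $w$ or otherwise on $T$. 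-/

import Mathlib

open MeasureTheory Set
open scoped ENNReal NNReal

namespace FracSparse

noncomputable section

/-- Euclidean space `ℝⁿ`. -/
abbrev Rn (n : ℕ) : Type := EuclideanSpace ℝ (Fin n)

/-- The half-open cube with sides parallel to the axes, lower corner `a` and side length `ℓ`. -/
def cube {n : ℕ} (a : Fin n → ℝ) (ℓ : ℝ) : Set (Rn n) :=
  {x | ∀ i, a i ≤ x i ∧ x i < a i + ℓ}

/-- `Q` is a cube (sides parallel to the axes, positive side length). -/
def IsCube {n : ℕ} (Q : Set (Rn n)) : Prop :=
  ∃ (a : Fin n → ℝ) (ℓ : ℝ), 0 < ℓ ∧ Q = cube a ℓ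

/-- `Q` is a cube of side length `2 ^ k`. -/
def IsCubeOfScale {n : ℕ} (k : ℤ) (Q : Set (Rn n)) : Prop :=
  ∃ a : Fin n → ℝ, Q = cube a ((2 : ℝ) ^ k)

/-- Dyadic grids: every member is a cube whose side length is a power of two; two members are
disjoint or one contains the other; the members of side length `2 ^ k` partition `ℝⁿ`. -/
structure IsDyadicGrid {n : ℕ} (D : Set (Set (Rn n))) : Prop where
  scale : ∀ Q ∈ D, ∃ k : ℤ, IsCubeOfScale k Q
  nested : ∀ Q ∈ D, ∀ R ∈ D, Q ∩ R = ∅ ∨ Q ∩ R = Q ∨ Q ∩ R = R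
  partition : ∀ (k : ℤ) (x : Rn n), ∃! Q, Q ∈ D ∧ IsCubeOfScale k Q ∧ x ∈ Q

/-- The shifted dyadic cubes `2⁻ᵏ ([0,1)ⁿ + m + (-1)ᵏ a / 3)`, `a ∈ {0,1,2}ⁿ`. -/
def IsShiftedDyadicCube {n : ℕ} (Q : Set (Rn n)) : Prop :=
  ∃ (a : Fin n → Fin 3) (k : ℤ) (m : Fin n → ℤ),
    Q = cube (fun i => (2 : ℝ) ^ (-k) * ((m i : ℝ) + (-1 : ℝ) ^ k * ((a i : ℕ) : ℝ) / 3))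
      ((2 : ℝ) ^ (-k))

/-- `η`-sparse collections: there are pairwise disjoint measurable `E Q ⊆ Q`, `Q ∈ S`, with
`|E Q| ≥ η |Q|`. -/
def IsSparse {n : ℕ} (η : ℝ) (S : Set (Set (Rn n))) : Prop :=
  ∃ E : Set (Rn n) → Set (Rn n), S.PairwiseDisjoint E ∧
    ∀ Q ∈ S, MeasurableSet (E Q) ∧ E Q ⊆ Q ∧ ENNReal.ofReal η * volume Q ≤ volume (E Q)

/-- The fractional average `⟨f⟩_{α,p,Q} = (|Q|^{α/n-1} ∫_Q f^p)^{1/p}` of `f ≥ 0`. -/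
def fracAvg {n : ℕ} (α p : ℝ) (Q : Set (Rn n)) (f : Rn n → ℝ≥0∞) : ℝ≥0∞ :=
  ((∫⁻ x in Q, f x ^ p) / volume Q ^ (1 - α / n)) ^ (1 / p)

/-- Smooth compactly supported functions. -/
def testFun (𝕜 : Type*) [RCLike 𝕜] (n : ℕ) : Set (Rn n → 𝕜) :=
  {f | ContDiff ℝ ((⊤ : ℕ∞) : WithTop ℕ∞) f ∧ HasCompactSupport f}

/-- `T` is sublinear on the class `V` of functions, up to `μ`-null sets. Linear operators are
included. -/
def SublinearOn {𝕜 : Type*} [RCLike 𝕜] {n : ℕ} (μ : Measure (Rn n)) (V : Set (Rn n → 𝕜))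
    (T : (Rn n → 𝕜) → Rn n → 𝕜) : Prop :=
  (∀ f ∈ V, ∀ g ∈ V, ∀ᵐ x ∂μ, ‖T (f + g) x‖ ≤ ‖T f x‖ + ‖T g x‖) ∧
    ∀ (c : 𝕜), ∀ f ∈ V, ∀ᵐ x ∂μ, ‖T (c • f) x‖ = ‖c‖ * ‖T f x‖

/-- `T` is linear on the class `V` of functions, up to `μ`-null sets. -/
def LinearOn {𝕜 : Type*} [RCLike 𝕜] {n : ℕ} (μ : Measure (Rn n)) (V : Set (Rn n → 𝕜))
    (T : (Rn n → 𝕜) → Rn n → 𝕜) : Prop :=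
  (∀ f ∈ V, ∀ g ∈ V, ∀ᵐ x ∂μ, T (f + g) x = T f x + T g x) ∧
    ∀ (c : 𝕜), ∀ f ∈ V, ∀ᵐ x ∂μ, T (c • f) x = c * T f x

/-- `T ∈ S^α(p₀,q₀)`, with sparseness parameter `η`, number of collections `N` and constant `B`.
`T` is a (sub)linear operator, initially defined on test functions, with locally integrable values
(so that the pairing `⟨T f, g⟩ = ∫ T f * g` makes sense); only the values of `T` at test functions
matter. The sparse collections may depend on `f` and `g`, and each lies in some dyadic grid. -/
structure SparselyDominated {𝕜 : Type*} [RCLike 𝕜] {n : ℕ} (α p₀ : ℝ) (q₀ : ℝ≥0∞) (η : ℝ)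
    (N : ℕ) (B : ℝ≥0) (T : (Rn n → 𝕜) → Rn n → 𝕜) : Prop where
  sublinear : SublinearOn volume (testFun 𝕜 n) T
  locallyIntegrable : ∀ f ∈ testFun 𝕜 n, LocallyIntegrable (T f) volume
  domination : ∀ f ∈ testFun 𝕜 n, ∀ g ∈ testFun 𝕜 n, ∃ S : Fin N → Set (Set (Rn n)),
    (∀ j, (∃ D, IsDyadicGrid D ∧ S j ⊆ D) ∧ IsSparse η (S j)) ∧
    ‖∫ x, T f x * g x‖ₑ ≤ (B : ℝ≥0∞) * ∑ j, ∑' Q : S j,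
      fracAvg 0 p₀ Q (fun x => ‖f x‖ₑ) *
        fracAvg α (ENNReal.conjExponent q₀).toReal Q (fun x => ‖g x‖ₑ) * volume (Q : Set (Rn n))

/-- The measure `w dx`. -/
def wMeasure {n : ℕ} (w : Rn n → ℝ≥0) : Measure (Rn n) :=
  volume.withDensity fun x => (w x : ℝ≥0∞)

/-- The constant `[w]_{A^R_{p,q}}`; here `α / n = 1 / p - 1 / q`. -/
def aRConst {n : ℕ} (p q : ℝ) (w : Rn n → ℝ≥0) : ℝ≥0∞ :=
  ⨆ (Q : Set (Rn n)) (_ : IsCube Q) (E : Set (Rn n)) (_ : MeasurableSet E) (_ : E ⊆ Q),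
    volume E / volume Q ^ (1 - (1 / p - 1 / q)) *
      (wMeasure (fun x => w x ^ q) Q ^ (1 / q) / wMeasure (fun x => w x ^ p) E ^ (1 / p))

/-- The Muckenhoupt constant `[w]_{A_p}`, `1 ≤ p < ∞`. -/
def apConst {n : ℕ} (p : ℝ) (w : Rn n → ℝ≥0) : ℝ≥0∞ :=
  ⨆ (Q : Set (Rn n)) (_ : IsCube Q),
    ((∫⁻ x in Q, (w x : ℝ≥0∞)) / volume Q) *
      if p = 1 then (essInf (fun x => (w x : ℝ≥0∞)) (volume.restrict Q))⁻¹
      else ((∫⁻ x in Q, (w x : ℝ≥0∞) ^ (-(1 / (p - 1)))) / volume Q) ^ (p - 1)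

/-- The class `A_∞`, the union of the classes `A_p`, `1 ≤ p < ∞`. -/
def IsAInfty {n : ℕ} (w : Rn n → ℝ≥0) : Prop := ∃ p : ℝ, 1 ≤ p ∧ apConst p w < ∞

/-- The reverse Hölder constant `[w]_{RH_s}`, `1 ≤ s < ∞`, with `[w]_{RH_1} = 1`. -/
def rhConst {n : ℕ} (s : ℝ) (w : Rn n → ℝ≥0) : ℝ≥0∞ :=
  if s = 1 then 1
  else ⨆ (Q : Set (Rn n)) (_ : IsCube Q),
    fracAvg 0 s Q (fun x => (w x : ℝ≥0∞)) / fracAvg 0 1 Q (fun x => (w x : ℝ≥0∞))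

/-- The class `RH_s`, `1 ≤ s < ∞`, with `RH_1 = A_∞`. -/
def IsRH {n : ℕ} (s : ℝ) (w : Rn n → ℝ≥0) : Prop :=
  if s = 1 then IsAInfty w else rhConst s w < ∞

/-- The doubling-type constant `D^η_w`, the supremum of `w(Q) / w(E)` over shifted dyadic cubes `Q`
and measurable `E ⊆ Q` with `|E| ≥ η |Q|`. -/
def doublingConst {n : ℕ} (η : ℝ) (w : Rn n → ℝ≥0) : ℝ≥0∞ :=
  ⨆ (Q : Set (Rn n)) (_ : IsShiftedDyadicCube Q) (E : Set (Rn n)) (_ : MeasurableSet E)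
    (_ : E ⊆ Q) (_ : ENNReal.ofReal η * volume Q ≤ volume E), wMeasure w Q / wMeasure w E

/-- The Lorentz norm `‖f‖_{L^{p,1}(μ)} = p ∫_0^∞ μ{|f| > y}^{1/p} dy`. -/
def lorentzOneNorm {𝕜 : Type*} [RCLike 𝕜] {n : ℕ} (p : ℝ) (μ : Measure (Rn n))
    (f : Rn n → 𝕜) : ℝ≥0∞ :=
  ENNReal.ofReal p * ∫⁻ y in Ioi (0 : ℝ), μ {x | y < ‖f x‖} ^ (1 / p)

/-- The weak norm `‖f‖_{L^{q,∞}(μ)} = sup_{y>0} y μ{|f| > y}^{1/q}`. -/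
def weakNorm {𝕜 : Type*} [RCLike 𝕜] {n : ℕ} (q : ℝ) (μ : Measure (Rn n))
    (f : Rn n → 𝕜) : ℝ≥0∞ :=
  ⨆ (y : ℝ) (_ : 0 < y), ENNReal.ofReal y * μ {x | y < ‖f x‖} ^ (1 / q)

/-- The functions of class `L^{p,1}(μ)`. -/
def LorentzOne (𝕜 : Type*) [RCLike 𝕜] {n : ℕ} (p : ℝ) (μ : Measure (Rn n)) : Set (Rn n → 𝕜) :=
  {f | AEStronglyMeasurable f μ ∧ lorentzOneNorm p μ f < ∞}

/-- The functions of class `L^{q,∞}(μ)`. -/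
def WeakL (𝕜 : Type*) [RCLike 𝕜] {n : ℕ} (q : ℝ) (μ : Measure (Rn n)) : Set (Rn n → 𝕜) :=
  {f | AEStronglyMeasurable f μ ∧ weakNorm q μ f < ∞}

/-- `T`, given on test functions, extends to a (sub)linear operator from `L^{p,1}(μ)` to
`L^{q,∞}(ν)` of norm at most `K` (linear if `T` is linear). -/
def ExtendsBoundedly {𝕜 : Type*} [RCLike 𝕜] {n : ℕ} (p q : ℝ) (μ ν : Measure (Rn n))
    (K : ℝ≥0∞) (T : (Rn n → 𝕜) → Rn n → 𝕜) : Prop :=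
  ∃ T' : (Rn n → 𝕜) → Rn n → 𝕜,
    (∀ f ∈ testFun 𝕜 n, f ∈ LorentzOne 𝕜 p μ ∧ T' f =ᵐ[ν] T f) ∧
    SublinearOn ν (LorentzOne 𝕜 p μ) T' ∧
    (LinearOn volume (testFun 𝕜 n) T → LinearOn ν (LorentzOne 𝕜 p μ) T') ∧
    ∀ f ∈ LorentzOne 𝕜 p μ, T' f ∈ WeakL 𝕜 q ν ∧
      weakNorm q ν (T' f) ≤ K * lorentzOneNorm p μ f

end

end FracSparse

open FracSparse

/-!
The proof linearizes the level sets of `T f` by duality and estimates sparse forms level by level.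
Write `v = w ^ p`, `u = w ^ q` for the two measures, `s = q₀'`, `r = (q₀ / q)'`, and let `b_P` be the
`L^{p,1}(v)` norm of `f` localized to a cube `P` (`lorentzIntegral`).

*The two averages.* The layer-cake formula and the restricted Muckenhoupt condition bound the
average of `f` over `P` by `b_P u(P)^{-1/q}`, up to `A^{1/p₀}` and the power of `|P|` prescribed by
`α` (`lintegral_rpow_mul_wMeasure_le`). If `g` is the density of `u` on a set `G`, then the average
of `g` is governed by a power of `t_P = u(G ∩ P) / u(P)`. Plain interpolation with the reverse Hölder
inequality gives the power `1 - 1/q`; the self-improvement of reverse Hölder weights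
(`exists_gehring`), proved with a Calderón–Zygmund decomposition that keeps track of the constants,
improves this to `1 - 1/q + δ` with `1/δ ≲ R^r`, where `R` is the reverse Hölder constant
(`exists_testing_bound`). This is the source of the exponent `r + 1/q` in the theorem.

*The sparse form.* The one-third trick (`exists_gridCube_superset`) replaces the cubes of a sparse
family by shifted dyadic ones. A sparse family satisfies a Carleson condition with respect to `u`,
with a constant proportional to `D^η`: the part of a cube that lies in at most `m` smaller cubes of
the family still has proportion `η` if `m` is large (`sum_measure_le_of_doubling`). Away from the
exceptional set `ω`, the union of the shifted dyadic cubes with `b_P > γ u(P)^{1/q}`, both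
`z_P = (b_P/γ)^q / u(P)` and `t_P` are at most `1`, and their sums over disjoint cubes, weighted by
`u(P)`, are at most `(b/γ)^q` and `u(G)`; for `z` this is `sum_lorentzIntegral_rpow_le`, which uses
`p ≤ q`. The form is a sum of terms `γ z^{1/q} t^{1-1/q+δ} u(P)`, whose exponents add up to more than
one, so `sum_rpow_mul_rpow_mul_measure_le` bounds it by `δ⁻¹ γ ((b/γ)^q + u(G))`. For `η = 1` the cubes
are almost everywhere disjoint and Hölder's inequality is enough. The outcome is
`exists_tsum_formTerm_le`.

*The weak-type bound.* For a test function `f` and `G ⊆ {|T f| > y} \ ω`, the pairing of `T f` with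
`u` times the conjugate sign of `T f` on `G` is at least `y u(G)`. Choosing `γ` as a small multiple of
`y` absorbs the term `u(G)` (`exists_weakNorm_le`), and `u(ω) ≲ (b/γ)^q`
(`measure_iUnion_gridCube_le`). Sparse domination is available only for smooth `g`. It passes to
bounded `g` of bounded support by mollification, because sparse forms are continuous in `g` uniformly
in the sparse family (`exists_tsum_formTerm_le_of_bounded`): this uses `q < q₀`.

*The extension.* Test functions are dense in `L^{p,1}(v)`, and `T f`, or `|T f|` when `T` is only
sublinear, is Lipschitz in `f`; limits along geometrically convergent sequences exist almost
everywhere by the Borel–Cantelli lemma (`extendsBoundedly_of_weakNorm_le`).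

*The doubling constant.* Hölder's inequality bounds `v(E)` by a power of `u(E)` and `|E|`, so the
restricted Muckenhoupt condition for `E ⊆ Q` compares `u(Q)` with `u(E)` (`doublingConst_le`).
-/

namespace FracSparse

noncomputable section

/-! ### Nested and Carleson families -/

/-- A finite family of pairwise nested or disjoint sets contains a disjoint subfamily with the same
union, namely its maximal members. -/
theorem exists_disjoint_subfamily {ι X : Type*} (P : ι → Set X) (I : Finset ι)
    (hP : ∀ i ∈ I, ∀ j ∈ I, Disjoint (P i) (P j) ∨ P i ⊆ P j ∨ P j ⊆ P i) :
    ∃ J ⊆ I, (J : Set ι).PairwiseDisjoint P ∧ ∀ i ∈ I, ∃ j ∈ J, P i ⊆ P j := by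
  classical
  induction I using Finset.induction_on with
  | empty => exact ⟨∅, by simp, by simp, by simp⟩
  | insert i I hi ih =>
    obtain ⟨J, hJI, hJd, hJ⟩ := ih fun a ha b hb =>
      hP a (Finset.mem_insert_of_mem ha) b (Finset.mem_insert_of_mem hb)
    by_cases h : ∃ j ∈ J, P i ⊆ P j
    · refine ⟨J, hJI.trans (Finset.subset_insert _ _), hJd, fun a ha => ?_⟩
      rcases Finset.mem_insert.1 ha with rfl | ha
      · exact h
      · exact hJ a ha
    · push Not at h
      refine ⟨insert i (J.filter fun j => ¬ P j ⊆ P i), ?_, ?_, ?_⟩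
      · exact Finset.insert_subset_insert _ ((Finset.filter_subset _ _).trans hJI)
      · have key : ∀ j ∈ J, ¬ P j ⊆ P i → Disjoint (P i) (P j) := by
          intro j hj hji
          rcases hP i (Finset.mem_insert_self _ _) j (Finset.mem_insert_of_mem (hJI hj)) with
            h1 | h1 | h1
          · exact h1
          · exact absurd h1 (h j hj)
          · exact absurd h1 hji
        rw [Finset.coe_insert, Set.pairwiseDisjoint_insert]
        refine ⟨hJd.subset (by exact_mod_cast Finset.filter_subset _ _), fun j hj _ => ?_⟩
        simp only [Finset.coe_filter, mem_ofPred_eq] at hj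
        exact key j hj.1 hj.2
      · intro a ha
        rcases Finset.mem_insert.1 ha with rfl | ha
        · exact ⟨a, Finset.mem_insert_self _ _, subset_rfl⟩
        · obtain ⟨j, hj, haj⟩ := hJ a ha
          by_cases hji : P j ⊆ P i
          · exact ⟨i, Finset.mem_insert_self _ _, haj.trans hji⟩
          · exact ⟨j, Finset.mem_insert_of_mem (Finset.mem_filter.2 ⟨hj, hji⟩), haj⟩

/-- `∫_0^1 y^{ε-1} dy = 1 / ε`. -/
theorem lintegral_Ioo_rpow_sub_one {ε : ℝ} (hε : 0 < ε) :
    ∫⁻ y in Ioo (0 : ℝ) 1, ENNReal.ofReal (y ^ (ε - 1)) = ENNReal.ofReal (1 / ε) := by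
  have hint : IntervalIntegrable (fun y : ℝ => y ^ (ε - 1)) volume 0 1 :=
    intervalIntegral.intervalIntegrable_rpow' (by linarith)
  rw [intervalIntegrable_iff_integrableOn_Ioo_of_le zero_le_one] at hint
  rw [← ofReal_integral_eq_lintegral_ofReal hint]
  · rw [← integral_Ioc_eq_integral_Ioo, ← intervalIntegral.integral_of_le zero_le_one,
      integral_rpow (Or.inl (by linarith))]
    simp [hε.ne']
  · filter_upwards [ae_restrict_mem measurableSet_Ioo] with y hy
    exact Real.rpow_nonneg hy.1.le _

/-- The sum over a nested family of `z ^ (1 + ε)` against a Carleson measure: the weak-type bound,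
applied to the level sets `{z > y}`, is integrated over `0 < y < 1`. -/
theorem sum_rpow_mul_measure_le {ι X : Type*} [MeasurableSpace X] (μ : Measure X)
    (P : ι → Set X) (I : Finset ι)
    (hP : ∀ i ∈ I, ∀ j ∈ I, Disjoint (P i) (P j) ∨ P i ⊆ P j ∨ P j ⊆ P i)
    (K Z : ℝ≥0∞) (hK : ∀ J ⊆ I, ∑ i ∈ J, μ (P i) ≤ K * μ (⋃ i ∈ J, P i))
    (z : ι → ℝ≥0∞) (hz : ∀ i ∈ I, z i ≤ 1)
    (hZ : ∀ J ⊆ I, (J : Set ι).PairwiseDisjoint P → ∑ i ∈ J, z i * μ (P i) ≤ Z)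
    {ε : ℝ} (hε : 0 < ε) (hε1 : ε ≤ 1) :
    ∑ i ∈ I, z i ^ (1 + ε) * μ (P i) ≤ ENNReal.ofReal (2 / ε) * (K * Z) := by
  classical
  have weak : ∀ y : ℝ, 0 < y →
      ∑ i ∈ I with ENNReal.ofReal y < z i, μ (P i) ≤ K * Z * ENNReal.ofReal y⁻¹ := by
    intro y hy
    set J := I.filter fun i => ENNReal.ofReal y < z i with hJ
    have hJI : J ⊆ I := Finset.filter_subset _ _
    obtain ⟨J', hJ'J, hd, hcov⟩ := exists_disjoint_subfamily P J
      fun i hi j hj => hP i (hJI hi) j (hJI hj)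
    calc ∑ i ∈ J, μ (P i) ≤ K * μ (⋃ i ∈ J, P i) := hK J hJI
      _ ≤ K * ∑ i ∈ J', μ (P i) := by
        gcongr
        refine le_trans (measure_mono ?_) (measure_biUnion_finset_le J' P)
        refine iUnion₂_subset fun i hi => ?_
        obtain ⟨j, hj, hij⟩ := hcov i hi
        exact hij.trans (subset_biUnion_of_mem (u := fun i => P i) hj)
      _ ≤ K * ∑ i ∈ J', ENNReal.ofReal y⁻¹ * (z i * μ (P i)) := by
        gcongr with i hi
        have h1 : ENNReal.ofReal y < z i := (Finset.mem_filter.1 (hJ'J hi)).2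
        calc μ (P i) = ENNReal.ofReal y⁻¹ * (ENNReal.ofReal y * μ (P i)) := by
              rw [← mul_assoc, ← ENNReal.ofReal_mul (by positivity), inv_mul_cancel₀ hy.ne']
              simp
          _ ≤ _ := by gcongr
      _ ≤ K * (ENNReal.ofReal y⁻¹ * Z) := by
        rw [← Finset.mul_sum]
        gcongr
        exact hZ J' (hJ'J.trans hJI) hd
      _ = _ := by ring
  let _ : MeasurableSpace ι := ⊤
  set m : Measure ι := ∑ i ∈ I, μ (P i) • Measure.dirac i with hm
  have hms : ∀ s : Set ι, MeasurableSet s := fun s => trivial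
  have hmeas : ∀ f : ι → ℝ≥0∞, ∫⁻ i, f i ∂m = ∑ i ∈ I, f i * μ (P i) := by
    intro f
    rw [hm, lintegral_finsetSum_measure]
    refine Finset.sum_congr rfl fun i _ => ?_
    rw [lintegral_smul_measure, lintegral_dirac' _ (fun _ _ => hms _), smul_eq_mul, mul_comm]
  have hset : ∀ y : ℝ, 0 < y → m {i | y < (z i ⊓ 1).toReal} ≤
      (Ioo (0 : ℝ) 1).indicator (fun y => K * Z * ENNReal.ofReal y⁻¹) y := by
    intro y hy
    by_cases hy1 : y < 1
    · rw [indicator_of_mem (show y ∈ Ioo (0 : ℝ) 1 from ⟨hy, hy1⟩)]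
      refine le_trans ?_ (weak y hy)
      rw [← lintegral_indicator_one (hms _), hmeas, Finset.sum_filter]
      refine Finset.sum_le_sum fun i hi => ?_
      by_cases h : y < (z i ⊓ 1).toReal
      · have hlt : ENNReal.ofReal y < z i := by
          rw [← ENNReal.ofReal_lt_iff_lt_toReal hy.le (by simp)] at h
          exact h.trans_le inf_le_left
        simp [h, hlt]
      · simp [h]
    · have : {i | y < (z i ⊓ 1).toReal} = ∅ := by
        ext i
        simp only [mem_ofPred_eq, mem_empty_iff_false, iff_false, not_lt]
        refine le_trans (ENNReal.toReal_mono ENNReal.one_ne_top inf_le_right) ?_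
        simpa using hy1
      simp [this]
  calc ∑ i ∈ I, z i ^ (1 + ε) * μ (P i)
      = ∫⁻ i, ENNReal.ofReal ((z i ⊓ 1).toReal ^ (1 + ε)) ∂m := by
        rw [hmeas]
        refine Finset.sum_congr rfl fun i hi => ?_
        rw [← ENNReal.ofReal_rpow_of_nonneg ENNReal.toReal_nonneg (by linarith),
          ENNReal.ofReal_toReal (by simp), inf_eq_left.2 (hz i hi)]
    _ = ENNReal.ofReal (1 + ε) * ∫⁻ y in Ioi (0 : ℝ), m {i | y < (z i ⊓ 1).toReal} *
          ENNReal.ofReal (y ^ (1 + ε - 1)) := by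
        refine lintegral_rpow_eq_lintegral_meas_lt_mul m (f := fun i => (z i ⊓ 1).toReal) ?_ ?_
          (by linarith)
        · exact Filter.Eventually.of_forall fun i => ENNReal.toReal_nonneg
        · exact Measurable.aemeasurable fun _ _ => hms _
    _ ≤ ENNReal.ofReal (1 + ε) * ∫⁻ y in Ioi (0 : ℝ), (Ioo (0 : ℝ) 1).indicator
          (fun y => K * Z * ENNReal.ofReal (y ^ (ε - 1))) y := by
        refine mul_le_mul_right ?_ _
        refine setLIntegral_mono_ae' measurableSet_Ioi (Filter.Eventually.of_forall ?_)
        intro y hy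
        have hy0 : (0 : ℝ) < y := hy
        refine (mul_le_mul_left (hset y hy0) _).trans ?_
        by_cases hy1 : y ∈ Ioo (0 : ℝ) 1
        · rw [indicator_of_mem hy1, indicator_of_mem hy1, mul_assoc,
            ← ENNReal.ofReal_mul (by positivity)]
          gcongr
          rw [add_sub_cancel_left, Real.rpow_sub hy0, Real.rpow_one, div_eq_inv_mul]
        · simp [indicator_of_notMem hy1]
    _ = ENNReal.ofReal (1 + ε) * (K * Z * ENNReal.ofReal (1 / ε)) := by
        rw [lintegral_indicator measurableSet_Ioo, Measure.restrict_restrict measurableSet_Ioo,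
          inter_eq_left.2 Ioo_subset_Ioi_self, lintegral_const_mul _ (by fun_prop),
          lintegral_Ioo_rpow_sub_one hε]
    _ = ENNReal.ofReal ((1 + ε) / ε) * (K * Z) := by
        rw [div_eq_mul_one_div (1 + ε), ENNReal.ofReal_mul (by linarith)]
        ring
    _ ≤ _ := by
        gcongr
        linarith

/-- Two weak-type `(1,1)` quantities `z`, `t` combine as soon as the exponents add up to more than
one, since `z ^ a * t ^ (1 - a + ε) ≤ max z t ^ (1 + ε)`. -/
theorem sum_rpow_mul_rpow_mul_measure_le {ι X : Type*} [MeasurableSpace X] (μ : Measure X)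
    (P : ι → Set X) (I : Finset ι)
    (hP : ∀ i ∈ I, ∀ j ∈ I, Disjoint (P i) (P j) ∨ P i ⊆ P j ∨ P j ⊆ P i)
    (K Z W : ℝ≥0∞) (hK : ∀ J ⊆ I, ∑ i ∈ J, μ (P i) ≤ K * μ (⋃ i ∈ J, P i))
    (z t : ι → ℝ≥0∞) (hz : ∀ i ∈ I, z i ≤ 1) (ht : ∀ i ∈ I, t i ≤ 1)
    (hZ : ∀ J ⊆ I, (J : Set ι).PairwiseDisjoint P → ∑ i ∈ J, z i * μ (P i) ≤ Z)
    (hW : ∀ J ⊆ I, (J : Set ι).PairwiseDisjoint P → ∑ i ∈ J, t i * μ (P i) ≤ W)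
    {a ε : ℝ} (ha : 0 ≤ a) (ha1 : a ≤ 1) (hε : 0 < ε) (hε1 : ε ≤ 1) :
    ∑ i ∈ I, z i ^ a * t i ^ (1 - a + ε) * μ (P i) ≤ ENNReal.ofReal (2 / ε) * (K * (Z + W)) := by
  calc ∑ i ∈ I, z i ^ a * t i ^ (1 - a + ε) * μ (P i)
      ≤ ∑ i ∈ I, (z i ^ (1 + ε) * μ (P i) + t i ^ (1 + ε) * μ (P i)) := by
        refine Finset.sum_le_sum fun i _ => ?_
        rw [← add_mul]
        gcongr
        have h : z i ^ a * t i ^ (1 - a + ε) ≤ (max (z i) (t i)) ^ (1 + ε) := by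
          calc z i ^ a * t i ^ (1 - a + ε)
              ≤ max (z i) (t i) ^ a * max (z i) (t i) ^ (1 - a + ε) := by
                refine mul_le_mul' (ENNReal.rpow_le_rpow (le_max_left _ _) ha)
                  (ENNReal.rpow_le_rpow (le_max_right _ _) (by linarith))
            _ = _ := by
                rw [← ENNReal.rpow_add_of_nonneg _ _ ha (by linarith)]
                ring_nf
        refine h.trans ?_
        rcases max_cases (z i) (t i) with h | h <;> rw [h.1]
        · exact le_self_add
        · exact le_add_self
    _ ≤ ENNReal.ofReal (2 / ε) * (K * Z) + ENNReal.ofReal (2 / ε) * (K * W) := by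
        rw [Finset.sum_add_distrib]
        exact add_le_add (sum_rpow_mul_measure_le μ P I hP K Z hK z hz hZ hε hε1)
          (sum_rpow_mul_measure_le μ P I hP K W hK t ht hW hε hε1)
    _ = _ := by ring

/-- Sparse families are Carleson families. -/
theorem sum_measure_le_of_sparse {ι X : Type*} [MeasurableSpace X] (μ : Measure X)
    (P E : ι → Set X) (I : Finset ι) (Λ : ℝ≥0∞)
    (hE : (I : Set ι).PairwiseDisjoint E) (hEm : ∀ i ∈ I, MeasurableSet (E i))
    (hEP : ∀ i ∈ I, E i ⊆ P i) (hΛ : ∀ i ∈ I, μ (P i) ≤ Λ * μ (E i)) :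
    ∀ J ⊆ I, ∑ i ∈ J, μ (P i) ≤ Λ * μ (⋃ i ∈ J, P i) := by
  intro J hJ
  calc ∑ i ∈ J, μ (P i) ≤ ∑ i ∈ J, Λ * μ (E i) := Finset.sum_le_sum fun i hi => hΛ i (hJ hi)
    _ = Λ * μ (⋃ i ∈ J, E i) := by
      rw [← Finset.mul_sum, measure_biUnion_finset (hE.subset (by exact_mod_cast hJ))
        fun i hi => hEm i (hJ hi)]
    _ ≤ _ := by
      gcongr with i hi
      exact hEP i (hJ hi)

/-- A family that is Carleson with respect to `vol` is Carleson with respect to `μ`, with the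
constant `m * D`, if `μ (P i) ≤ D * μ F` for all large parts `F` of `P i`. The large part that is
used consists of the points that lie in at most `m` members `P j ⊆ P i` of the family: no point
belongs to more than `m` of these parts. -/
theorem sum_measure_le_of_doubling {ι X : Type*} [MeasurableSpace X] (vol μ : Measure X)
    (P E : ι → Set X) (I : Finset ι) (Λ D η : ℝ≥0∞) (m : ℕ) (hηt : η ≤ 1)
    (hP : ∀ i ∈ I, ∀ j ∈ I, Disjoint (P i) (P j) ∨ P i ⊆ P j ∨ P j ⊆ P i)
    (hPm : ∀ i ∈ I, MeasurableSet (P i)) (hPt : ∀ i ∈ I, vol (P i) ≠ ∞)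
    (hE : (I : Set ι).PairwiseDisjoint E) (hEm : ∀ i ∈ I, MeasurableSet (E i))
    (hEP : ∀ i ∈ I, E i ⊆ P i) (hΛ : ∀ i ∈ I, vol (P i) ≤ Λ * vol (E i))
    (hm : Λ ≤ (1 - η) * (m + 1))
    (hD : ∀ i ∈ I, ∀ F, MeasurableSet F → F ⊆ P i → η * vol (P i) ≤ vol F → μ (P i) ≤ D * μ F) :
    ∀ J ⊆ I, ∑ i ∈ J, μ (P i) ≤ (D * m) * μ (⋃ i ∈ J, P i) := by
  classical
  intro J hJ
  -- the number of members of the family between `x` and `P i`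
  let N : ι → X → ℝ≥0∞ := fun i x => ∑ j ∈ I with P j ⊆ P i, (P j).indicator 1 x
  have hNm : ∀ i, Measurable (N i) := by
    intro i
    refine Finset.measurable_fun_sum _ fun j hj => ?_
    exact measurable_one.indicator (hPm j (Finset.mem_filter.1 hj).1)
  let F : ι → Set X := fun i => P i ∩ {x | N i x ≤ m}
  have hFm : ∀ i ∈ I, MeasurableSet (F i) := fun i hi =>
    (hPm i hi).inter (measurableSet_le (hNm i) measurable_const)
  have hNcard : ∀ i x, N i x = ((I.filter fun j => P j ⊆ P i ∧ x ∈ P j).card : ℝ≥0∞) := by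
    intro i x
    simp only [N, indicator_apply, Pi.one_apply]
    rw [Finset.sum_ite, Finset.sum_const_zero, add_zero, Finset.sum_const, nsmul_eq_mul, mul_one,
      Finset.filter_filter]
  have hF : ∀ i ∈ I, η * vol (P i) ≤ vol (F i) := by
    intro i hi
    have h1 : ∫⁻ x in P i, N i x ∂vol ≤ Λ * vol (P i) := by
      calc ∫⁻ x in P i, N i x ∂vol ≤ ∫⁻ x, N i x ∂vol := setLIntegral_le_lintegral _ _
        _ = ∑ j ∈ I with P j ⊆ P i, vol (P j) := by
          rw [lintegral_finsetSum']
          · refine Finset.sum_congr rfl fun j hj => ?_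
            exact lintegral_indicator_one (hPm j (Finset.mem_filter.1 hj).1)
          · intro j hj
            exact (measurable_one.indicator (hPm j (Finset.mem_filter.1 hj).1)).aemeasurable
        _ ≤ Λ * vol (⋃ j ∈ I.filter fun j => P j ⊆ P i, P j) :=
          sum_measure_le_of_sparse vol P E I Λ hE hEm hEP hΛ _ (Finset.filter_subset _ _)
        _ ≤ _ := by
          gcongr
          exact iUnion₂_subset fun j hj => (Finset.mem_filter.1 hj).2
    have h2 : (m + 1 : ℝ≥0∞) * vol (P i \ F i) ≤ (m + 1) * ((1 - η) * vol (P i)) := by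
      calc (m + 1 : ℝ≥0∞) * vol (P i \ F i) = ∫⁻ x in P i \ F i, (m + 1 : ℝ≥0∞) ∂vol := by
            rw [setLIntegral_const]
        _ ≤ ∫⁻ x in P i \ F i, N i x ∂vol := by
          refine setLIntegral_mono' ((hPm i hi).diff (hFm i hi)) fun x hx => ?_
          have : ¬ N i x ≤ m := fun h => hx.2 ⟨hx.1, h⟩
          rw [hNcard] at this ⊢
          have h3 : m < (I.filter fun j => P j ⊆ P i ∧ x ∈ P j).card := by
            by_contra h4
            exact this (by exact_mod_cast not_lt.1 h4)
          exact_mod_cast h3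
        _ ≤ ∫⁻ x in P i, N i x ∂vol := lintegral_mono_set sdiff_subset
        _ ≤ _ := h1
        _ ≤ _ := by
          calc Λ * vol (P i) ≤ (1 - η) * (m + 1) * vol (P i) := by gcongr
            _ = _ := by ring
    have h3 : vol (P i \ F i) ≤ (1 - η) * vol (P i) :=
      (ENNReal.mul_le_mul_iff_right (by positivity) (by finiteness)).1 h2
    have h4 : vol (P i) ≤ vol (F i) + (1 - η) * vol (P i) := by
      calc vol (P i) = vol (F i ∪ (P i \ F i)) := by
            rw [union_sdiff_cancel inter_subset_left]
        _ ≤ _ := (measure_union_le _ _).trans (by gcongr)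
    have h5 : η * vol (P i) + (1 - η) * vol (P i) = vol (P i) := by
      rw [← add_mul, add_tsub_cancel_of_le hηt, one_mul]
    refine (ENNReal.add_le_add_iff_right ?_).1 (h5.trans_le h4)
    exact ENNReal.mul_ne_top (by simp) (hPt i hi)
  have hover : ∀ x, ∑ i ∈ J, (F i).indicator (1 : X → ℝ≥0∞) x ≤
      m * (⋃ i ∈ J, P i).indicator 1 x := by
    intro x
    have hc : ∑ i ∈ J, (F i).indicator (1 : X → ℝ≥0∞) x =
        ((J.filter fun i => x ∈ F i).card : ℝ≥0∞) := by
      simp only [indicator_apply, Pi.one_apply]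
      rw [Finset.sum_ite, Finset.sum_const_zero, add_zero, Finset.sum_const, nsmul_eq_mul, mul_one]
    rw [hc]
    set G := J.filter fun i => x ∈ F i with hG
    rcases G.eq_empty_or_nonempty with h0 | hne
    · simp [h0]
    have hGI : ∀ i ∈ G, i ∈ I ∧ x ∈ F i := fun i hi =>
      ⟨hJ (Finset.mem_filter.1 hi).1, (Finset.mem_filter.1 hi).2⟩
    -- the members that contain `x` form a chain; its largest member sees all of them
    obtain ⟨G', hG'G, hd, hcov⟩ := exists_disjoint_subfamily P G
      fun i hi j hj => hP i (hGI i hi).1 j (hGI j hj).1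
    obtain ⟨i₀, hi₀⟩ := hne
    obtain ⟨j₀, hj₀, -⟩ := hcov i₀ hi₀
    have hall : ∀ i ∈ G, P i ⊆ P j₀ := by
      intro i hi
      obtain ⟨j, hj, hij⟩ := hcov i hi
      have : j = j₀ := by
        by_contra hne
        exact (disjoint_left.1 (hd hj hj₀ hne) (hGI j (hG'G hj)).2.1) (hGI j₀ (hG'G hj₀)).2.1
      exact this ▸ hij
    have hx : x ∈ F j₀ := (hGI j₀ (hG'G hj₀)).2
    have hle : (G.card : ℝ≥0∞) ≤ m := by
      refine le_trans ?_ hx.2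
      rw [hNcard]
      gcongr
      intro i hi
      exact Finset.mem_filter.2 ⟨(hGI i hi).1, hall i hi, (hGI i hi).2.1⟩
    have hxU : x ∈ ⋃ i ∈ J, P i :=
      mem_biUnion (show j₀ ∈ (J : Set ι) from (Finset.mem_filter.1 (hG'G hj₀)).1) hx.1
    rw [indicator_of_mem hxU]
    simpa using hle
  calc ∑ i ∈ J, μ (P i) ≤ ∑ i ∈ J, D * μ (F i) := Finset.sum_le_sum fun i hi =>
        hD i (hJ hi) (F i) (hFm i (hJ hi)) inter_subset_left (hF i (hJ hi))
    _ = D * ∫⁻ x, ∑ i ∈ J, (F i).indicator 1 x ∂μ := by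
      rw [← Finset.mul_sum, lintegral_finsetSum']
      · congr 1
        refine Finset.sum_congr rfl fun i hi => ?_
        rw [lintegral_indicator_one (hFm i (hJ hi))]
      · intro i hi
        exact (measurable_one.indicator (hFm i (hJ hi))).aemeasurable
    _ ≤ D * ∫⁻ x, m * (⋃ i ∈ J, P i).indicator 1 x ∂μ := by
      gcongr with x
      exact hover x
    _ = _ := by
      have hU : MeasurableSet (⋃ i ∈ J, P i) :=
        Finset.measurableSet_biUnion J fun i hi => hPm i (hJ hi)
      rw [lintegral_const_mul _ (measurable_one.indicator hU), lintegral_indicator_one hU]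
      ring

/-! ### Cubes and shifted dyadic grids -/

theorem cube_eq_preimage {n : ℕ} (a : Fin n → ℝ) (ℓ : ℝ) :
    cube a ℓ = (WithLp.ofLp : Rn n → Fin n → ℝ) ⁻¹' (univ.pi fun i => Ico (a i) (a i + ℓ)) := by
  ext x
  simp [cube]

theorem measurableSet_cube {n : ℕ} (a : Fin n → ℝ) (ℓ : ℝ) : MeasurableSet (cube a ℓ) := by
  rw [cube_eq_preimage]
  exact (PiLp.volume_preserving_ofLp (Fin n)).measurable
    (MeasurableSet.univ_pi fun i => measurableSet_Ico)

theorem volume_cube {n : ℕ} (a : Fin n → ℝ) (ℓ : ℝ) :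
    volume (cube a ℓ) = ENNReal.ofReal ℓ ^ n := by
  rw [cube_eq_preimage, (PiLp.volume_preserving_ofLp (Fin n)).measure_preimage
    (MeasurableSet.univ_pi fun i => measurableSet_Ico).nullMeasurableSet, volume_pi_pi]
  simp

theorem IsCube.measurableSet {n : ℕ} {Q : Set (Rn n)} (hQ : IsCube Q) : MeasurableSet Q := by
  obtain ⟨a, ℓ, -, rfl⟩ := hQ
  exact measurableSet_cube a ℓ

theorem IsCube.volume_ne_top {n : ℕ} {Q : Set (Rn n)} (hQ : IsCube Q) : volume Q ≠ ∞ := by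
  obtain ⟨a, ℓ, -, rfl⟩ := hQ
  rw [volume_cube]
  finiteness

theorem IsCube.volume_ne_zero {n : ℕ} {Q : Set (Rn n)} (hQ : IsCube Q) : volume Q ≠ 0 := by
  obtain ⟨a, ℓ, h, rfl⟩ := hQ
  rw [volume_cube]
  exact pow_ne_zero _ (by simpa using h)

/-- The index, among the cubes of side length `2⁻ᵏ` of the shifted dyadic grid with parameter `a`,
of the cube that contains `x`. -/
def gridIndex {n : ℕ} (a : Fin n → Fin 3) (k : ℤ) (x : Rn n) : Fin n → ℤ :=
  fun i => ⌊(2 : ℝ) ^ k * x i - (-1 : ℝ) ^ k * ((a i : ℕ) : ℝ) / 3⌋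

/-- The cube with index `m` and side length `2⁻ᵏ` of the shifted dyadic grid with parameter `a`. -/
def gridCube {n : ℕ} (a : Fin n → Fin 3) (k : ℤ) (m : Fin n → ℤ) : Set (Rn n) :=
  cube (fun i => (2 : ℝ) ^ (-k) * ((m i : ℝ) + (-1 : ℝ) ^ k * ((a i : ℕ) : ℝ) / 3))
    ((2 : ℝ) ^ (-k))

theorem isShiftedDyadicCube_gridCube {n : ℕ} (a : Fin n → Fin 3) (k : ℤ) (m : Fin n → ℤ) :
    IsShiftedDyadicCube (gridCube a k m) := ⟨a, k, m, rfl⟩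

theorem isCube_gridCube {n : ℕ} (a : Fin n → Fin 3) (k : ℤ) (m : Fin n → ℤ) :
    IsCube (gridCube a k m) := ⟨_, _, by positivity, rfl⟩

theorem measurableSet_gridCube {n : ℕ} (a : Fin n → Fin 3) (k : ℤ) (m : Fin n → ℤ) :
    MeasurableSet (gridCube a k m) := measurableSet_cube _ _

theorem volume_gridCube {n : ℕ} (a : Fin n → Fin 3) (k : ℤ) (m : Fin n → ℤ) :
    volume (gridCube a k m) = ENNReal.ofReal ((2 : ℝ) ^ (-k)) ^ n := volume_cube _ _

theorem mem_gridCube {n : ℕ} {a : Fin n → Fin 3} {k : ℤ} {m : Fin n → ℤ} {x : Rn n} :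
    x ∈ gridCube a k m ↔ gridIndex a k x = m := by
  have h2 : (0 : ℝ) < 2 ^ k := by positivity
  rw [funext_iff]
  refine forall_congr' fun i => ?_
  rw [gridIndex, Int.floor_eq_iff, zpow_neg, ← mul_add_one, inv_mul_le_iff₀ h2, lt_inv_mul_iff₀ h2]
  constructor <;> rintro ⟨h, h'⟩ <;> constructor <;> linarith

theorem neg_one_zpow_eq_or_eq (k : ℤ) : (-1 : ℝ) ^ k = 1 ∨ (-1 : ℝ) ^ k = -1 :=
  (Int.even_or_odd k).imp Even.neg_one_zpow Odd.neg_one_zpow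

/-- The cubes of a shifted dyadic grid are refined by those of the next generation. -/
theorem gridIndex_eq_of_succ {n : ℕ} {a : Fin n → Fin 3} {k : ℤ} {x y : Rn n}
    (h : gridIndex a (k + 1) x = gridIndex a (k + 1) y) : gridIndex a k x = gridIndex a k y := by
  -- the shift by `(-1)ᵏ a / 3` at scale `k` differs from the one at scale `k + 1` by an integer
  obtain ⟨e, he⟩ : ∃ e : ℤ, (-1 : ℝ) ^ k = e := by
    rcases neg_one_zpow_eq_or_eq k with h | h
    · exact ⟨1, by simp [h]⟩
    · exact ⟨-1, by simp [h]⟩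
  have key : ∀ z : Rn n, ∀ i, gridIndex a k z i =
      ⌊(((gridIndex a (k + 1) z i - e * (a i : ℕ) : ℤ) : ℝ) / (2 : ℕ))⌋ := by
    intro z i
    have h1 : (gridIndex a (k + 1) z i - e * (a i : ℕ) : ℤ) =
        ⌊2 * ((2 : ℝ) ^ k * z i - (-1 : ℝ) ^ k * ((a i : ℕ) : ℝ) / 3)⌋ := by
      rw [gridIndex, ← Int.floor_sub_intCast]
      congr 1
      push_cast
      rw [zpow_add₀ (by norm_num), zpow_add₀ (by norm_num), he]
      ring
    rw [h1, Int.floor_div_natCast, Int.floor_intCast, gridIndex]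
    rw [← Int.floor_div_natCast]
    congr 1
    push_cast
    ring
  funext i
  rw [key x i, key y i, h]

theorem gridIndex_eq_of_le {n : ℕ} {a : Fin n → Fin 3} {k l : ℤ} (hkl : k ≤ l) {x y : Rn n}
    (h : gridIndex a l x = gridIndex a l y) : gridIndex a k x = gridIndex a k y := by
  induction l, hkl using Int.leInduction with
  | base => exact h
  | succ l _ ih => exact ih (gridIndex_eq_of_succ h)

/-- Two cubes of the same shifted dyadic grid are disjoint or nested, the smaller one inside. -/
theorem gridCube_disjoint_or_subset {n : ℕ} (a : Fin n → Fin 3) {k l : ℤ} (hkl : k ≤ l)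
    (m m' : Fin n → ℤ) :
    Disjoint (gridCube a k m) (gridCube a l m') ∨ gridCube a l m' ⊆ gridCube a k m := by
  rw [or_iff_not_imp_left, not_disjoint_iff]
  rintro ⟨x, hx, hx'⟩ y hy
  rw [mem_gridCube] at *
  rw [← hx]
  exact gridIndex_eq_of_le hkl (hy.trans hx'.symm)

theorem gridCube_nested {n : ℕ} (a : Fin n → Fin 3) (k l : ℤ) (m m' : Fin n → ℤ) :
    Disjoint (gridCube a k m) (gridCube a l m') ∨ gridCube a k m ⊆ gridCube a l m' ∨
      gridCube a l m' ⊆ gridCube a k m := by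
  rcases le_total k l with h | h
  · rcases gridCube_disjoint_or_subset a h m m' with h | h <;> tauto
  · rcases gridCube_disjoint_or_subset a h m' m with h | h
    · exact Or.inl h.symm
    · tauto

/-- The one-third trick: every cube of side length `2 ^ j` is contained in a shifted dyadic cube of
four times the side length. -/
theorem exists_gridCube_superset {n : ℕ} (b : Fin n → ℝ) (j : ℤ) :
    ∃ (a : Fin n → Fin 3) (m : Fin n → ℤ), cube b ((2 : ℝ) ^ j) ⊆ gridCube a (-(j + 2)) m := by
  set k : ℤ := -(j + 2) with hk
  have hjk : (2 : ℝ) ^ k * 2 ^ j = 1 / 4 := by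
    rw [← zpow_add₀ (by norm_num), hk]
    ring_nf
    norm_num
  have h2 : (0 : ℝ) < 2 ^ k := by positivity
  -- in each coordinate, one of the shifts `0` and `1` moves the lower end into `[0, 3/4]` mod `1`
  have key : ∀ y : ℝ, ∃ c : Fin 3, Int.fract (y - (-1 : ℝ) ^ k * ((c : ℕ) : ℝ) / 3) ≤ 3 / 4 := by
    intro y
    by_cases h : Int.fract y ≤ 3 / 4
    · exact ⟨0, by simpa using h⟩
    · push Not at h
      refine ⟨1, ?_⟩
      have h1 := Int.fract_lt_one y
      have h3 := Int.self_sub_fract y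
      rcases neg_one_zpow_eq_or_eq k with hs | hs <;> rw [hs]
      · have : Int.fract (y - 1 * ((1 : Fin 3) : ℕ) / 3) = Int.fract y - 1 / 3 := by
          rw [Int.fract_eq_iff]
          refine ⟨by linarith, by linarith, ⌊y⌋, ?_⟩
          rw [← h3]
          norm_num
        linarith
      · have : Int.fract (y - -1 * ((1 : Fin 3) : ℕ) / 3) = Int.fract y + 1 / 3 - 1 := by
          rw [Int.fract_eq_iff]
          refine ⟨by linarith, by linarith, ⌊y⌋ + 1, ?_⟩
          push_cast
          norm_num
          linarith
        linarith
  choose c hc using fun i => key (2 ^ k * b i)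
  refine ⟨c, fun i => ⌊(2 : ℝ) ^ k * b i - (-1 : ℝ) ^ k * ((c i : ℕ) : ℝ) / 3⌋, fun x hx => ?_⟩
  rw [mem_gridCube]
  funext i
  obtain ⟨h1, h3⟩ := hx i
  have h4 := hc i
  have h5 : (2 : ℝ) ^ k * b i ≤ 2 ^ k * x i := by gcongr
  have h6 : (2 : ℝ) ^ k * x i < 2 ^ k * b i + 1 / 4 := by
    rw [← hjk, ← mul_add]
    gcongr
  rw [gridIndex, Int.floor_eq_iff]
  rw [Int.fract] at h4
  constructor
  · exact (Int.floor_le _).trans (by linarith)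
  · linarith

theorem volume_gridCube_eq {n : ℕ} (a : Fin n → Fin 3) (j : ℤ) (m : Fin n → ℤ) (b : Fin n → ℝ) :
    volume (gridCube a (-(j + 2)) m) = 4 ^ n * volume (cube b ((2 : ℝ) ^ j)) := by
  rw [volume_gridCube, volume_cube, neg_neg, zpow_add₀ (by norm_num),
    ENNReal.ofReal_mul (by positivity), mul_pow, mul_comm]
  norm_num

theorem volume_gridCube_pred {n : ℕ} (a : Fin n → Fin 3) (k : ℤ) (m m' : Fin n → ℤ) :
    volume (gridCube a k m) = 2 ^ n * volume (gridCube a (k + 1) m') := by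
  rw [volume_gridCube, volume_gridCube, ← mul_pow]
  congr 1
  rw [show (2 : ℝ≥0∞) = ENNReal.ofReal 2 by simp, ← ENNReal.ofReal_mul (by norm_num)]
  congr 1
  rw [neg_add, zpow_add₀ (by norm_num)]
  norm_num
  ring

theorem dist_le_of_mem_cube {n : ℕ} {a : Fin n → ℝ} {ℓ : ℝ} (hℓ : 0 ≤ ℓ) {x y : Rn n}
    (hx : x ∈ cube a ℓ) (hy : y ∈ cube a ℓ) : dist x y ≤ (n + 1) * ℓ := by
  rw [EuclideanSpace.dist_eq]
  refine Real.sqrt_le_iff.2 ⟨by positivity, ?_⟩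
  calc ∑ i, dist (x i) (y i) ^ 2 ≤ ∑ i : Fin n, ℓ ^ 2 := by
        refine Finset.sum_le_sum fun i _ => ?_
        obtain ⟨h1, h2⟩ := hx i
        obtain ⟨h3, h4⟩ := hy i
        refine pow_le_pow_left₀ dist_nonneg ?_ 2
        rw [Real.dist_eq, abs_le]
        constructor <;> linarith
    _ = n * ℓ ^ 2 := by simp
    _ ≤ ((n + 1) * ℓ) ^ 2 := by
        rw [mul_pow]
        gcongr
        nlinarith [(Nat.cast_nonneg n : (0 : ℝ) ≤ n)]

theorem IsCube.isBounded {n : ℕ} {Q : Set (Rn n)} (hQ : IsCube Q) : Bornology.IsBounded Q := by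
  obtain ⟨a, ℓ, h, rfl⟩ := hQ
  exact Metric.isBounded_iff.2 ⟨(n + 1) * ℓ, fun _ hx _ hy => dist_le_of_mem_cube h.le hx hy⟩

/-- Lebesgue differentiation along a shifted dyadic grid, in the form of an upper bound. -/
theorem ae_le_of_grid_average_le {n : ℕ} (a : Fin n → Fin 3) {U : Rn n → ℝ≥0}
    (hU : LocallyIntegrable (fun x => (U x : ℝ)) volume) :
    ∀ᵐ x : Rn n, ∀ h : ℝ≥0, (∀ᶠ k : ℕ in Filter.atTop,
      ∫⁻ y in gridCube a k (gridIndex a k x), U y ≤ h * volume (gridCube a k (gridIndex a k x))) →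
      U x ≤ h := by
  filter_upwards [(Besicovitch.vitaliFamily (volume : Measure (Rn n))).ae_tendsto_average_norm_sub
    hU] with x hx h hh
  set r : ℕ → ℝ := fun k => (n + 1) * (2 : ℝ) ^ (-(k : ℤ)) with hr
  have hrpos : ∀ k, 0 < r k := fun k => by positivity
  have hr0 : Filter.Tendsto r Filter.atTop (nhdsWithin 0 (Ioi 0)) := by
    refine tendsto_nhdsWithin_iff.2 ⟨?_, Filter.Eventually.of_forall hrpos⟩
    have : Filter.Tendsto (fun k : ℕ => ((n : ℝ) + 1) * (1 / 2 : ℝ) ^ k) Filter.atTop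
        (nhds ((n + 1) * 0)) :=
      (tendsto_pow_atTop_nhds_zero_of_lt_one (by norm_num) (by norm_num)).const_mul _
    simpa [hr] using this
  have hlim := (hx.comp (Besicovitch.tendsto_filterAt volume x)).comp hr0
  set V := (volume (Metric.ball (0 : Rn n) 1)).toReal with hV
  set c : ℝ := (n + 1) ^ n * V
  have hlim2 : Filter.Tendsto (fun k => c * (⨍ y in Metric.closedBall x (r k), ‖(U y : ℝ) - U x‖) + h)
      Filter.atTop (nhds (c * 0 + h)) := (hlim.const_mul c).add_const _
  rw [mul_zero, zero_add] at hlim2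
  rw [← NNReal.coe_le_coe]
  refine ge_of_tendsto hlim2 ?_
  filter_upwards [hh] with k hk
  set Q := gridCube a k (gridIndex a k x) with hQ
  have hxQ : x ∈ Q := mem_gridCube.2 rfl
  have hQc : IsCube Q := isCube_gridCube _ _ _
  have hQB : Q ⊆ Metric.closedBall x (r k) := fun y hy =>
    Metric.mem_closedBall.2 (dist_le_of_mem_cube (by positivity) hy hxQ)
  have hintB : IntegrableOn (fun y => (U y : ℝ)) (Metric.closedBall x (r k)) :=
    hU.integrableOn_isCompact (isCompact_closedBall _ _)
  have hintB' : IntegrableOn (fun y => (U y : ℝ) - U x) (Metric.closedBall x (r k)) :=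
    hintB.sub (integrableOn_const (isCompact_closedBall x (r k)).measure_lt_top.ne)
  have hvQ : volume.real Q = ((2 : ℝ) ^ (-(k : ℤ))) ^ n := by
    rw [Measure.real, volume_gridCube, ENNReal.toReal_pow, ENNReal.toReal_ofReal (by positivity)]
  have hvQpos : 0 < volume.real Q := by rw [hvQ]; positivity
  have h1 : ∫ y in Q, (U y : ℝ) ≤ h * volume.real Q := by
    rw [integral_eq_lintegral_of_nonneg_ae (Filter.Eventually.of_forall fun y => by positivity)
      (hintB.mono_set hQB).aestronglyMeasurable]
    refine ENNReal.toReal_le_of_le_ofReal (by positivity) ?_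
    rw [ENNReal.ofReal_mul (by positivity), Measure.real,
      ENNReal.ofReal_toReal hQc.volume_ne_top]
    simpa using hk
  have h2 : ∫ y in Q, ‖(U y : ℝ) - U x‖ ≤ ∫ y in Metric.closedBall x (r k), ‖(U y : ℝ) - U x‖ :=
    setIntegral_mono_set hintB'.norm (Filter.Eventually.of_forall fun y => norm_nonneg _)
      (Filter.Eventually.of_forall hQB)
  have h3 : (U x : ℝ) * volume.real Q ≤
      (∫ y in Q, ‖(U y : ℝ) - U x‖) + ∫ y in Q, (U y : ℝ) := by
    rw [← integral_add (hintB'.mono_set hQB).norm (hintB.mono_set hQB), mul_comm, ← smul_eq_mul,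
      ← setIntegral_const]
    refine integral_mono (integrableOn_const hQc.volume_ne_top)
      ((hintB'.mono_set hQB).norm.add (hintB.mono_set hQB)) fun y => ?_
    have := neg_abs_le ((U y : ℝ) - U x)
    simp only [Real.norm_eq_abs]
    linarith
  have h4 : ∫ y in Metric.closedBall x (r k), ‖(U y : ℝ) - U x‖ =
      c * volume.real Q * ⨍ y in Metric.closedBall x (r k), ‖(U y : ℝ) - U x‖ := by
    have hvB : volume.real (Metric.closedBall x (r k)) = c * volume.real Q := by
      rw [Measure.real, Measure.addHaar_closedBall _ _ (hrpos k).le, ENNReal.toReal_mul,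
        ENNReal.toReal_ofReal (by positivity), hvQ, finrank_euclideanSpace_fin, hr, mul_pow]
      ring
    have hVpos : 0 < V := ENNReal.toReal_pos (Metric.measure_ball_pos _ _ one_pos).ne'
      measure_ball_lt_top.ne
    have hc : 0 < c := by positivity
    rw [setAverage_eq, hvB, smul_eq_mul, ← mul_assoc, mul_inv_cancel₀ (by positivity), one_mul]
  rw [h4] at h2
  have : (U x : ℝ) * volume.real Q ≤ (c * (⨍ y in Metric.closedBall x (r k), ‖(U y : ℝ) - U x‖) + h)
      * volume.real Q := by linarith
  exact le_of_mul_le_mul_right this hvQpos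

/-! ### Self-improvement of reverse Hölder weights -/

/-- The set where some average of `U` over a dyadic subcube of the cube `gridCube a k m` exceeds
`h`. -/
def dyadicLevelSet {n : ℕ} (a : Fin n → Fin 3) (k : ℤ) (m : Fin n → ℤ) (U : Rn n → ℝ≥0)
    (h : ℝ≥0∞) : Set (Rn n) :=
  {x | x ∈ gridCube a k m ∧ ∃ j : ℕ, h * volume (gridCube a (k + j) (gridIndex a (k + j) x)) <
    ∫⁻ y in gridCube a (k + j) (gridIndex a (k + j) x), U y}

theorem dyadicLevelSet_anti {n : ℕ} (a : Fin n → Fin 3) (k : ℤ) (m : Fin n → ℤ)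
    (U : Rn n → ℝ≥0) {h h' : ℝ≥0∞} (hh : h ≤ h') :
    dyadicLevelSet a k m U h' ⊆ dyadicLevelSet a k m U h := by
  rintro x ⟨hx, j, hj⟩
  exact ⟨hx, j, lt_of_le_of_lt (by gcongr) hj⟩

/-- Calderón–Zygmund decomposition: above the average over the whole cube, the level set is a
disjoint union of dyadic subcubes on which the average of `U` is comparable to the level. -/
theorem exists_dyadicLevelSet_eq_biUnion {n : ℕ} (a : Fin n → Fin 3) (k : ℤ) (m : Fin n → ℤ)
    (U : Rn n → ℝ≥0) {h : ℝ≥0∞} (hh : ∫⁻ y in gridCube a k m, U y ≤ h * volume (gridCube a k m)) :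
    ∃ S : Set (ℕ × (Fin n → ℤ)), S.PairwiseDisjoint (fun s => gridCube a (k + s.1) s.2) ∧
      dyadicLevelSet a k m U h = ⋃ s ∈ S, gridCube a (k + s.1) s.2 ∧
      ∀ s ∈ S, h * volume (gridCube a (k + s.1) s.2) ≤ ∫⁻ y in gridCube a (k + s.1) s.2, U y ∧
        ∫⁻ y in gridCube a (k + s.1) s.2, U y ≤ 2 ^ n * h * volume (gridCube a (k + s.1) s.2) := by
  classical
  have hmem : ∀ (x : Rn n) (l : ℤ), x ∈ gridCube a l (gridIndex a l x) :=
    fun x l => mem_gridCube.2 rfl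
  have hsub : ∀ (x : Rn n) (i j : ℕ), i ≤ j → gridCube a (k + j) (gridIndex a (k + j) x) ⊆
      gridCube a (k + i) (gridIndex a (k + i) x) := by
    intro x i j hij y hy
    rw [mem_gridCube] at hy ⊢
    exact gridIndex_eq_of_le (by gcongr) hy
  let big : ℕ → (Fin n → ℤ) → Prop := fun j m' =>
    h * volume (gridCube a (k + j) m') < ∫⁻ y in gridCube a (k + j) m', U y
  -- the maximal cubes: no dyadic ancestor inside the given cube is big
  let S : Set (ℕ × (Fin n → ℤ)) := {s | ∃ x ∈ gridCube a k m, s.2 = gridIndex a (k + s.1) x ∧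
    big s.1 s.2 ∧ ∀ i < s.1, ¬ big i (gridIndex a (k + i) x)}
  refine ⟨S, ?_, ?_, ?_⟩
  · have main : ∀ s ∈ S, ∀ s' ∈ S, s.1 ≤ s'.1 → s ≠ s' →
        Disjoint (gridCube a (k + s.1) s.2) (gridCube a (k + s'.1) s'.2) := by
      rintro ⟨j, m₁⟩ ⟨x, -, hx, hb, -⟩ ⟨j', m₂⟩ ⟨x', -, hx', hb', hanc⟩ hjj hne
      dsimp only at *
      rw [disjoint_left]
      intro y hy hy'
      rw [mem_gridCube] at hy hy'
      rcases hjj.lt_or_eq with hlt | rfl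
      · refine hanc j hlt ?_
        have : gridIndex a (k + j) x' = m₁ := by
          rw [← hy]
          exact gridIndex_eq_of_le (by gcongr) (hx'.symm.trans hy'.symm)
        rwa [this]
      · exact hne (by rw [← hy, ← hy'])
    intro s hs s' hs' hne
    rcases le_total s.1 s'.1 with h | h
    · exact main s hs s' hs' h hne
    · exact (main s' hs' s hs h hne.symm).symm
  · ext x
    simp only [mem_iUnion, exists_prop]
    constructor
    · rintro ⟨hx, hj⟩
      refine ⟨(Nat.find hj, gridIndex a (k + Nat.find hj) x), ⟨x, hx, rfl, Nat.find_spec hj, ?_⟩,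
        hmem x _⟩
      intro i hi
      exact Nat.find_min hj hi
    · rintro ⟨⟨j, m'⟩, ⟨x', hx', hm', hb, -⟩, hx⟩
      dsimp only at *
      rw [mem_gridCube] at hx
      refine ⟨?_, j, ?_⟩
      · rw [mem_gridCube] at hx' ⊢
        rw [← hx']
        exact gridIndex_eq_of_le (by linarith [(Nat.cast_nonneg j : (0 : ℤ) ≤ j)])
          (hx.trans hm')
      · rw [hx]
        exact hb
  · rintro ⟨j, m'⟩ ⟨x, hx, hm', hb, hanc⟩
    dsimp only at *
    refine ⟨hb.le, ?_⟩
    rcases j with _ | j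
    · exfalso
      have h0 : m' = m := by
        rw [hm']
        simpa [mem_gridCube] using hx
      simp only [big, h0, Nat.cast_zero, add_zero] at hb
      exact absurd hh (not_le.2 hb)
    · have h1 := not_lt.1 (hanc j (Nat.lt_succ_self j))
      calc ∫⁻ y in gridCube a (k + (j + 1 : ℕ)) m', (U y : ℝ≥0∞)
          ≤ ∫⁻ y in gridCube a (k + j) (gridIndex a (k + j) x), U y := by
            rw [hm']
            exact lintegral_mono_set (hsub x j (j + 1) (Nat.le_succ j))
        _ ≤ h * volume (gridCube a (k + j) (gridIndex a (k + j) x)) := h1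
        _ = 2 ^ n * h * volume (gridCube a (k + (j + 1 : ℕ)) m') := by
            rw [volume_gridCube_pred a (k + j) _ m', Nat.cast_succ, add_assoc]
            ring

theorem measurableSet_dyadicLevelSet {n : ℕ} (a : Fin n → Fin 3) (k : ℤ) (m : Fin n → ℤ)
    (U : Rn n → ℝ≥0) {h : ℝ≥0∞} (hh : ∫⁻ y in gridCube a k m, U y ≤ h * volume (gridCube a k m)) :
    MeasurableSet (dyadicLevelSet a k m U h) := by
  obtain ⟨S, -, hS, -⟩ := exists_dyadicLevelSet_eq_biUnion a k m U hh
  rw [hS]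
  exact MeasurableSet.biUnion (to_countable S) fun s _ => measurableSet_gridCube _ _ _

/-- A dyadic geometric sum below `y` is dominated by its last term. -/
theorem sum_geometric_lt_le {κ : ℝ} (hκ : 0 < κ) {y : ℝ} (hy : 0 ≤ y) (L : ℕ) :
    ∀ {c : ℝ}, 0 < c → (2 ^ κ - 1) * ∑ l ∈ Finset.range L,
      (if 2 ^ l * c < y then (2 ^ l * c) ^ κ else 0) ≤ (2 * y) ^ κ := by
  have h2κ : (1 : ℝ) < 2 ^ κ := Real.one_lt_rpow (by norm_num) hκ
  have hzero : ∀ {c : ℝ} (L : ℕ), 0 < c → y ≤ c → ∑ l ∈ Finset.range L,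
      (if 2 ^ l * c < y then (2 ^ l * c) ^ κ else 0) = 0 := by
    intro c L hc hyc
    refine Finset.sum_eq_zero fun l _ => if_neg (not_lt.2 (hyc.trans ?_))
    exact le_mul_of_one_le_left hc.le (one_le_pow₀ (by norm_num))
  -- below `2 * y` the bound holds with the gain `c ^ κ`, which makes the induction work
  have key : ∀ L : ℕ, ∀ {c : ℝ}, 0 < c → c ≤ 2 * y → (2 ^ κ - 1) * ∑ l ∈ Finset.range L,
      (if 2 ^ l * c < y then (2 ^ l * c) ^ κ else 0) ≤ (2 * y) ^ κ - c ^ κ := by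
    intro L
    induction L with
    | zero =>
      intro c hc hcy
      simpa using Real.rpow_le_rpow hc.le hcy hκ.le
    | succ L ih =>
      intro c hc hcy
      rcases lt_or_ge c y with h | h
      · rw [Finset.sum_range_succ']
        have h1 := ih (c := 2 * c) (by positivity) (by linarith)
        have h2 : ∀ l : ℕ, (2 : ℝ) ^ (l + 1) * c = 2 ^ l * (2 * c) := fun l => by ring
        simp only [h2, pow_zero, one_mul, if_pos h]
        rw [Real.mul_rpow (x := 2) (y := c) (by norm_num) hc.le] at h1
        rw [mul_add]
        linarith
      · rw [hzero _ hc h, mul_zero]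
        simpa using Real.rpow_le_rpow hc.le hcy hκ.le
  intro c hc
  rcases le_or_gt c (2 * y) with h | h
  · exact (key L hc h).trans (by linarith [Real.rpow_nonneg hc.le κ])
  · rw [hzero _ hc (by linarith), mul_zero]
    positivity

/-- The mass of the high level sets of a reverse Hölder weight decays: over `L` consecutive dyadic
levels, the sum of the masses is at most a constant times the mass of the first one. -/
theorem mul_lintegral_dyadicLevelSet_le {n : ℕ} {r : ℝ} (hr : 1 < r) {U : Rn n → ℝ≥0}
    (hU : Measurable U) (R : ℝ≥0) (a : Fin n → Fin 3) (k : ℤ) (m : Fin n → ℤ)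
    (hRH : ∀ k m, ∫⁻ x in gridCube a k m, (U x : ℝ≥0∞) ^ r ≤ R ^ r *
      ((∫⁻ x in gridCube a k m, U x) / volume (gridCube a k m)) ^ r * volume (gridCube a k m))
    {h₀ : ℝ≥0} (hh₀ : 0 < h₀)
    (hh : ∫⁻ y in gridCube a k m, U y ≤ h₀ * volume (gridCube a k m)) (L : ℕ) :
    (L : ℝ≥0∞) * ∫⁻ x in dyadicLevelSet a k m U (2 ^ L * h₀), (U x : ℝ≥0∞) ^ r ≤
      ENNReal.ofReal (2 * (2 ^ n * R) ^ r * (4 ^ (r - 1) / (2 ^ (r - 1) - 1))) *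
        ∫⁻ x in dyadicLevelSet a k m U h₀, (U x : ℝ≥0∞) ^ r := by
  set Q := gridCube a k m with hQ
  set Ω : ℕ → Set (Rn n) := fun l => dyadicLevelSet a k m U (2 ^ l * h₀) with hΩ
  have hκ : 0 < r - 1 := by linarith
  have h2κ : (1 : ℝ) < 2 ^ (r - 1) := Real.one_lt_rpow (by norm_num) hκ
  have hle : ∀ l : ℕ, ∫⁻ y in Q, (U y : ℝ≥0∞) ≤ 2 ^ l * h₀ * volume Q := by
    intro l
    refine hh.trans ?_
    gcongr
    exact le_mul_of_one_le_left (by positivity) (one_le_pow₀ (by norm_num))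
  have hΩm : ∀ l, MeasurableSet (Ω l) := fun l => measurableSet_dyadicLevelSet a k m U (hle l)
  have hΩanti : ∀ {i l}, i ≤ l → Ω l ⊆ Ω i := by
    intro i l hil
    refine dyadicLevelSet_anti a k m U ?_
    gcongr
    norm_num
  have hΩQ : ∀ l, Ω l ⊆ Q := fun l x hx => hx.1
  have hUr : Measurable fun x => (U x : ℝ≥0∞) ^ r := by fun_prop
  have hU' : Measurable fun x => (U x : ℝ≥0∞) := by fun_prop
  have hsize : ∀ l, (2 ^ l * h₀ : ℝ≥0∞) * volume (Ω l) ≤ ∫⁻ x in Ω l, U x ∧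
      ∫⁻ x in Ω l, (U x : ℝ≥0∞) ^ r ≤ (2 ^ n * R) ^ r * (2 ^ l * h₀ : ℝ≥0∞) ^ r * volume (Ω l) := by
    intro l
    obtain ⟨S, hd, hS, hb⟩ := exists_dyadicLevelSet_eq_biUnion a k m U (hle l)
    have hSΩ : Ω l = ⋃ s ∈ S, gridCube a (k + s.1) s.2 := hS
    have hc := to_countable S
    have hm : ∀ s ∈ S, MeasurableSet (gridCube a (k + s.1) s.2) :=
      fun s _ => measurableSet_gridCube _ _ _
    rw [hSΩ, measure_biUnion hc hd hm, lintegral_biUnion hc hm hd, lintegral_biUnion hc hm hd,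
      ← ENNReal.tsum_mul_left, ← ENNReal.tsum_mul_left]
    refine ⟨ENNReal.tsum_le_tsum fun s => (hb s s.2).1, ENNReal.tsum_le_tsum fun s => ?_⟩
    have hcube := isCube_gridCube a (k + (s : ℕ × (Fin n → ℤ)).1) (s : ℕ × (Fin n → ℤ)).2
    refine (hRH _ _).trans ?_
    gcongr ?_ * _
    rw [← ENNReal.mul_rpow_of_nonneg _ _ (by linarith), ← ENNReal.mul_rpow_of_nonneg _ _ (by linarith)]
    refine ENNReal.rpow_le_rpow ?_ (by linarith)
    calc (R : ℝ≥0∞) * ((∫⁻ x in gridCube a (k + (s : ℕ × (Fin n → ℤ)).1)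
            (s : ℕ × (Fin n → ℤ)).2, U x) / volume (gridCube a (k + (s : ℕ × (Fin n → ℤ)).1)
            (s : ℕ × (Fin n → ℤ)).2)) ≤ R * (2 ^ n * (2 ^ l * h₀)) := by
          gcongr
          exact ENNReal.div_le_of_le_mul (hb s s.2).2
      _ = _ := by ring
  have hfin : ∀ l, volume (Ω l) ≠ ∞ := fun l =>
    measure_ne_top_of_subset (hΩQ l) (isCube_gridCube a k m).volume_ne_top
  -- only the part where `U` exceeds half the level matters
  have hupper : ∀ l, (2 ^ l * h₀ : ℝ≥0∞) * volume (Ω l) ≤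
      2 * ∫⁻ x in Ω l, {x | 2 ^ l * h₀ < 2 * U x}.indicator (fun x => (U x : ℝ≥0∞)) x := by
    intro l
    set I := ∫⁻ x in Ω l, {x | 2 ^ l * h₀ < 2 * U x}.indicator (fun x => (U x : ℝ≥0∞)) x
    set V := (2 ^ l * h₀ : ℝ≥0∞) * volume (Ω l) with hV
    have h1 : V ≤ V / 2 + I := by
      refine (hsize l).1.trans ?_
      calc ∫⁻ x in Ω l, (U x : ℝ≥0∞) ≤ ∫⁻ x in Ω l, ((2 ^ l * h₀ / 2 : ℝ≥0∞) +
            {x | 2 ^ l * h₀ < 2 * U x}.indicator (fun x => (U x : ℝ≥0∞)) x) := by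
            refine lintegral_mono fun x => ?_
            by_cases hx : 2 ^ l * h₀ < 2 * U x
            · rw [indicator_of_mem (show x ∈ {x | 2 ^ l * h₀ < 2 * U x} from hx)]
              exact le_add_self
            · rw [indicator_of_notMem (show x ∉ {x | 2 ^ l * h₀ < 2 * U x} from hx), add_zero,
                ENNReal.le_div_iff_mul_le (by simp) (by simp), mul_comm]
              exact_mod_cast not_lt.1 hx
        _ = _ := by
            rw [lintegral_add_left measurable_const, setLIntegral_const, hV]
            congr 1
            rw [ENNReal.div_eq_inv_mul, ENNReal.div_eq_inv_mul]
            ring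
    have hVt : V ≠ ∞ := ENNReal.mul_ne_top (by finiteness) (hfin l)
    have h2 : V / 2 + V / 2 ≤ V / 2 + I := by rwa [ENNReal.add_halves]
    have h3 := (ENNReal.add_le_add_iff_left (ENNReal.div_ne_top hVt (by simp))).1 h2
    rwa [ENNReal.div_le_iff_le_mul (by simp) (by simp), mul_comm] at h3
  have hsum3 : ∀ l, ∫⁻ x in Ω l, (U x : ℝ≥0∞) ^ r ≤ 2 * (2 ^ n * R) ^ r *
      ∫⁻ x in Ω 0, (U x : ℝ≥0∞) * ENNReal.ofReal (if 2 ^ l * (h₀ : ℝ) < 2 * U x then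
        (2 ^ l * (h₀ : ℝ)) ^ (r - 1) else 0) := by
    intro l
    have hlpos : (2 ^ l * h₀ : ℝ≥0∞) ≠ 0 := by
      have : (h₀ : ℝ≥0∞) ≠ 0 := by simpa using hh₀.ne'
      positivity
    have hlt : (2 ^ l * h₀ : ℝ≥0∞) ≠ ∞ := by finiteness
    have hl : ENNReal.ofReal ((2 ^ l * (h₀ : ℝ)) ^ (r - 1)) = (2 ^ l * h₀ : ℝ≥0∞) ^ (r - 1) := by
      rw [← ENNReal.ofReal_rpow_of_nonneg (by positivity) hκ.le, ENNReal.ofReal_mul (by positivity),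
        ENNReal.ofReal_pow (by norm_num)]
      simp
    calc ∫⁻ x in Ω l, (U x : ℝ≥0∞) ^ r
        ≤ (2 ^ n * R) ^ r * (2 ^ l * h₀ : ℝ≥0∞) ^ r * volume (Ω l) := (hsize l).2
      _ = (2 ^ n * R) ^ r * (2 ^ l * h₀ : ℝ≥0∞) ^ (r - 1) * ((2 ^ l * h₀) * volume (Ω l)) := by
          rw [ENNReal.rpow_sub _ _ hlpos hlt, ENNReal.rpow_one, div_eq_mul_inv]
          calc _ = (2 ^ n * R) ^ r * (2 ^ l * h₀ : ℝ≥0∞) ^ r * volume (Ω l) *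
                ((2 ^ l * h₀ : ℝ≥0∞)⁻¹ * (2 ^ l * h₀)) := by
                rw [ENNReal.inv_mul_cancel hlpos hlt, mul_one]
            _ = _ := by ring
      _ ≤ (2 ^ n * R) ^ r * (2 ^ l * h₀ : ℝ≥0∞) ^ (r - 1) *
          (2 * ∫⁻ x in Ω l, {x | 2 ^ l * h₀ < 2 * U x}.indicator (fun x => (U x : ℝ≥0∞)) x) := by
          exact mul_le_mul_right (hupper l) _
      _ = 2 * (2 ^ n * R) ^ r * ∫⁻ x in Ω l, (2 ^ l * h₀ : ℝ≥0∞) ^ (r - 1) *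
          {x | 2 ^ l * h₀ < 2 * U x}.indicator (fun x => (U x : ℝ≥0∞)) x := by
          rw [lintegral_const_mul' _ _ (by finiteness)]
          ring
      _ ≤ 2 * (2 ^ n * R) ^ r * ∫⁻ x in Ω 0, (2 ^ l * h₀ : ℝ≥0∞) ^ (r - 1) *
          {x | 2 ^ l * h₀ < 2 * U x}.indicator (fun x => (U x : ℝ≥0∞)) x := by
          gcongr
          exact hΩanti (Nat.zero_le l)
      _ = _ := by
          congr 1
          refine lintegral_congr fun x => ?_
          by_cases hx : 2 ^ l * h₀ < 2 * U x
          · have hx' : 2 ^ l * (h₀ : ℝ) < 2 * U x := by exact_mod_cast hx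
            rw [indicator_of_mem (show x ∈ {x | 2 ^ l * h₀ < 2 * U x} from hx), if_pos hx', hl,
              mul_comm]
          · have hx' : ¬ 2 ^ l * (h₀ : ℝ) < 2 * U x := by exact_mod_cast hx
            rw [indicator_of_notMem (show x ∉ {x | 2 ^ l * h₀ < 2 * U x} from hx), if_neg hx']
            simp
  have hΩ0 : Ω 0 = dyadicLevelSet a k m U h₀ := by simp [hΩ]
  calc (L : ℝ≥0∞) * ∫⁻ x in Ω L, (U x : ℝ≥0∞) ^ r
      = ∑ l ∈ Finset.range L, ∫⁻ x in Ω L, (U x : ℝ≥0∞) ^ r := by simp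
    _ ≤ ∑ l ∈ Finset.range L, ∫⁻ x in Ω l, (U x : ℝ≥0∞) ^ r := by
        refine Finset.sum_le_sum fun l hl => lintegral_mono_set ?_
        exact hΩanti (Finset.mem_range.1 hl).le
    _ ≤ ∑ l ∈ Finset.range L, 2 * (2 ^ n * R) ^ r *
      ∫⁻ x in Ω 0, (U x : ℝ≥0∞) * ENNReal.ofReal (if 2 ^ l * (h₀ : ℝ) < 2 * U x then
        (2 ^ l * (h₀ : ℝ)) ^ (r - 1) else 0) := Finset.sum_le_sum fun l _ => hsum3 l
    _ = 2 * (2 ^ n * R) ^ r * ∫⁻ x in Ω 0, (U x : ℝ≥0∞) * ENNReal.ofReal (∑ l ∈ Finset.range L,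
        if 2 ^ l * (h₀ : ℝ) < 2 * U x then (2 ^ l * (h₀ : ℝ)) ^ (r - 1) else 0) := by
        rw [← Finset.mul_sum, ← lintegral_finsetSum]
        · congr 1
          refine lintegral_congr fun x => ?_
          rw [ENNReal.ofReal_sum_of_nonneg, Finset.mul_sum]
          intro l _
          split_ifs <;> positivity
        · intro l _
          refine hU'.mul (Measurable.ennreal_ofReal ?_)
          refine Measurable.ite ?_ measurable_const measurable_const
          exact measurableSet_lt measurable_const (by fun_prop)
    _ ≤ 2 * (2 ^ n * R) ^ r * ∫⁻ x in Ω 0,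
          ENNReal.ofReal (4 ^ (r - 1) / (2 ^ (r - 1) - 1)) * (U x : ℝ≥0∞) ^ r := by
        refine mul_le_mul_right (lintegral_mono fun x => ?_) _
        have h1 := sum_geometric_lt_le hκ (y := 2 * (U x : ℝ)) (by positivity) L
          (c := h₀) (by exact_mod_cast hh₀)
        rw [mul_comm, ← le_div_iff₀ (by linarith), ← mul_assoc,
          Real.mul_rpow (by norm_num) (by positivity)] at h1
        have h2 : (U x : ℝ≥0∞) ^ r = ENNReal.ofReal ((U x : ℝ) ^ (r - 1)) * U x := by
          rw [← ENNReal.ofReal_rpow_of_nonneg (by positivity) hκ.le, ENNReal.ofReal_coe_nnreal]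
          nth_rewrite 3 [← ENNReal.rpow_one (U x : ℝ≥0∞)]
          rw [← ENNReal.rpow_add_of_nonneg _ _ hκ.le zero_le_one]
          ring_nf
        rw [h2, ← mul_assoc, ← ENNReal.ofReal_mul (div_nonneg (by positivity) (by linarith)),
          mul_comm]
        gcongr
        refine h1.trans (le_of_eq ?_)
        norm_num
        ring
    _ = _ := by
        rw [lintegral_const_mul _ hUr, ← mul_assoc, hΩ0]
        congr 1
        rw [ENNReal.ofReal_mul (by positivity), ENNReal.ofReal_mul (by norm_num),
          ← ENNReal.ofReal_rpow_of_nonneg (by positivity) (by linarith),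
          ENNReal.ofReal_mul (by positivity), ENNReal.ofReal_pow (by norm_num)]
        simp

/-- Optimization over the number `j` of steps: with `δ = 1 / (κ + 1)`, both terms are comparable to
`τ ^ δ` when `2 ^ j ≈ τ ^ (-δ)`. -/
theorem exists_two_rpow_add_le {κ τ : ℝ} (hκ : 0 ≤ κ) (hτ : 0 < τ) (hτ1 : τ ≤ 1) :
    ∃ j : ℕ, (1 / 2 : ℝ) ^ j + 2 ^ (j * κ) * τ ≤ 4 * τ ^ (1 / (κ + 1)) := by
  set δ := 1 / (κ + 1) with hδ
  have hδpos : 0 < δ := by positivity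
  have hlog : 0 ≤ Real.logb 2 (1 / τ) :=
    Real.logb_nonneg (by norm_num) (by rw [le_div_iff₀ hτ]; linarith)
  set j := ⌊δ * Real.logb 2 (1 / τ)⌋₊ with hj
  have h1 : (j : ℝ) ≤ δ * Real.logb 2 (1 / τ) := Nat.floor_le (by positivity)
  have h2 : δ * Real.logb 2 (1 / τ) < j + 1 := Nat.lt_floor_add_one _
  have hτj : τ = (2 : ℝ) ^ (-Real.logb 2 (1 / τ)) := by
    rw [one_div, Real.logb_inv, neg_neg, Real.rpow_logb (by norm_num) (by norm_num) hτ]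
  have h3 : (1 / 2 : ℝ) ^ j ≤ 2 * τ ^ δ := by
    calc (1 / 2 : ℝ) ^ j = 2 ^ (-(j : ℝ)) := by
          rw [Real.rpow_neg (by norm_num), Real.rpow_natCast]
          simp
      _ ≤ 2 ^ (1 + -Real.logb 2 (1 / τ) * δ) := by
          refine Real.rpow_le_rpow_of_exponent_le (by norm_num) (by linarith)
      _ = 2 * τ ^ δ := by
          rw [Real.rpow_add (by norm_num), Real.rpow_one, Real.rpow_mul (by norm_num), ← hτj]
  have h4 : 2 ^ (j * κ) * τ ≤ (1 / 2 : ℝ) ^ j := by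
    calc 2 ^ (j * κ) * τ = 2 ^ (j * κ + -Real.logb 2 (1 / τ)) := by
          rw [Real.rpow_add (by norm_num), ← hτj]
      _ ≤ 2 ^ (-(j : ℝ)) := by
          refine Real.rpow_le_rpow_of_exponent_le (by norm_num) ?_
          have h5 : (j : ℝ) * (κ + 1) ≤ Real.logb 2 (1 / τ) := by
            calc (j : ℝ) * (κ + 1) ≤ δ * Real.logb 2 (1 / τ) * (κ + 1) := by gcongr
              _ = _ := by rw [hδ]; field_simp
          linarith
      _ = _ := by
          rw [Real.rpow_neg (by norm_num), Real.rpow_natCast]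
          simp
  exact ⟨j, by linarith⟩

/-- Outside the dyadic level set, a locally integrable function is at most the level. -/
theorem ae_le_of_notMem_dyadicLevelSet {n : ℕ} {U : Rn n → ℝ≥0}
    (hloc : LocallyIntegrable (fun x => (U x : ℝ)) volume) (a : Fin n → Fin 3) (k : ℤ)
    (m : Fin n → ℤ) (h : ℝ≥0) :
    ∀ᵐ x : Rn n, x ∈ gridCube a k m → x ∉ dyadicLevelSet a k m U h → U x ≤ h := by
  filter_upwards [ae_le_of_grid_average_le a hloc] with x hx hxQ hxΩ
  refine hx h ?_
  filter_upwards [Filter.eventually_ge_atTop k.toNat] with i hi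
  obtain ⟨j, hj⟩ : ∃ j : ℕ, (i : ℤ) = k + j := ⟨(i - k).toNat, by omega⟩
  rw [hj]
  by_contra hlt
  exact hxΩ ⟨hxQ, j, not_le.1 hlt⟩

/-- A quantitative Gehring lemma: if `U` satisfies the reverse Hölder inequality with exponent `r`
and constant `R` on the shifted dyadic cubes, then `U ^ r` is absolutely continuous with respect to
`U`, uniformly over these cubes, with an exponent `δ` comparable to `R ^ (-r)`. -/
theorem exists_gehring (n : ℕ) {r : ℝ} (hr : 1 < r) : ∃ c : ℝ, 0 < c ∧
    ∀ (U : Rn n → ℝ≥0) (R : ℝ≥0), Measurable U → LocallyIntegrable (fun x => (U x : ℝ)) volume →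
      1 ≤ R → (∀ a k m, ∫⁻ x in gridCube a k m, U x ≠ (0 : ℝ≥0∞)) →
      (∀ a k m, ∫⁻ x in gridCube a k m, (U x : ℝ≥0∞) ^ r ≤ R ^ r *
        ((∫⁻ x in gridCube a k m, U x) / volume (gridCube a k m)) ^ r *
          volume (gridCube a k m)) →
      ∃ δ : ℝ, 0 < δ ∧ δ ≤ 1 ∧ 1 / δ ≤ c * R ^ r ∧ ∀ a k m G, MeasurableSet G →
        G ⊆ gridCube a k m → ∫⁻ x in G, (U x : ℝ≥0∞) ^ r ≤
          4 * ((∫⁻ x in G, U x) / ∫⁻ x in gridCube a k m, U x) ^ δ *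
            ∫⁻ x in gridCube a k m, (U x : ℝ≥0∞) ^ r := by
  have hκ : 0 < r - 1 := by linarith
  have h2κ : (1 : ℝ) < 2 ^ (r - 1) := Real.one_lt_rpow (by norm_num) hκ
  set K₀ : ℝ := 2 * (2 ^ n) ^ r * (4 ^ (r - 1) / (2 ^ (r - 1) - 1)) with hK₀
  have hK₀pos : 0 < K₀ := mul_pos (by positivity) (div_pos (by positivity) (by linarith))
  refine ⟨(2 * K₀ + 1) * (r - 1) + 1, by positivity, ?_⟩
  intro U R hU hloc hR hpos hRH
  have hRr : (1 : ℝ) ≤ (R : ℝ) ^ r := Real.one_le_rpow (by exact_mod_cast hR) (by linarith)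
  set K : ℝ := K₀ * R ^ r with hK
  have hKpos : 0 < K := by positivity
  set L : ℕ := ⌈2 * K⌉₊ with hL
  have hLK : 2 * K ≤ L := Nat.le_ceil _
  have hLK' : (L : ℝ) ≤ 2 * K + 1 := (Nat.ceil_lt_add_one (by positivity)).le
  set δ : ℝ := 1 / (L * (r - 1) + 1) with hδ
  have hLr : 0 ≤ (L : ℝ) * (r - 1) := by positivity
  refine ⟨δ, by positivity, ?_, ?_, ?_⟩
  · rw [hδ, div_le_one (by positivity)]
    linarith
  · rw [hδ, one_div_one_div]
    calc (L : ℝ) * (r - 1) + 1 ≤ (2 * K + 1) * (r - 1) + 1 := by gcongr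
      _ ≤ (2 * K + R ^ r) * (r - 1) + R ^ r := by gcongr
      _ = _ := by rw [hK]; ring
  intro a k m G hG hGP
  set P := gridCube a k m with hP
  have hPc : IsCube P := isCube_gridCube a k m
  have hPm : MeasurableSet P := measurableSet_gridCube a k m
  have hU' : Measurable fun x => (U x : ℝ≥0∞) := by fun_prop
  have hUr : Measurable fun x => (U x : ℝ≥0∞) ^ r := by fun_prop
  have huP : ∫⁻ x in P, (U x : ℝ≥0∞) ≠ ∞ := by
    have h1 : IntegrableOn (fun x => (U x : ℝ)) (closure P) :=
      hloc.integrableOn_isCompact hPc.isBounded.isCompact_closure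
    have h2 := (h1.mono_set subset_closure).2
    rw [hasFiniteIntegral_iff_enorm] at h2
    convert h2.ne using 3 with x
    simp
  have hu0 := hpos a k m
  set h₀ : ℝ≥0 := ((∫⁻ x in P, (U x : ℝ≥0∞)) / volume P).toNNReal with hh₀
  have hh₀c : (h₀ : ℝ≥0∞) = (∫⁻ x in P, (U x : ℝ≥0∞)) / volume P :=
    ENNReal.coe_toNNReal (ENNReal.div_ne_top huP hPc.volume_ne_zero)
  have hh₀P : (h₀ : ℝ≥0∞) * volume P = ∫⁻ x in P, (U x : ℝ≥0∞) := by
    rw [hh₀c, ENNReal.div_mul_cancel hPc.volume_ne_zero hPc.volume_ne_top]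
  have hh₀pos : 0 < h₀ := by
    rw [pos_iff_ne_zero]
    intro h
    rw [h] at hh₀P
    exact hu0 (by simpa using hh₀P.symm)
  set Ω : ℕ → Set (Rn n) := fun j => dyadicLevelSet a k m U ((2 ^ (j * L) * h₀ : ℝ≥0) : ℝ≥0∞) with hΩ
  have hle : ∀ j, ∫⁻ x in P, (U x : ℝ≥0∞) ≤ ((2 ^ (j * L) * h₀ : ℝ≥0) : ℝ≥0∞) * volume P := by
    intro j
    rw [← hh₀P]
    gcongr
    exact le_mul_of_one_le_left (by positivity) (one_le_pow₀ (by norm_num))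
  set σP := ∫⁻ x in P, (U x : ℝ≥0∞) ^ r with hσP
  have hσt : σP ≠ ∞ := by
    refine ne_top_of_le_ne_top ?_ (hRH a k m)
    have := hPc.volume_ne_zero
    have := hPc.volume_ne_top
    have : 0 ≤ r := by linarith
    exact ENNReal.mul_ne_top (ENNReal.mul_ne_top (by finiteness)
      (ENNReal.rpow_ne_top_of_nonneg this (ENNReal.div_ne_top huP (by assumption)))) (by assumption)
  have decay : ∀ j : ℕ, ∫⁻ x in Ω j, (U x : ℝ≥0∞) ^ r ≤ ENNReal.ofReal ((1 / 2) ^ j) * σP := by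
    intro j
    induction j with
    | zero =>
      simp only [pow_zero, ENNReal.ofReal_one, one_mul]
      exact lintegral_mono_set fun x hx => hx.1
    | succ j ih =>
      have h1 := mul_lintegral_dyadicLevelSet_le hr hU R a k m (hRH a)
        (h₀ := 2 ^ (j * L) * h₀) (by positivity) (hle j) L
      have h2 : (2 ^ L * ((2 ^ (j * L) * h₀ : ℝ≥0) : ℝ≥0∞)) =
          ((2 ^ ((j + 1) * L) * h₀ : ℝ≥0) : ℝ≥0∞) := by
        push_cast
        ring
      have h3 : (2 : ℝ) * (2 ^ n * R) ^ r * (4 ^ (r - 1) / (2 ^ (r - 1) - 1)) = K := by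
        rw [hK, hK₀, Real.mul_rpow (by positivity) (by positivity)]
        ring
      rw [h2, h3] at h1
      have h4 : ENNReal.ofReal (2 * K) * ∫⁻ x in Ω (j + 1), (U x : ℝ≥0∞) ^ r ≤
          ENNReal.ofReal (2 * K) * (ENNReal.ofReal ((1 / 2) ^ (j + 1)) * σP) := by
        calc _ ≤ (L : ℝ≥0∞) * ∫⁻ x in Ω (j + 1), (U x : ℝ≥0∞) ^ r := by
              gcongr
              exact ENNReal.ofReal_le_of_le_toReal (by simpa using hLK)
          _ ≤ ENNReal.ofReal K * ∫⁻ x in Ω j, (U x : ℝ≥0∞) ^ r := h1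
          _ ≤ ENNReal.ofReal K * (ENNReal.ofReal ((1 / 2) ^ j) * σP) := by gcongr
          _ = _ := by
              rw [← mul_assoc, ← mul_assoc, ← ENNReal.ofReal_mul (by positivity),
                ← ENNReal.ofReal_mul (by positivity)]
              congr 2
              ring
      exact (ENNReal.mul_le_mul_iff_right (by simpa using hKpos) ENNReal.ofReal_ne_top).1 h4
  -- on the complement of the level set, `U ^ r` is at most `h ^ (r - 1) * U`
  have split : ∀ j : ℕ, ∫⁻ x in G, (U x : ℝ≥0∞) ^ r ≤ ENNReal.ofReal ((1 / 2) ^ j) * σP +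
      ENNReal.ofReal (2 ^ (j * ((L : ℝ) * (r - 1)))) * (h₀ : ℝ≥0∞) ^ (r - 1) *
        ∫⁻ x in G, (U x : ℝ≥0∞) := by
    intro j
    have hΩm : MeasurableSet (Ω j) := measurableSet_dyadicLevelSet a k m U (hle j)
    rw [← lintegral_inter_add_sdiff (fun x => (U x : ℝ≥0∞) ^ r) G hΩm]
    refine add_le_add ((lintegral_mono_set inter_subset_right).trans (decay j)) ?_
    calc ∫⁻ x in G \ Ω j, (U x : ℝ≥0∞) ^ r
        ≤ ∫⁻ x in G \ Ω j, ENNReal.ofReal (2 ^ (j * ((L : ℝ) * (r - 1)))) *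
          (h₀ : ℝ≥0∞) ^ (r - 1) * U x := by
          refine setLIntegral_mono_ae' (hG.diff hΩm) ?_
          filter_upwards [ae_le_of_notMem_dyadicLevelSet hloc a k m (2 ^ (j * L) * h₀)] with x hx hxG
          have h1 : (U x : ℝ≥0∞) ≤ ((2 ^ (j * L) * h₀ : ℝ≥0) : ℝ≥0∞) := by
            exact_mod_cast hx (hGP hxG.1) hxG.2
          have h2 : (U x : ℝ≥0∞) ^ r = (U x : ℝ≥0∞) ^ (r - 1) * U x := by
            nth_rewrite 3 [← ENNReal.rpow_one (U x : ℝ≥0∞)]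
            rw [← ENNReal.rpow_add_of_nonneg _ _ hκ.le zero_le_one]
            ring_nf
          rw [h2]
          gcongr
          refine (ENNReal.rpow_le_rpow h1 hκ.le).trans (le_of_eq ?_)
          rw [ENNReal.coe_mul, ENNReal.mul_rpow_of_nonneg _ _ hκ.le]
          congr 1
          rw [← mul_assoc, Real.rpow_mul (by norm_num),
            ← ENNReal.ofReal_rpow_of_nonneg (by positivity) hκ.le]
          congr 1
          rw [← Nat.cast_mul, Real.rpow_natCast, ENNReal.ofReal_pow (by norm_num)]
          simp
      _ = _ := lintegral_const_mul _ hU'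
      _ ≤ _ := by
          gcongr
          exact sdiff_subset
  -- Hölder's inequality for the average over `P`
  have hholder : (h₀ : ℝ≥0∞) ^ (r - 1) * ∫⁻ x in P, (U x : ℝ≥0∞) ≤ σP := by
    have h1 : ∫⁻ x in P, (U x : ℝ≥0∞) ≤ σP ^ (1 / r) * volume P ^ (1 - 1 / r) := by
      have := ENNReal.lintegral_mul_norm_pow_le (μ := volume.restrict P)
        (f := fun x => (U x : ℝ≥0∞) ^ r) (g := fun _ => 1) hUr.aemeasurable
        aemeasurable_const (p := 1 / r) (q := 1 - 1 / r) (by positivity)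
        (by rw [sub_nonneg, div_le_one (by linarith)]; exact hr.le) (by ring)
      have hr0 : r ≠ 0 := by linarith
      simpa [← ENNReal.rpow_mul, hr0] using this
    have h2 : (h₀ : ℝ≥0∞) ^ r * volume P ≤ σP := by
      rw [hh₀c, ENNReal.div_rpow_of_nonneg _ _ (by linarith)]
      have hV0 := hPc.volume_ne_zero
      have hVt := hPc.volume_ne_top
      calc (∫⁻ x in P, (U x : ℝ≥0∞)) ^ r / volume P ^ r * volume P
          ≤ (σP ^ (1 / r) * volume P ^ (1 - 1 / r)) ^ r / volume P ^ r * volume P := by gcongr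
        _ = σP * (volume P ^ (r - 1) * volume P / volume P ^ r) := by
            rw [ENNReal.mul_rpow_of_nonneg _ _ (by linarith), ← ENNReal.rpow_mul,
              ← ENNReal.rpow_mul, one_div_mul_cancel (by linarith), ENNReal.rpow_one, sub_mul,
              one_mul, one_div_mul_cancel (by linarith)]
            simp only [div_eq_mul_inv]
            ring
        _ = σP := by
            nth_rewrite 2 [← ENNReal.rpow_one (volume P)]
            rw [← ENNReal.rpow_add _ _ hV0 hVt, sub_add_cancel, ENNReal.div_self, mul_one]
            · exact (ENNReal.rpow_pos (pos_iff_ne_zero.2 hV0) hVt).ne'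
            · exact ENNReal.rpow_ne_top_of_nonneg (by linarith) hVt
    calc _ = (h₀ : ℝ≥0∞) ^ (r - 1) * (h₀ * volume P) := by rw [hh₀P]
      _ = (h₀ : ℝ≥0∞) ^ r * volume P := by
          rw [← mul_assoc]
          nth_rewrite 2 [← ENNReal.rpow_one (h₀ : ℝ≥0∞)]
          rw [← ENNReal.rpow_add_of_nonneg _ _ hκ.le zero_le_one, sub_add_cancel]
      _ ≤ σP := h2
  set uG := ∫⁻ x in G, (U x : ℝ≥0∞) with huG
  set uP := ∫⁻ x in P, (U x : ℝ≥0∞) with huPdef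
  have huGP : uG ≤ uP := lintegral_mono_set hGP
  rcases eq_or_ne uG 0 with h0 | h0
  · have : ∫⁻ x in G, (U x : ℝ≥0∞) ^ r = 0 := by
      rw [huG, lintegral_eq_zero_iff hU'] at h0
      rw [lintegral_eq_zero_iff hUr]
      filter_upwards [h0] with x hx
      have hr0 : 0 < r := by linarith
      simpa [hr0] using hx
    rw [this]
    exact zero_le
  set t := uG / uP with ht
  have htt : t ≠ ∞ := ENNReal.div_ne_top (ne_top_of_le_ne_top huP huGP) hu0
  have ht0 : t ≠ 0 := (ENNReal.div_pos h0 huP).ne'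
  have ht1 : t ≤ 1 := ENNReal.div_le_of_le_mul (by simpa using huGP)
  obtain ⟨j, hj⟩ := exists_two_rpow_add_le hLr (ENNReal.toReal_pos ht0 htt)
    (by simpa using ENNReal.toReal_mono ENNReal.one_ne_top ht1)
  have huGt : uG = t * uP := (ENNReal.div_mul_cancel hu0 huP).symm
  calc ∫⁻ x in G, (U x : ℝ≥0∞) ^ r
      ≤ ENNReal.ofReal ((1 / 2) ^ j) * σP +
      ENNReal.ofReal (2 ^ (j * ((L : ℝ) * (r - 1)))) * (h₀ : ℝ≥0∞) ^ (r - 1) * uG := split j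
    _ = ENNReal.ofReal ((1 / 2) ^ j) * σP +
      ENNReal.ofReal (2 ^ (j * ((L : ℝ) * (r - 1)))) * t * ((h₀ : ℝ≥0∞) ^ (r - 1) * uP) := by
        rw [huGt]
        ring
    _ ≤ ENNReal.ofReal ((1 / 2) ^ j) * σP +
      ENNReal.ofReal (2 ^ (j * ((L : ℝ) * (r - 1)))) * t * σP := by gcongr
    _ = ENNReal.ofReal ((1 / 2) ^ j + 2 ^ (j * ((L : ℝ) * (r - 1))) * t.toReal) * σP := by
        rw [ENNReal.ofReal_add (by positivity) (by positivity),
          ENNReal.ofReal_mul (p := 2 ^ (j * ((L : ℝ) * (r - 1)))) (by positivity),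
          ENNReal.ofReal_toReal htt]
        ring
    _ ≤ ENNReal.ofReal (4 * t.toReal ^ δ) * σP := by gcongr
    _ = _ := by
        rw [ENNReal.ofReal_mul (by norm_num), ← ENNReal.ofReal_rpow_of_nonneg (by positivity)
          (by positivity), ENNReal.ofReal_toReal htt]
        simp

/-! ### Lorentz integrals -/

theorem sum_rpow_le_rpow_sum {ι : Type*} (J : Finset ι) (x : ι → ℝ≥0∞) {θ : ℝ} (hθ : 1 ≤ θ) :
    ∑ i ∈ J, x i ^ θ ≤ (∑ i ∈ J, x i) ^ θ := by
  classical
  induction J using Finset.induction_on with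
  | empty => simp
  | insert i J hi ih =>
    rw [Finset.sum_insert hi, Finset.sum_insert hi]
    exact (add_le_add_right ih _).trans (ENNReal.add_rpow_le_rpow_add _ _ hθ)

/-- The distribution integral `∫_0^∞ μ{f > y}^{1/p} dy`, equal to the `L^{p,1}` norm up to the
factor `p`. -/
def lorentzIntegral {X : Type*} [MeasurableSpace X] (p : ℝ) (μ : Measure X) (f : X → ℝ) : ℝ≥0∞ :=
  ∫⁻ y in Ioi (0 : ℝ), μ {x | y < f x} ^ (1 / p)

theorem antitone_measure_lt {X : Type*} [MeasurableSpace X] {p : ℝ} (hp : 0 ≤ p) (μ : Measure X)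
    (f : X → ℝ) : Antitone fun y : ℝ => μ {x | y < f x} ^ (1 / p) := by
  intro y z hyz
  refine ENNReal.rpow_le_rpow (measure_mono fun x hx => ?_) (by positivity)
  exact lt_of_le_of_lt hyz hx

theorem measurable_measure_lt {X : Type*} [MeasurableSpace X] {p : ℝ} (hp : 0 ≤ p) (μ : Measure X)
    (f : X → ℝ) : Measurable fun y : ℝ => μ {x | y < f x} ^ (1 / p) :=
  (antitone_measure_lt hp μ f).measurable

/-- `L^{p,1}` embeds into `L^p`. -/
theorem lintegral_rpow_le_lorentzIntegral {X : Type*} [MeasurableSpace X] {p : ℝ} (hp : 1 ≤ p)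
    (μ : Measure X) {f : X → ℝ} (hf : ∀ x, 0 ≤ f x) (hfm : AEMeasurable f μ) :
    ∫⁻ x, ENNReal.ofReal (f x) ^ p ∂μ ≤ ENNReal.ofReal p * lorentzIntegral p μ f ^ p := by
  have hp0 : 0 < p := by linarith
  set Φ := lorentzIntegral p μ f with hΦ
  set φ : ℝ → ℝ≥0∞ := fun y => μ {x | y < f x} ^ (1 / p) with hφ
  have hφΦ : ∀ y : ℝ, 0 < y → ENNReal.ofReal y * φ y ≤ Φ := by
    intro y hy
    calc ENNReal.ofReal y * φ y = ∫⁻ z in Ioc 0 y, φ y := by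
          rw [setLIntegral_const, Real.volume_Ioc, sub_zero, mul_comm]
      _ ≤ ∫⁻ z in Ioc 0 y, φ z := setLIntegral_mono' measurableSet_Ioc fun z hz =>
          antitone_measure_lt hp0.le μ f hz.2
      _ ≤ Φ := lintegral_mono_set Ioc_subset_Ioi_self
  have hφp : ∀ y, μ {x | y < f x} = φ y * φ y ^ (p - 1) := by
    intro y
    nth_rewrite 1 [← ENNReal.rpow_one (φ y)]
    rw [← ENNReal.rpow_add_of_nonneg _ _ zero_le_one (by linarith), add_sub_cancel, hφ]
    simp only
    rw [← ENNReal.rpow_mul, one_div_mul_cancel hp0.ne', ENNReal.rpow_one]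
  calc ∫⁻ x, ENNReal.ofReal (f x) ^ p ∂μ = ∫⁻ x, ENNReal.ofReal (f x ^ p) ∂μ := by
        refine lintegral_congr fun x => ?_
        rw [ENNReal.ofReal_rpow_of_nonneg (hf x) hp0.le]
    _ = ENNReal.ofReal p * ∫⁻ y in Ioi (0 : ℝ), μ {x | y < f x} * ENNReal.ofReal (y ^ (p - 1)) :=
        lintegral_rpow_eq_lintegral_meas_lt_mul μ (Filter.Eventually.of_forall hf) hfm hp0
    _ ≤ ENNReal.ofReal p * ∫⁻ y in Ioi (0 : ℝ), φ y * Φ ^ (p - 1) := by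
        refine mul_le_mul_right (setLIntegral_mono' measurableSet_Ioi fun y hy => ?_) _
        have hy0 : (0 : ℝ) < y := hy
        rw [hφp, mul_assoc, ← ENNReal.ofReal_rpow_of_nonneg hy0.le (by linarith),
          ← ENNReal.mul_rpow_of_nonneg _ _ (by linarith)]
        refine mul_le_mul_right (ENNReal.rpow_le_rpow ?_ (by linarith)) _
        rw [mul_comm]
        exact hφΦ y hy0
    _ = ENNReal.ofReal p * Φ ^ p := by
        rw [lintegral_mul_const _ (measurable_measure_lt hp0.le μ f)]
        congr 1
        change Φ * Φ ^ (p - 1) = Φ ^ p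
        nth_rewrite 1 [← ENNReal.rpow_one Φ]
        rw [← ENNReal.rpow_add_of_nonneg _ _ zero_le_one (by linarith), add_sub_cancel]

/-- Minkowski's inequality for the `L^{p,1}` norms over disjoint sets: for `p ≤ q` their `ℓ^q` sum
is at most the `L^{p,1}` norm over the whole space. -/
theorem sum_lorentzIntegral_rpow_le {ι X : Type*} [MeasurableSpace X] {p q : ℝ} (hp : 1 ≤ p)
    (hpq : p ≤ q) (μ : Measure X) (f : X → ℝ) (P : ι → Set X) (J : Finset ι)
    (hP : (J : Set ι).PairwiseDisjoint P) (hPm : ∀ i ∈ J, MeasurableSet (P i)) :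
    ∑ i ∈ J, lorentzIntegral p (μ.restrict (P i)) f ^ q ≤ lorentzIntegral p μ f ^ q := by
  have hp0 : 0 < p := by linarith
  have hq0 : 0 < q := by linarith
  set b : ι → ℝ≥0∞ := fun i => lorentzIntegral p (μ.restrict (P i)) f with hb
  set B := lorentzIntegral p μ f with hB
  set h : ι → ℝ → ℝ≥0∞ := fun i y => μ.restrict (P i) {x | y < f x} ^ (1 / p) with hh
  have hhm : ∀ i, Measurable (h i) := fun i => measurable_measure_lt hp0.le _ f
  rcases eq_or_ne B ∞ with hBt | hBt
  · simp [hBt, hq0]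
  have hbB : ∀ i, b i ≤ B := fun i => lintegral_mono fun y =>
    ENNReal.rpow_le_rpow (Measure.restrict_apply_le _ _) (by positivity)
  have hbt : ∀ i, b i ≠ ∞ := fun i => ne_top_of_le_ne_top hBt (hbB i)
  have hsum : ∀ y, (∑ i ∈ J, h i y ^ q) ^ (1 / q) ≤ μ {x | y < f x} ^ (1 / p) := by
    intro y
    have h1 : ∑ i ∈ J, h i y ^ q ≤ μ {x | y < f x} ^ (q / p) := by
      calc ∑ i ∈ J, h i y ^ q = ∑ i ∈ J, μ.restrict (P i) {x | y < f x} ^ (q / p) := by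
            refine Finset.sum_congr rfl fun i _ => ?_
            rw [hh]
            simp only
            rw [← ENNReal.rpow_mul, one_div_mul_eq_div]
        _ ≤ (∑ i ∈ J, μ.restrict (P i) {x | y < f x}) ^ (q / p) :=
            sum_rpow_le_rpow_sum _ _ ((one_le_div hp0).2 hpq)
        _ ≤ _ := by
            refine ENNReal.rpow_le_rpow ?_ (by positivity)
            calc ∑ i ∈ J, μ.restrict (P i) {x | y < f x}
                = ∑ i ∈ J, μ.restrict {x | y < f x} (P i) := by
                  refine Finset.sum_congr rfl fun i hi => ?_
                  rw [Measure.restrict_apply' (hPm i hi), Measure.restrict_apply (hPm i hi),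
                    inter_comm]
              _ = μ.restrict {x | y < f x} (⋃ i ∈ J, P i) :=
                  (measure_biUnion_finset hP hPm).symm
              _ ≤ μ.restrict {x | y < f x} univ := measure_mono (subset_univ _)
              _ = _ := Measure.restrict_apply_univ _
    calc _ ≤ (μ {x | y < f x} ^ (q / p)) ^ (1 / q) := ENNReal.rpow_le_rpow h1 (by positivity)
      _ = _ := by
          rw [← ENNReal.rpow_mul]
          congr 1
          field_simp
  -- duality: the dual sequence of `b` is `b ^ (q - 1)`
  set S := ∑ i ∈ J, b i ^ q with hS
  have hSt : S ≠ ∞ := ENNReal.sum_ne_top.2 fun i _ => ENNReal.rpow_ne_top_of_nonneg hq0.le (hbt i)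
  have key : S ≤ S ^ (1 - 1 / q) * B := by
    calc S = ∑ i ∈ J, b i ^ (q - 1) * b i := by
          refine Finset.sum_congr rfl fun i _ => ?_
          nth_rewrite 3 [← ENNReal.rpow_one (b i)]
          rw [← ENNReal.rpow_add_of_nonneg _ _ (by linarith) zero_le_one, sub_add_cancel]
      _ = ∫⁻ y in Ioi (0 : ℝ), ∑ i ∈ J, b i ^ (q - 1) * h i y := by
          rw [lintegral_finsetSum _ fun i _ => (hhm i).const_mul _]
          refine Finset.sum_congr rfl fun i _ => ?_
          rw [lintegral_const_mul _ (hhm i)]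
          rfl
      _ ≤ ∫⁻ y in Ioi (0 : ℝ), S ^ (1 - 1 / q) * μ {x | y < f x} ^ (1 / p) := by
          refine lintegral_mono fun y => ?_
          refine le_trans ?_ (mul_le_mul_right (hsum y) _)
          rcases (hp.trans hpq).eq_or_lt with h1 | h1
          · simp [← h1]
          · have hc : (q / (q - 1)).HolderConjugate q :=
              (Real.HolderConjugate.conjExponent h1).symm
            refine (ENNReal.inner_le_Lp_mul_Lq J _ _ hc).trans (le_of_eq ?_)
            have hq1 : q - 1 ≠ 0 := by linarith
            congr 2
            · refine Finset.sum_congr rfl fun i _ => ?_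
              rw [← ENNReal.rpow_mul]
              congr 1
              field_simp
            · field_simp
      _ = _ := lintegral_const_mul _ (measurable_measure_lt hp0.le μ f)
  rcases eq_or_ne S 0 with hS0 | hS0
  · rw [hS0]
    exact zero_le
  · have h1 : S ^ (1 / q) ≤ B := by
      have h2 : S ^ (1 - 1 / q) * S ^ (1 / q) ≤ S ^ (1 - 1 / q) * B := by
        rwa [← ENNReal.rpow_add _ _ hS0 hSt, sub_add_cancel, ENNReal.rpow_one]
      refine (ENNReal.mul_le_mul_iff_right ?_ ?_).1 h2
      · exact (ENNReal.rpow_pos (pos_iff_ne_zero.2 hS0) hSt).ne'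
      · refine ENNReal.rpow_ne_top_of_nonneg ?_ hSt
        rw [sub_nonneg, div_le_one hq0]
        linarith
    calc S = (S ^ (1 / q)) ^ q := by
          rw [← ENNReal.rpow_mul, one_div_mul_cancel hq0.ne', ENNReal.rpow_one]
      _ ≤ _ := ENNReal.rpow_le_rpow h1 hq0.le

/-! ### Weights -/

theorem wMeasure_apply {n : ℕ} (w : Rn n → ℝ≥0) (S : Set (Rn n)) :
    wMeasure w S = ∫⁻ x in S, (w x : ℝ≥0∞) := withDensity_apply' _ S

theorem wMeasure_congr {n : ℕ} {w w' : Rn n → ℝ≥0} (h : w =ᵐ[volume] w') :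
    wMeasure w = wMeasure w' :=
  withDensity_congr_ae (h.mono fun x hx => by simp [hx])

theorem wMeasure_absolutelyContinuous {n : ℕ} (w : Rn n → ℝ≥0) : wMeasure w ≪ volume :=
  withDensity_absolutelyContinuous _ _

theorem exists_cube_superset_closedBall {n : ℕ} (ρ : ℝ) :
    ∃ Q : Set (Rn n), IsCube Q ∧ Metric.closedBall 0 ρ ⊆ Q := by
  refine ⟨cube (fun _ => -(|ρ| + 1)) (2 * (|ρ| + 1)), ⟨_, _, by positivity, rfl⟩, fun x hx i => ?_⟩
  rw [mem_closedBall_zero_iff] at hx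
  have h1 : ‖x i‖ ≤ ‖x‖ := PiLp.norm_apply_le x i
  have h2 : |x i| ≤ |ρ| := by
    rw [← Real.norm_eq_abs]
    exact h1.trans (hx.trans (le_abs_self ρ))
  rw [abs_le] at h2
  constructor <;> linarith

theorem aRConst_term_le {n : ℕ} {p₀ p q : ℝ} (hp₀ : 0 < p₀) (w : Rn n → ℝ≥0) {Q E : Set (Rn n)}
    (hQ : IsCube Q) (hE : MeasurableSet E) (hEQ : E ⊆ Q) :
    volume E / volume Q ^ (1 - (p₀ / p - p₀ / q)) *
      (wMeasure (fun x => w x ^ q) Q ^ (p₀ / q) / wMeasure (fun x => w x ^ p) E ^ (p₀ / p)) ≤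
      aRConst (p / p₀) (q / p₀) (fun x => w x ^ p₀) := by
  have h : ∀ t : ℝ, (fun x => (w x ^ p₀) ^ (t / p₀)) = fun x => w x ^ t := by
    intro t
    funext x
    rw [← NNReal.rpow_mul, mul_div_cancel₀ _ hp₀.ne']
  have : volume E / volume Q ^ (1 - (1 / (p / p₀) - 1 / (q / p₀))) *
      (wMeasure (fun x => (w x ^ p₀) ^ (q / p₀)) Q ^ (1 / (q / p₀)) /
        wMeasure (fun x => (w x ^ p₀) ^ (p / p₀)) E ^ (1 / (p / p₀))) ≤
      aRConst (p / p₀) (q / p₀) (fun x => w x ^ p₀) :=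
    le_iSup₂_of_le Q hQ (le_iSup_of_le E (le_iSup_of_le hE (le_iSup_of_le hEQ le_rfl)))
  rw [h, h, one_div_div, one_div_div] at this
  exact this

/-- A weight of finite restricted Muckenhoupt constant vanishes almost everywhere or is almost
everywhere positive. -/
theorem ae_eq_zero_or_ae_ne_zero {n : ℕ} {p₀ p q : ℝ} (hp₀ : 0 < p₀) (hp : 0 < p) (hq : 0 < q)
    {w : Rn n → ℝ≥0} (hw : Measurable w)
    (hA : aRConst (p / p₀) (q / p₀) (fun x => w x ^ p₀) < ∞) :
    (∀ᵐ x, w x = 0) ∨ ∀ᵐ x, w x ≠ 0 := by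
  rw [or_iff_not_imp_right]
  intro hZ
  have hZm : MeasurableSet {x | w x = 0} := hw (measurableSet_singleton 0)
  have hZpos : volume {x | w x = 0} ≠ 0 := by
    intro h
    refine hZ ?_
    rw [ae_iff]
    simpa using h
  -- a cube that meets the zero set in positive measure has no mass
  have key : ∀ Q, IsCube Q → volume ({x | w x = 0} ∩ Q) ≠ 0 →
      wMeasure (fun x => w x ^ q) Q = 0 := by
    intro Q hQ hE
    have h1 := (aRConst_term_le (p := p) (q := q) hp₀ w hQ (hZm.inter hQ.measurableSet)
      inter_subset_right).trans_lt hA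
    by_contra hu
    have h2 : wMeasure (fun x => w x ^ p) ({x | w x = 0} ∩ Q) = 0 := by
      rw [wMeasure_apply]
      refine (setLIntegral_congr_fun (hZm.inter hQ.measurableSet) (g := fun _ => 0) ?_).trans
        (by simp)
      intro x hx
      have : w x = 0 := hx.1
      simp [this, hp.ne']
    rw [h2, ENNReal.zero_rpow_of_pos (by positivity), ENNReal.div_zero, ENNReal.mul_top] at h1
    · exact lt_irrefl _ h1
    · refine (ENNReal.div_pos hE ?_).ne'
      exact ENNReal.rpow_ne_top_of_ne_zero hQ.volume_ne_zero hQ.volume_ne_top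
    · rw [Ne, ENNReal.rpow_eq_zero_iff]
      rintro (⟨h, -⟩ | ⟨-, h⟩)
      · exact hu h
      · exact absurd h (not_lt.2 (by positivity))
  have hball : ∀ N : ℕ, ∃ Q : Set (Rn n), IsCube Q ∧ Metric.closedBall 0 (N : ℝ) ⊆ Q := fun N =>
    exists_cube_superset_closedBall N
  have hun : ∀ S : Set (Rn n), S = ⋃ N : ℕ, S ∩ Metric.closedBall 0 (N : ℝ) := by
    intro S
    rw [← inter_iUnion, Metric.iUnion_closedBall_nat, inter_univ]
  obtain ⟨N₀, hN₀⟩ : ∃ N : ℕ, volume ({x | w x = 0} ∩ Metric.closedBall 0 (N : ℝ)) ≠ 0 := by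
    by_contra! h
    refine hZpos ?_
    rw [hun {x | w x = 0}]
    exact measure_iUnion_null h
  have hnull : wMeasure (fun x => w x ^ q) univ = 0 := by
    rw [hun univ]
    refine measure_iUnion_null fun N => ?_
    obtain ⟨Q, hQ, hBQ⟩ := hball (max N N₀)
    refine measure_mono_null (inter_subset_right.trans
      ((Metric.closedBall_subset_closedBall ?_).trans hBQ)) (key Q hQ ?_)
    · exact_mod_cast le_max_left _ _
    · refine fun h => hN₀ (measure_mono_null (inter_subset_inter_right _
        ((Metric.closedBall_subset_closedBall ?_).trans hBQ)) h)
      exact_mod_cast le_max_right _ _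
  rw [wMeasure_apply, Measure.restrict_univ, lintegral_eq_zero_iff (by fun_prop)] at hnull
  filter_upwards [hnull] with x hx
  simpa [hq.ne'] using hx

theorem wMeasure_ne_zero {n : ℕ} {w : Rn n → ℝ≥0} (hw : Measurable w) (hpos : ∀ᵐ x, w x ≠ 0)
    (t : ℝ) {E : Set (Rn n)} (hE : volume E ≠ 0) : wMeasure (fun x => w x ^ t) E ≠ 0 := by
  rw [wMeasure_apply]
  intro h
  rw [lintegral_eq_zero_iff (by fun_prop)] at h
  have : ∀ᵐ x ∂volume.restrict E, False := by
    filter_upwards [h, ae_restrict_of_ae hpos] with x hx hx'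
    simp [NNReal.rpow_eq_zero_iff, hx'] at hx
  rw [ae_iff] at this
  simp at this
  exact hE this

/-- Finiteness of the restricted Muckenhoupt constant of `w ^ p₀` makes `w ^ q` locally integrable. -/
theorem wMeasure_ne_top {n : ℕ} {p₀ p q : ℝ} (hp₀ : 0 < p₀) (hp : 0 < p) (hq : 0 < q)
    {w : Rn n → ℝ≥0} (hw : Measurable w)
    (hA : aRConst (p / p₀) (q / p₀) (fun x => w x ^ p₀) < ∞) {Q : Set (Rn n)} (hQ : IsCube Q) :
    wMeasure (fun x => w x ^ q) Q ≠ ∞ := by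
  intro htop
  obtain ⟨M, hM⟩ : ∃ M : ℕ, volume (Q ∩ {x | w x ≤ M}) ≠ 0 := by
    by_contra! h
    refine hQ.volume_ne_zero ?_
    have : Q = ⋃ M : ℕ, Q ∩ {x | w x ≤ M} := by
      rw [← inter_iUnion]
      refine (inter_eq_left.2 fun x _ => ?_).symm
      obtain ⟨M, hM⟩ := exists_nat_ge (w x)
      exact mem_iUnion.2 ⟨M, hM⟩
    rw [this]
    exact measure_iUnion_null h
  set E := Q ∩ {x | w x ≤ M} with hE
  have hEm : MeasurableSet E := hQ.measurableSet.inter (measurableSet_le hw measurable_const)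
  have h1 := (aRConst_term_le (p := p) (q := q) hp₀ w hQ hEm inter_subset_left).trans_lt hA
  have hvE : wMeasure (fun x => w x ^ p) E ≠ ∞ := by
    rw [wMeasure_apply]
    refine ne_top_of_le_ne_top ?_ (setLIntegral_mono' hEm
      (g := fun _ => (((M : ℝ≥0) ^ p : ℝ≥0) : ℝ≥0∞)) fun x hx => ?_)
    · rw [setLIntegral_const]
      exact ENNReal.mul_ne_top (by simp) (measure_ne_top_of_subset inter_subset_left
        hQ.volume_ne_top)
    · have : w x ≤ M := hx.2
      gcongr
  rw [htop, ENNReal.top_rpow_of_pos (by positivity), ENNReal.top_div_of_ne_top, ENNReal.mul_top]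
    at h1
  · exact lt_irrefl _ h1
  · exact (ENNReal.div_pos hM (ENNReal.rpow_ne_top_of_ne_zero hQ.volume_ne_zero
      hQ.volume_ne_top)).ne'
  · exact ENNReal.rpow_ne_top_of_nonneg (by positivity) hvE

theorem wMeasure_ne_top_of_le {n : ℕ} {p q : ℝ} (hp : 0 < p) (hpq : p ≤ q)
    {w : Rn n → ℝ≥0} {Q : Set (Rn n)} (hQ : volume Q ≠ ∞)
    (hu : wMeasure (fun x => w x ^ q) Q ≠ ∞) : wMeasure (fun x => w x ^ p) Q ≠ ∞ := by
  rw [wMeasure_apply] at *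
  refine ne_top_of_le_ne_top ?_ (lintegral_mono (g := fun x => 1 + ((w x ^ q : ℝ≥0) : ℝ≥0∞))
    fun x => ?_)
  · rw [lintegral_add_left measurable_const, setLIntegral_const, one_mul]
    exact ENNReal.add_ne_top.2 ⟨hQ, hu⟩
  · rcases le_total (w x) 1 with h | h
    · refine le_add_right ?_
      exact ENNReal.coe_le_one_iff.2 (NNReal.rpow_le_one h hp.le)
    · refine le_add_left ?_
      exact ENNReal.coe_le_coe.2 (NNReal.rpow_le_rpow_of_exponent_le h hpq)

/-- The restricted Muckenhoupt condition without division. -/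
theorem volume_mul_wMeasure_rpow_le {n : ℕ} {p₀ p q : ℝ} (hp₀ : 0 < p₀) (hp : p₀ ≤ p) (hpq : p ≤ q)
    {w : Rn n → ℝ≥0} (hw : Measurable w) (hpos : ∀ᵐ x, w x ≠ 0)
    (hA : aRConst (p / p₀) (q / p₀) (fun x => w x ^ p₀) < ∞) {Q E : Set (Rn n)} (hQ : IsCube Q)
    (hE : MeasurableSet E) (hEQ : E ⊆ Q) :
    volume E * wMeasure (fun x => w x ^ q) Q ^ (p₀ / q) ≤
      aRConst (p / p₀) (q / p₀) (fun x => w x ^ p₀) * volume Q ^ (1 - (p₀ / p - p₀ / q)) *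
        wMeasure (fun x => w x ^ p) E ^ (p₀ / p) := by
  have hp' : 0 < p := by linarith
  have hq' : 0 < q := by linarith
  rcases eq_or_ne (volume E) 0 with h0 | h0
  · rw [h0, zero_mul]
    exact zero_le
  have h1 := aRConst_term_le (p := p) (q := q) hp₀ w hQ hE hEQ
  have hut := wMeasure_ne_top hp₀ hp' hq' hw hA hQ
  have hvt := measure_ne_top_of_subset hEQ (wMeasure_ne_top_of_le hp' hpq hQ.volume_ne_top hut)
  have hv0 := wMeasure_ne_zero hw hpos p h0
  have e1 : volume Q ^ (1 - (p₀ / p - p₀ / q)) ≠ 0 :=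
    (ENNReal.rpow_pos (pos_iff_ne_zero.2 hQ.volume_ne_zero) hQ.volume_ne_top).ne'
  have e2 : volume Q ^ (1 - (p₀ / p - p₀ / q)) ≠ ∞ :=
    ENNReal.rpow_ne_top_of_ne_zero hQ.volume_ne_zero hQ.volume_ne_top
  have e3 : wMeasure (fun x => w x ^ p) E ^ (p₀ / p) ≠ 0 :=
    (ENNReal.rpow_pos (pos_iff_ne_zero.2 hv0) hvt).ne'
  have e4 : wMeasure (fun x => w x ^ p) E ^ (p₀ / p) ≠ ∞ :=
    ENNReal.rpow_ne_top_of_nonneg (by positivity) hvt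
  set x := volume Q ^ (1 - (p₀ / p - p₀ / q))
  set y := wMeasure (fun x => w x ^ p) E ^ (p₀ / p)
  calc volume E * wMeasure (fun x => w x ^ q) Q ^ (p₀ / q)
      = volume E / x * (wMeasure (fun x => w x ^ q) Q ^ (p₀ / q) / y) * x * y := by
        generalize wMeasure (fun x => w x ^ q) Q ^ (p₀ / q) = z
        calc volume E * z = volume E * z * (x⁻¹ * x) * (y⁻¹ * y) := by
              rw [ENNReal.inv_mul_cancel e1 e2, ENNReal.inv_mul_cancel e3 e4, mul_one, mul_one]
          _ = _ := by
              simp only [div_eq_mul_inv]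
              ring
    _ ≤ _ := by gcongr

/-- The weight `w ^ q` gives a fixed proportion of its mass to the large parts of a cube. -/
theorem wMeasure_le_of_large {n : ℕ} {p₀ p q η : ℝ} (hp₀ : 0 < p₀) (hp : p₀ ≤ p) (hpq : p ≤ q)
    (hη : 0 < η) {w : Rn n → ℝ≥0} (hw : Measurable w) (hpos : ∀ᵐ x, w x ≠ 0)
    (hA : aRConst (p / p₀) (q / p₀) (fun x => w x ^ p₀) < ∞) {Q E : Set (Rn n)} (hQ : IsCube Q)
    (hE : MeasurableSet E) (hEQ : E ⊆ Q) (hl : ENNReal.ofReal η * volume Q ≤ volume E) :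
    wMeasure (fun x => w x ^ q) Q ≤
      ENNReal.ofReal (η ^ (-(1 - (p₀ / p - p₀ / q)) * (q / p₀))) *
      aRConst (p / p₀) (q / p₀) (fun x => w x ^ p₀) ^ (q / p₀) *
        wMeasure (fun x => w x ^ q) E := by
  have hp' : 0 < p := by linarith
  have hq' : 0 < q := by linarith
  set A := aRConst (p / p₀) (q / p₀) (fun x => w x ^ p₀)
  set c := p₀ / p - p₀ / q with hc
  have hc0 : 0 ≤ c := by
    rw [hc, sub_nonneg]
    exact div_le_div_of_nonneg_left hp₀.le hp' hpq
  have hc1 : 0 < 1 - c := by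
    have h1 : p₀ / p ≤ 1 := (div_le_one hp').2 hp
    have h2 : 0 < p₀ / q := by positivity
    linarith
  have hE0 : volume E ≠ 0 := by
    intro h
    rw [h] at hl
    have := hQ.volume_ne_zero
    simp [this] at hl
    linarith
  have hEt : volume E ≠ ∞ := measure_ne_top_of_subset hEQ hQ.volume_ne_top
  have hQ0 := hQ.volume_ne_zero
  have hQt := hQ.volume_ne_top
  set uQ := wMeasure (fun x => w x ^ q) Q
  set uE := wMeasure (fun x => w x ^ q) E with huE
  have hv : wMeasure (fun x => w x ^ p) E ^ (p₀ / p) ≤ uE ^ (p₀ / q) * volume E ^ c := by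
    have h1 : wMeasure (fun x => w x ^ p) E ≤ uE ^ (p / q) * volume E ^ (1 - p / q) := by
      rw [huE, wMeasure_apply, wMeasure_apply]
      have := ENNReal.lintegral_mul_norm_pow_le (μ := volume.restrict E)
        (f := fun x => ((w x ^ q : ℝ≥0) : ℝ≥0∞)) (g := fun _ => 1) (by fun_prop)
        aemeasurable_const (p := p / q) (q := 1 - p / q) (by positivity)
        (by rw [sub_nonneg, div_le_one hq']; exact hpq) (by ring)
      simp only [ENNReal.one_rpow, mul_one, lintegral_const, Measure.restrict_apply_univ,
        one_mul] at this
      refine le_trans (le_of_eq ?_) this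
      refine lintegral_congr fun x => ?_
      rw [← ENNReal.coe_rpow_of_nonneg _ (by positivity), ← NNReal.rpow_mul]
      congr 2
      field_simp
    calc _ ≤ (uE ^ (p / q) * volume E ^ (1 - p / q)) ^ (p₀ / p) :=
          ENNReal.rpow_le_rpow h1 (by positivity)
      _ = _ := by
          rw [ENNReal.mul_rpow_of_nonneg _ _ (by positivity), ← ENNReal.rpow_mul,
            ← ENNReal.rpow_mul]
          congr 2
          · field_simp
          · rw [hc]
            field_simp
  have h1 := (volume_mul_wMeasure_rpow_le hp₀ hp hpq hw hpos hA hQ hE hEQ).trans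
    (mul_le_mul_right hv _)
  -- cancel `|E| ^ c` and use that `|E|` is comparable to `|Q|`
  have h2 : volume E ^ (1 - c) * uQ ^ (p₀ / q) ≤ A * volume Q ^ (1 - c) * uE ^ (p₀ / q) := by
    have e0 : volume E ^ c ≠ 0 := (ENNReal.rpow_pos (pos_iff_ne_zero.2 hE0) hEt).ne'
    have et : volume E ^ c ≠ ∞ := ENNReal.rpow_ne_top_of_nonneg hc0 hEt
    refine (ENNReal.mul_le_mul_iff_right e0 et).1 ?_
    calc volume E ^ c * (volume E ^ (1 - c) * uQ ^ (p₀ / q)) = volume E * uQ ^ (p₀ / q) := by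
          rw [← mul_assoc, ← ENNReal.rpow_add _ _ hE0 hEt, add_sub_cancel, ENNReal.rpow_one]
      _ ≤ _ := h1
      _ = _ := by ring
  have h3 : ENNReal.ofReal η ^ (1 - c) * uQ ^ (p₀ / q) ≤ A * uE ^ (p₀ / q) := by
    have e0 : volume Q ^ (1 - c) ≠ 0 := (ENNReal.rpow_pos (pos_iff_ne_zero.2 hQ0) hQt).ne'
    have et : volume Q ^ (1 - c) ≠ ∞ := ENNReal.rpow_ne_top_of_nonneg hc1.le hQt
    refine (ENNReal.mul_le_mul_iff_right e0 et).1 ?_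
    calc volume Q ^ (1 - c) * (ENNReal.ofReal η ^ (1 - c) * uQ ^ (p₀ / q))
        = (ENNReal.ofReal η * volume Q) ^ (1 - c) * uQ ^ (p₀ / q) := by
          rw [ENNReal.mul_rpow_of_nonneg _ _ hc1.le]
          ring
      _ ≤ volume E ^ (1 - c) * uQ ^ (p₀ / q) := by gcongr
      _ ≤ _ := h2
      _ = _ := by ring
  have hη0 : ENNReal.ofReal η ≠ 0 := by simpa using hη
  have h4 : uQ ^ (p₀ / q) ≤ ENNReal.ofReal η ^ (-(1 - c)) * (A * uE ^ (p₀ / q)) := by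
    calc uQ ^ (p₀ / q) = ENNReal.ofReal η ^ (-(1 - c)) *
          (ENNReal.ofReal η ^ (1 - c) * uQ ^ (p₀ / q)) := by
          rw [← mul_assoc, ← ENNReal.rpow_add _ _ hη0 ENNReal.ofReal_ne_top, neg_add_cancel,
            ENNReal.rpow_zero, one_mul]
      _ ≤ _ := by gcongr
  have hqp : 0 < q / p₀ := by positivity
  have e : p₀ / q * (q / p₀) = 1 := by field_simp
  calc uQ = (uQ ^ (p₀ / q)) ^ (q / p₀) := by rw [← ENNReal.rpow_mul, e, ENNReal.rpow_one]
    _ ≤ (ENNReal.ofReal η ^ (-(1 - c)) * (A * uE ^ (p₀ / q))) ^ (q / p₀) :=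
        ENNReal.rpow_le_rpow h4 hqp.le
    _ = _ := by
        rw [ENNReal.mul_rpow_of_nonneg _ _ hqp.le, ENNReal.mul_rpow_of_nonneg _ _ hqp.le,
          ← ENNReal.rpow_mul, ← ENNReal.rpow_mul, e, ENNReal.rpow_one,
          ENNReal.ofReal_rpow_of_pos hη, mul_assoc]

theorem IsShiftedDyadicCube.isCube {n : ℕ} {Q : Set (Rn n)} (hQ : IsShiftedDyadicCube Q) :
    IsCube Q := by
  obtain ⟨a, k, m, rfl⟩ := hQ
  exact ⟨_, _, by positivity, rfl⟩

theorem doublingConst_le {n : ℕ} {p₀ p q η : ℝ} (hp₀ : 0 < p₀) (hp : p₀ ≤ p) (hpq : p ≤ q)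
    (hη : 0 < η) {w : Rn n → ℝ≥0} (hw : Measurable w)
    (hA : aRConst (p / p₀) (q / p₀) (fun x => w x ^ p₀) < ∞) :
    doublingConst η (fun x => w x ^ q) ≤
      ENNReal.ofReal (η ^ (-(1 - (p₀ / p - p₀ / q)) * (q / p₀))) *
      aRConst (p / p₀) (q / p₀) (fun x => w x ^ p₀) ^ (q / p₀) := by
  refine iSup₂_le fun Q hQ => iSup₂_le fun E hE => iSup₂_le fun hEQ hl => ?_
  rcases ae_eq_zero_or_ae_ne_zero hp₀ (by linarith) (by linarith) hw hA with h0 | hpos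
  · have : wMeasure (fun x => w x ^ q) Q = 0 := by
      rw [wMeasure_apply]
      refine (lintegral_congr_ae (ae_restrict_of_ae (h0.mono fun x hx => ?_))).trans
        (lintegral_zero (μ := volume.restrict Q))
      have hq0 : q ≠ 0 := by linarith
      simp [hx, hq0]
    simp [this]
  · exact ENNReal.div_le_of_le_mul
      (wMeasure_le_of_large hp₀ hp hpq hη hw hpos hA hQ.isCube hE hEQ hl)

theorem wMeasure_le_doublingConst_mul {n : ℕ} {η : ℝ} (hη : 0 < η) {w : Rn n → ℝ≥0} {q : ℝ}
    (hw : Measurable w) (hpos : ∀ᵐ x, w x ≠ 0)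
    (hut : ∀ Q, IsCube Q → wMeasure (fun x => w x ^ q) Q ≠ ∞) {Q E : Set (Rn n)}
    (hQ : IsShiftedDyadicCube Q) (hE : MeasurableSet E) (hEQ : E ⊆ Q)
    (hl : ENNReal.ofReal η * volume Q ≤ volume E) :
    wMeasure (fun x => w x ^ q) Q ≤
      doublingConst η (fun x => w x ^ q) * wMeasure (fun x => w x ^ q) E := by
  have hE0 : volume E ≠ 0 := by
    intro h
    rw [h] at hl
    have := hQ.isCube.volume_ne_zero
    simp [this] at hl
    linarith
  have h1 : wMeasure (fun x => w x ^ q) Q / wMeasure (fun x => w x ^ q) E ≤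
      doublingConst η (fun x => w x ^ q) :=
    le_iSup₂_of_le Q hQ (le_iSup₂_of_le E hE (le_iSup₂_of_le hEQ hl le_rfl))
  refine (ENNReal.div_le_iff_le_mul ?_ ?_).1 h1
  · exact Or.inl (wMeasure_ne_zero hw hpos q hE0)
  · exact Or.inl (measure_ne_top_of_subset hEQ (hut Q hQ.isCube))

theorem one_le_doublingConst {n : ℕ} {η : ℝ} (hη : η ≤ 1) {w : Rn n → ℝ≥0} {q : ℝ}
    (hw : Measurable w) (hpos : ∀ᵐ x, w x ≠ 0)
    (hut : ∀ Q, IsCube Q → wMeasure (fun x => w x ^ q) Q ≠ ∞) :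
    1 ≤ doublingConst η (fun x => w x ^ q) := by
  have hQ : IsShiftedDyadicCube (gridCube (n := n) 0 0 0) := isShiftedDyadicCube_gridCube _ _ _
  refine le_iSup₂_of_le _ hQ (le_iSup₂_of_le _ hQ.isCube.measurableSet
    (le_iSup₂_of_le subset_rfl ?_ ?_))
  · exact (mul_le_mul_left (ENNReal.ofReal_le_one.2 hη) _).trans (one_mul _).le
  · rw [ENNReal.div_self (wMeasure_ne_zero hw hpos q hQ.isCube.volume_ne_zero) (hut _ hQ.isCube)]

/-- The reverse Hölder condition without division. -/
theorem lintegral_rpow_le_rhConst {n : ℕ} {r q : ℝ} (hr : 1 < r) {w : Rn n → ℝ≥0}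
    (hw : Measurable w) (hpos : ∀ᵐ x, w x ≠ 0)
    (hut : ∀ Q, IsCube Q → wMeasure (fun x => w x ^ q) Q ≠ ∞) {Q : Set (Rn n)} (hQ : IsCube Q) :
    ∫⁻ x in Q, ((w x ^ q : ℝ≥0) : ℝ≥0∞) ^ r ≤ rhConst r (fun x => w x ^ q) ^ r *
      ((∫⁻ x in Q, ((w x ^ q : ℝ≥0) : ℝ≥0∞)) / volume Q) ^ r * volume Q := by
  have h1 : fracAvg 0 r Q (fun x => ((w x ^ q : ℝ≥0) : ℝ≥0∞)) /
      fracAvg 0 1 Q (fun x => ((w x ^ q : ℝ≥0) : ℝ≥0∞)) ≤ rhConst r (fun x => w x ^ q) := by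
    rw [rhConst, if_neg hr.ne']
    exact le_iSup₂_of_le Q hQ le_rfl
  have h0 := wMeasure_ne_zero hw hpos q hQ.volume_ne_zero
  have ht := hut Q hQ
  rw [wMeasure_apply] at h0 ht
  have e : fracAvg 0 1 Q (fun x => ((w x ^ q : ℝ≥0) : ℝ≥0∞)) =
      (∫⁻ x in Q, ((w x ^ q : ℝ≥0) : ℝ≥0∞)) / volume Q := by simp [fracAvg]
  have e' : fracAvg 0 r Q (fun x => ((w x ^ q : ℝ≥0) : ℝ≥0∞)) =
      ((∫⁻ x in Q, ((w x ^ q : ℝ≥0) : ℝ≥0∞) ^ r) / volume Q) ^ (1 / r) := by simp [fracAvg]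
  rw [ENNReal.div_le_iff_le_mul, e, e'] at h1
  · have h2 := ENNReal.rpow_le_rpow h1 (show 0 ≤ r by linarith)
    rw [← ENNReal.rpow_mul, one_div_mul_cancel (by linarith), ENNReal.rpow_one,
      ENNReal.mul_rpow_of_nonneg _ _ (by linarith), ENNReal.div_le_iff_le_mul] at h2
    · exact h2
    · exact Or.inl hQ.volume_ne_zero
    · exact Or.inl hQ.volume_ne_top
  · rw [e]
    exact Or.inl (ENNReal.div_pos h0 hQ.volume_ne_top).ne'
  · rw [e]
    exact Or.inl (ENNReal.div_ne_top ht hQ.volume_ne_zero)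

/-! ### The terms of the sparse form -/

/-- The contribution `⟨f⟩_{p₀,Q} ⟨g⟩_{α,s,Q} |Q|` of a cube `Q` to a sparse form. -/
def formTerm {n : ℕ} (α p₀ s : ℝ) (f g : Rn n → ℝ≥0∞) (Q : Set (Rn n)) : ℝ≥0∞ :=
  fracAvg 0 p₀ Q f * fracAvg α s Q g * volume Q

theorem fracAvg_eq {n : ℕ} {α p : ℝ} (hp : 0 < p) (f : Rn n → ℝ≥0∞) (Q : Set (Rn n)) :
    fracAvg α p Q f = (∫⁻ x in Q, f x ^ p) ^ (1 / p) * volume Q ^ (-((1 - α / n) * (1 / p))) := by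
  rw [fracAvg, ENNReal.div_rpow_of_nonneg _ _ (by positivity), ← ENNReal.rpow_mul,
    ENNReal.rpow_neg, ENNReal.div_eq_inv_mul, mul_comm]

/-- The factor `|Q|^β`, `β = α / (n s)`, is moved from the average of `g` to that of `f`. -/
theorem formTerm_eq {n : ℕ} {α p₀ s : ℝ} (hp₀ : 0 < p₀) (hs : 0 < s) (hn : n ≠ 0)
    (f g : Rn n → ℝ≥0∞) {Q : Set (Rn n)} (hQ : IsCube Q) :
    formTerm α p₀ s f g Q =
      ((∫⁻ x in Q, f x ^ p₀) ^ (1 / p₀) * volume Q ^ (α / (n * s) - 1 / p₀)) *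
        ((∫⁻ x in Q, g x ^ s) ^ (1 / s) * volume Q ^ (1 - 1 / s)) := by
  have h0 := hQ.volume_ne_zero
  have ht := hQ.volume_ne_top
  have hn' : (n : ℝ) ≠ 0 := by exact_mod_cast hn
  rw [formTerm, fracAvg_eq hp₀, fracAvg_eq hs]
  generalize (∫⁻ x in Q, f x ^ p₀) ^ (1 / p₀) = F
  generalize (∫⁻ x in Q, g x ^ s) ^ (1 / s) = G
  have e : volume Q ^ (-((1 - 0 / (n : ℝ)) * (1 / p₀))) * volume Q ^ (-((1 - α / n) * (1 / s))) *
      volume Q = volume Q ^ (α / (n * s) - 1 / p₀) * volume Q ^ (1 - 1 / s) := by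
    nth_rewrite 3 [← ENNReal.rpow_one (volume Q)]
    rw [← ENNReal.rpow_add _ _ h0 ht, ← ENNReal.rpow_add _ _ h0 ht, ← ENNReal.rpow_add _ _ h0 ht]
    congr 1
    field_simp
    ring
  calc _ = F * G * (volume Q ^ (-((1 - 0 / (n : ℝ)) * (1 / p₀))) *
        volume Q ^ (-((1 - α / n) * (1 / s))) * volume Q) := by ring
    _ = _ := by rw [e]; ring

theorem fracAvg_mono {n : ℕ} {α p : ℝ} (hp : 0 ≤ p) {f g : Rn n → ℝ≥0∞} (h : ∀ x, f x ≤ g x)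
    (Q : Set (Rn n)) : fracAvg α p Q f ≤ fracAvg α p Q g := by
  refine ENNReal.rpow_le_rpow (ENNReal.div_le_div_right (lintegral_mono fun x => ?_) _)
    (by positivity)
  exact ENNReal.rpow_le_rpow (h x) hp

theorem formTerm_mono {n : ℕ} {α p₀ s : ℝ} (hs : 0 ≤ s) {f g g' : Rn n → ℝ≥0∞}
    (h : ∀ x, g x ≤ g' x) (Q : Set (Rn n)) : formTerm α p₀ s f g Q ≤ formTerm α p₀ s f g' Q := by
  unfold formTerm
  gcongr
  exact fracAvg_mono hs h Q

theorem formTerm_add_le {n : ℕ} {α p₀ s : ℝ} (hs : 1 ≤ s) (f : Rn n → ℝ≥0∞) {g g' : Rn n → ℝ≥0∞}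
    (hg : Measurable g) (hg' : Measurable g') (Q : Set (Rn n)) :
    formTerm α p₀ s f (fun x => g x + g' x) Q ≤ formTerm α p₀ s f g Q + formTerm α p₀ s f g' Q := by
  have h : fracAvg α s Q (fun x => g x + g' x) ≤ fracAvg α s Q g + fracAvg α s Q g' := by
    have hs' : 0 ≤ 1 / s := by positivity
    rw [fracAvg, fracAvg, fracAvg, ENNReal.div_rpow_of_nonneg _ _ hs',
      ENNReal.div_rpow_of_nonneg _ _ hs', ENNReal.div_rpow_of_nonneg _ _ hs', ← ENNReal.add_div]
    refine ENNReal.div_le_div_right ?_ _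
    exact ENNReal.lintegral_Lp_add_le (p := s) hg.aemeasurable hg'.aemeasurable hs
  unfold formTerm
  calc _ ≤ fracAvg 0 p₀ Q f * (fracAvg α s Q g + fracAvg α s Q g') * volume Q := by gcongr
    _ = _ := by ring

theorem fracAvg_le_of_subset {n : ℕ} {α p : ℝ} (hn : n ≠ 0) (hα : 0 ≤ α) (hαn : α ≤ n) (hp : 1 ≤ p)
    (f : Rn n → ℝ≥0∞) {Q P : Set (Rn n)} (hQP : Q ⊆ P) {c : ℝ≥0∞} (hc : 1 ≤ c) (hct : c ≠ ∞)
    (hv : volume P = c * volume Q) : fracAvg α p Q f ≤ c * fracAvg α p P f := by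
  have hn' : (0 : ℝ) < n := by positivity
  have h1 : 0 ≤ 1 - α / n := by
    rw [sub_nonneg, div_le_one hn']
    exact hαn
  have h2 : 1 - α / n ≤ 1 := by
    have : 0 ≤ α / n := by positivity
    linarith
  have hc0 : c ≠ 0 := fun h => by simp [h] at hc
  have hp' : 0 < p := by linarith
  have h3 : (∫⁻ x in Q, f x ^ p) / volume Q ^ (1 - α / n) ≤
      c * ((∫⁻ x in P, f x ^ p) / volume P ^ (1 - α / n)) := by
    have hcc : c ^ (1 - α / n) ≤ c := by
      calc c ^ (1 - α / n) ≤ c ^ (1 : ℝ) := ENNReal.rpow_le_rpow_of_exponent_le hc h2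
        _ = c := ENNReal.rpow_one c
    have e : (volume Q ^ (1 - α / n))⁻¹ ≤ c * (volume P ^ (1 - α / n))⁻¹ := by
      rw [hv, ENNReal.mul_rpow_of_nonneg _ _ h1, ENNReal.mul_inv, ← mul_assoc]
      · refine le_mul_of_one_le_left (by positivity) ?_
        rw [← div_eq_mul_inv, ENNReal.le_div_iff_mul_le, one_mul]
        · exact hcc
        · exact Or.inl (ENNReal.rpow_pos (pos_iff_ne_zero.2 hc0) hct).ne'
        · exact Or.inl (ENNReal.rpow_ne_top_of_nonneg h1 hct)
      · exact Or.inl (ENNReal.rpow_pos (pos_iff_ne_zero.2 hc0) hct).ne'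
      · exact Or.inl (ENNReal.rpow_ne_top_of_nonneg h1 hct)
    calc _ = (∫⁻ x in Q, f x ^ p) * (volume Q ^ (1 - α / n))⁻¹ := div_eq_mul_inv _ _
      _ ≤ (∫⁻ x in P, f x ^ p) * (c * (volume P ^ (1 - α / n))⁻¹) := by
          gcongr
      _ = _ := by
          rw [ENNReal.div_eq_inv_mul]
          generalize volume P ^ (1 - α / n) = y
          ring
  calc fracAvg α p Q f ≤ (c * ((∫⁻ x in P, f x ^ p) / volume P ^ (1 - α / n))) ^ (1 / p) :=
        ENNReal.rpow_le_rpow h3 (by positivity)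
    _ = c ^ (1 / p) * fracAvg α p P f := ENNReal.mul_rpow_of_nonneg _ _ (by positivity)
    _ ≤ c ^ (1 : ℝ) * fracAvg α p P f := by
        refine mul_le_mul_left (ENNReal.rpow_le_rpow_of_exponent_le hc ?_) _
        rw [div_le_one hp']
        exact hp
    _ = _ := by rw [ENNReal.rpow_one]

theorem formTerm_le_of_subset {n : ℕ} {α p₀ s : ℝ} (hα : 0 ≤ α) (hαn : α < n) (hp₀ : 1 ≤ p₀)
    (hs : 1 ≤ s) (f g : Rn n → ℝ≥0∞) {Q P : Set (Rn n)} (hQP : Q ⊆ P)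
    (hv : volume P = 4 ^ n * volume Q) :
    formTerm α p₀ s f g Q ≤ (4 ^ n * 4 ^ n) * formTerm α p₀ s f g P := by
  have hc : (1 : ℝ≥0∞) ≤ 4 ^ n := one_le_pow₀ (by norm_num)
  have hn : n ≠ 0 := by
    rintro rfl
    simp only [Nat.cast_zero] at hαn
    linarith
  have h1 := fracAvg_le_of_subset hn le_rfl (by positivity) hp₀ f hQP hc (by finiteness) hv
  have h2 := fracAvg_le_of_subset hn hα hαn.le hs g hQP hc (by finiteness) hv
  calc formTerm α p₀ s f g Q
      ≤ (4 ^ n * fracAvg 0 p₀ P f) * (4 ^ n * fracAvg α s P g) * volume P := by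
        unfold formTerm
        gcongr
    _ = _ := by
        unfold formTerm
        ring

/-- The average of `f` is controlled by its Lorentz norm over `Q`: this is where the restricted
Muckenhoupt constant enters. -/
theorem lintegral_rpow_mul_wMeasure_le {n : ℕ} {p₀ p q : ℝ} (hp₀ : 1 ≤ p₀) (hp : p₀ ≤ p)
    (hpq : p ≤ q) {w : Rn n → ℝ≥0} (hw : Measurable w) (hpos : ∀ᵐ x, w x ≠ 0)
    (hA : aRConst (p / p₀) (q / p₀) (fun x => w x ^ p₀) < ∞) {f : Rn n → ℝ} (hf : ∀ x, 0 ≤ f x)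
    (hfm : Measurable f) {Q : Set (Rn n)} (hQ : IsCube Q) :
    (∫⁻ x in Q, ENNReal.ofReal (f x) ^ p₀) ^ (1 / p₀) * volume Q ^ ((1 / p - 1 / q) - 1 / p₀) *
        wMeasure (fun x => w x ^ q) Q ^ (1 / q) ≤
      ENNReal.ofReal p₀ * aRConst (p / p₀) (q / p₀) (fun x => w x ^ p₀) ^ (1 / p₀) *
        lorentzIntegral p ((wMeasure fun x => w x ^ p).restrict Q) f := by
  have hp₀' : 0 < p₀ := by linarith
  have hp' : 0 < p := by linarith
  have hq' : 0 < q := by linarith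
  set A := aRConst (p / p₀) (q / p₀) (fun x => w x ^ p₀) with hAdef
  set uQ := wMeasure (fun x => w x ^ q) Q with huQ
  set v := wMeasure fun x => w x ^ p with hv
  have h0 := hQ.volume_ne_zero
  have ht := hQ.volume_ne_top
  have hut : uQ ≠ ∞ := wMeasure_ne_top hp₀' hp' hq' hw hA hQ
  have h1 : (∫⁻ x in Q, ENNReal.ofReal (f x) ^ p₀) ^ (1 / p₀) ≤
      ENNReal.ofReal p₀ * lorentzIntegral p₀ (volume.restrict Q) f := by
    calc _ ≤ (ENNReal.ofReal p₀ * lorentzIntegral p₀ (volume.restrict Q) f ^ p₀) ^ (1 / p₀) :=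
          ENNReal.rpow_le_rpow (lintegral_rpow_le_lorentzIntegral hp₀ _ hf hfm.aemeasurable)
            (by positivity)
      _ = ENNReal.ofReal p₀ ^ (1 / p₀) * lorentzIntegral p₀ (volume.restrict Q) f := by
          rw [ENNReal.mul_rpow_of_nonneg _ _ (by positivity), ← ENNReal.rpow_mul,
            mul_one_div_cancel hp₀'.ne', ENNReal.rpow_one]
      _ ≤ ENNReal.ofReal p₀ ^ (1 : ℝ) * lorentzIntegral p₀ (volume.restrict Q) f := by
          gcongr
          · simpa using hp₀
          · rw [div_le_one hp₀']
            exact hp₀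
      _ = _ := by rw [ENNReal.rpow_one]
  have h2 : lorentzIntegral p₀ (volume.restrict Q) f * uQ ^ (1 / q) ≤
      (A ^ (1 / p₀) * volume Q ^ (1 / p₀ - (1 / p - 1 / q))) * lorentzIntegral p (v.restrict Q) f := by
    rw [lorentzIntegral, lorentzIntegral,
      ← lintegral_mul_const' _ _ (ENNReal.rpow_ne_top_of_nonneg (by positivity) hut),
      ← lintegral_const_mul _ (measurable_measure_lt hp'.le _ f)]
    refine lintegral_mono fun y => ?_
    have hm : MeasurableSet {x | y < f x} := measurableSet_lt measurable_const hfm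
    rw [Measure.restrict_apply hm, Measure.restrict_apply hm]
    have h3 := ENNReal.rpow_le_rpow (volume_mul_wMeasure_rpow_le hp₀' hp hpq hw hpos hA hQ
      (hm.inter hQ.measurableSet) inter_subset_right) (show 0 ≤ 1 / p₀ by positivity)
    rw [ENNReal.mul_rpow_of_nonneg _ _ (by positivity), ENNReal.mul_rpow_of_nonneg _ _ (by positivity),
      ENNReal.mul_rpow_of_nonneg _ _ (by positivity), ← ENNReal.rpow_mul, ← ENNReal.rpow_mul,
      ← ENNReal.rpow_mul] at h3
    convert h3 using 3
    · field_simp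
    · congr 1
      field_simp
    · field_simp
  have e : volume Q ^ ((1 / p - 1 / q) - 1 / p₀) * volume Q ^ (1 / p₀ - (1 / p - 1 / q)) = 1 := by
    rw [← ENNReal.rpow_add _ _ h0 ht]
    simp
  generalize hx : volume Q ^ ((1 / p - 1 / q) - 1 / p₀) = x at *
  generalize hy : volume Q ^ (1 / p₀ - (1 / p - 1 / q)) = y at *
  calc _ ≤ ENNReal.ofReal p₀ * lorentzIntegral p₀ (volume.restrict Q) f * x * uQ ^ (1 / q) := by
        gcongr
    _ = ENNReal.ofReal p₀ * x * (lorentzIntegral p₀ (volume.restrict Q) f * uQ ^ (1 / q)) := by ring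
    _ ≤ ENNReal.ofReal p₀ * x * ((A ^ (1 / p₀) * y) * lorentzIntegral p (v.restrict Q) f) := by
        gcongr
    _ = ENNReal.ofReal p₀ * A ^ (1 / p₀) * lorentzIntegral p (v.restrict Q) f * (x * y) := by ring
    _ = _ := by rw [e, mul_one]

/-- The average of a function dominated by `U` on `G`, by interpolation between `U` and `U ^ r`. An
absolute continuity of `U ^ r` with respect to `U` improves the power of the relative mass of `G`
from `1 - 1 / q` to `1 - 1 / q + δ / (q r)`. -/
theorem lintegral_rpow_indicator_le {n : ℕ} {q r s δ : ℝ} (hq : 1 ≤ q) (hr : 1 < r) (hs : 1 ≤ s)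
    (hδ : 0 ≤ δ) (hsq : s / (q * r) + s * (1 - 1 / q) = 1) {U : Rn n → ℝ≥0} (hU : Measurable U)
    {P G : Set (Rn n)} (hP : IsCube P) (hG : MeasurableSet G) {R : ℝ≥0∞}
    (hu0 : ∫⁻ x in P, (U x : ℝ≥0∞) ≠ 0) (hut : ∫⁻ x in P, (U x : ℝ≥0∞) ≠ ∞)
    (hRH : ∫⁻ x in P, (U x : ℝ≥0∞) ^ r ≤
      R ^ r * ((∫⁻ x in P, (U x : ℝ≥0∞)) / volume P) ^ r * volume P)
    (hGe : ∫⁻ x in G ∩ P, (U x : ℝ≥0∞) ^ r ≤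
      4 * ((∫⁻ x in G ∩ P, (U x : ℝ≥0∞)) / ∫⁻ x in P, (U x : ℝ≥0∞)) ^ δ *
        ∫⁻ x in P, (U x : ℝ≥0∞) ^ r) {g : Rn n → ℝ≥0∞}
    (hg : ∀ x, g x ≤ G.indicator (fun x => (U x : ℝ≥0∞)) x) :
    (∫⁻ x in P, g x ^ s) ^ (1 / s) * volume P ^ (1 - 1 / s) ≤
      4 * R ^ (1 / q) * ((∫⁻ x in P, (U x : ℝ≥0∞)) *
        ((∫⁻ x in G ∩ P, (U x : ℝ≥0∞)) / ∫⁻ x in P, (U x : ℝ≥0∞)) ^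
          (1 - 1 / q + δ / (q * r))) := by
  have hq0 : 0 < q := by linarith
  have hr0 : 0 < r := by linarith
  have hs0 : 0 < s := by linarith
  have hq1 : 0 ≤ 1 - 1 / q := by
    rw [sub_nonneg, div_le_one hq0]
    exact hq
  have h0 := hP.volume_ne_zero
  have ht := hP.volume_ne_top
  have hGP : MeasurableSet (G ∩ P) := hG.inter hP.measurableSet
  set uP := ∫⁻ x in P, (U x : ℝ≥0∞) with huP
  set uG := ∫⁻ x in G ∩ P, (U x : ℝ≥0∞) with huG
  set σG := ∫⁻ x in G ∩ P, (U x : ℝ≥0∞) ^ r with hσG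
  set t := uG / uP with htdef
  have htt : t ≠ ∞ := ENNReal.div_ne_top
    (ne_top_of_le_ne_top hut (lintegral_mono_set inter_subset_right)) hu0
  have huGt : uG = t * uP := (ENNReal.div_mul_cancel hu0 hut).symm
  have h1 : ∫⁻ x in P, g x ^ s ≤ σG ^ (s / (q * r)) * uG ^ (s * (1 - 1 / q)) := by
    calc ∫⁻ x in P, g x ^ s ≤ ∫⁻ x in P, G.indicator (fun x => (U x : ℝ≥0∞) ^ s) x := by
          refine lintegral_mono fun x => ?_
          refine (ENNReal.rpow_le_rpow (hg x) hs0.le).trans ?_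
          by_cases hx : x ∈ G <;> simp [hx, hs0]
      _ = ∫⁻ x in G ∩ P, (U x : ℝ≥0∞) ^ s := by
          rw [lintegral_indicator hG, Measure.restrict_restrict hG]
      _ = ∫⁻ x in G ∩ P, ((U x : ℝ≥0∞) ^ r) ^ (s / (q * r)) * (U x : ℝ≥0∞) ^ (s * (1 - 1 / q)) := by
          refine lintegral_congr fun x => ?_
          rw [← ENNReal.rpow_mul, ← ENNReal.rpow_add_of_nonneg _ _ (by positivity) (by positivity)]
          congr 1
          field_simp
          ring
      _ ≤ _ := ENNReal.lintegral_mul_norm_pow_le (by fun_prop) (by fun_prop) (by positivity)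
            (by positivity) hsq
  have h2 : (∫⁻ x in P, g x ^ s) ^ (1 / s) ≤ σG ^ (1 / (q * r)) * uG ^ (1 - 1 / q) := by
    calc _ ≤ (σG ^ (s / (q * r)) * uG ^ (s * (1 - 1 / q))) ^ (1 / s) :=
          ENNReal.rpow_le_rpow h1 (by positivity)
      _ = _ := by
          rw [ENNReal.mul_rpow_of_nonneg _ _ (by positivity), ← ENNReal.rpow_mul,
            ← ENNReal.rpow_mul]
          congr 2 <;> field_simp
  have h3 : σG ^ (1 / (q * r)) ≤ 4 * t ^ (δ / (q * r)) *
      (R ^ (1 / q) * uP ^ (1 / q) * volume P ^ (-(1 - 1 / s))) := by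
    have hqr : 0 ≤ 1 / (q * r) := by positivity
    calc σG ^ (1 / (q * r)) ≤ (4 * t ^ δ * (R ^ r * (uP / volume P) ^ r * volume P)) ^ (1 / (q * r)) :=
          ENNReal.rpow_le_rpow (hGe.trans (mul_le_mul_right hRH _)) hqr
      _ = 4 ^ (1 / (q * r)) * t ^ (δ / (q * r)) *
          (R ^ (1 / q) * uP ^ (1 / q) * (volume P ^ (-(1 / q)) * volume P ^ (1 / (q * r)))) := by
          rw [ENNReal.mul_rpow_of_nonneg _ _ hqr, ENNReal.mul_rpow_of_nonneg _ _ hqr,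
            ENNReal.mul_rpow_of_nonneg _ _ hqr, ENNReal.mul_rpow_of_nonneg _ _ hqr,
            ← ENNReal.rpow_mul, ← ENNReal.rpow_mul, ← ENNReal.rpow_mul]
          have e1 : r * (1 / (q * r)) = 1 / q := by field_simp
          have e2 : δ * (1 / (q * r)) = δ / (q * r) := by field_simp
          rw [e1, e2, ENNReal.div_rpow_of_nonneg uP _ (by positivity), ENNReal.rpow_neg,
            ENNReal.div_eq_inv_mul]
          generalize t ^ (δ / (q * r)) = t'
          ring
      _ = 4 ^ (1 / (q * r)) * t ^ (δ / (q * r)) *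
          (R ^ (1 / q) * uP ^ (1 / q) * volume P ^ (-(1 - 1 / s))) := by
          rw [← ENNReal.rpow_add _ _ h0 ht]
          congr 3
          have : 1 / (q * r) + (1 - 1 / q) = 1 / s := by
            rw [eq_div_iff hs0.ne']
            refine Eq.trans ?_ hsq
            ring
          linarith
      _ ≤ 4 ^ (1 : ℝ) * t ^ (δ / (q * r)) *
          (R ^ (1 / q) * uP ^ (1 / q) * volume P ^ (-(1 - 1 / s))) := by
          gcongr
          · norm_num
          · rw [div_le_one (by positivity)]
            exact one_le_mul_of_one_le_of_one_le hq hr.le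
      _ = _ := by rw [ENNReal.rpow_one]
  have e : volume P ^ (-(1 - 1 / s)) * volume P ^ (1 - 1 / s) = 1 := by
    rw [← ENNReal.rpow_add _ _ h0 ht]
    simp
  generalize volume P ^ (-(1 - 1 / s)) = y at *
  generalize volume P ^ (1 - 1 / s) = z at *
  calc _ ≤ σG ^ (1 / (q * r)) * uG ^ (1 - 1 / q) * z := by gcongr
    _ ≤ 4 * t ^ (δ / (q * r)) * (R ^ (1 / q) * uP ^ (1 / q) * y) * (t * uP) ^ (1 - 1 / q) * z := by
        rw [← huGt]
        gcongr
    _ = 4 * R ^ (1 / q) * ((uP ^ (1 / q) * uP ^ (1 - 1 / q)) *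
          (t ^ (1 - 1 / q) * t ^ (δ / (q * r)))) * (y * z) := by
        rw [ENNReal.mul_rpow_of_nonneg _ _ hq1]
        ring
    _ = _ := by
        rw [e, mul_one, ← ENNReal.rpow_add_of_nonneg _ _ (by positivity) hq1,
          ← ENNReal.rpow_add_of_nonneg _ _ hq1 (by positivity), add_sub_cancel, ENNReal.rpow_one]

/-! ### Weighted bounds for sparse forms -/

/-- A term of the sparse form, in terms of the normalized Lorentz norm `z` of `f` over the cube and
of the relative mass of the set `G` that carries `g`. -/
theorem formTerm_le {n : ℕ} {α p₀ p q s δ : ℝ} (hn : n ≠ 0) (hp₀ : 1 ≤ p₀) (hp : p₀ ≤ p)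
    (hpq : p ≤ q) (hs : 1 ≤ s) (hα : 1 / p - 1 / q = α / (n * s)) {w : Rn n → ℝ≥0}
    (hw : Measurable w) (hpos : ∀ᵐ x, w x ≠ 0)
    (hA : aRConst (p / p₀) (q / p₀) (fun x => w x ^ p₀) < ∞) {f : Rn n → ℝ} (hf : ∀ x, 0 ≤ f x)
    (hfm : Measurable f) {g : Rn n → ℝ≥0∞} {Cg : ℝ≥0∞} {G Q : Set (Rn n)} (hQ : IsCube Q)
    {γ : ℝ≥0∞} (hγ0 : γ ≠ 0) (hγt : γ ≠ ∞)
    (hg : (∫⁻ x in Q, g x ^ s) ^ (1 / s) * volume Q ^ (1 - 1 / s) ≤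
      Cg * (wMeasure (fun x => w x ^ q) Q * (wMeasure (fun x => w x ^ q) (G ∩ Q) /
        wMeasure (fun x => w x ^ q) Q) ^ (1 - 1 / q + δ))) :
    formTerm α p₀ s (fun x => ENNReal.ofReal (f x)) g Q ≤
      ENNReal.ofReal p₀ * aRConst (p / p₀) (q / p₀) (fun x => w x ^ p₀) ^ (1 / p₀) * Cg * γ *
        (((lorentzIntegral p ((wMeasure fun x => w x ^ p).restrict Q) f / γ) ^ q /
          wMeasure (fun x => w x ^ q) Q) ^ (1 / q) *
        (wMeasure (fun x => w x ^ q) (G ∩ Q) / wMeasure (fun x => w x ^ q) Q) ^ (1 - 1 / q + δ) *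
        wMeasure (fun x => w x ^ q) Q) := by
  have hp₀' : 0 < p₀ := by linarith
  have hp' : 0 < p := by linarith
  have hq' : 0 < q := by linarith
  have h1 := lintegral_rpow_mul_wMeasure_le hp₀ hp hpq hw hpos hA hf hfm hQ
  rw [formTerm_eq hp₀' (by linarith) hn _ _ hQ, ← hα]
  set u := wMeasure (fun x => w x ^ q) Q with hu
  set t := wMeasure (fun x => w x ^ q) (G ∩ Q) / u with ht
  set b := lorentzIntegral p ((wMeasure fun x => w x ^ p).restrict Q) f with hb
  set A := aRConst (p / p₀) (q / p₀) (fun x => w x ^ p₀) with hAdef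
  have hu0 : u ≠ 0 := wMeasure_ne_zero hw hpos q hQ.volume_ne_zero
  have hut : u ≠ ∞ := wMeasure_ne_top hp₀' hp' hq' hw hA hQ
  have hu0' : u ^ (1 / q) ≠ 0 := (ENNReal.rpow_pos (pos_iff_ne_zero.2 hu0) hut).ne'
  have hut' : u ^ (1 / q) ≠ ∞ := ENNReal.rpow_ne_top_of_nonneg (by positivity) hut
  have h2 : ((b / γ) ^ q / u) ^ (1 / q) * γ = b / u ^ (1 / q) := by
    rw [ENNReal.div_rpow_of_nonneg _ _ (by positivity), ← ENNReal.rpow_mul,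
      mul_one_div_cancel hq'.ne', ENNReal.rpow_one]
    generalize u ^ (1 / q) = y
    calc b / γ / y * γ = b / γ * γ / y := by simp only [div_eq_mul_inv]; ring
      _ = b / y := by rw [ENNReal.div_mul_cancel hγ0 hγt]
  calc _ ≤ (ENNReal.ofReal p₀ * A ^ (1 / p₀) * b / u ^ (1 / q)) *
        (Cg * (u * t ^ (1 - 1 / q + δ))) := by
        gcongr
        rw [ENNReal.le_div_iff_mul_le (Or.inl hu0') (Or.inl hut')]
        exact h1
    _ = ENNReal.ofReal p₀ * A ^ (1 / p₀) * Cg * (b / u ^ (1 / q)) * (t ^ (1 - 1 / q + δ) * u) := by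
        generalize u ^ (1 / q) = y
        generalize t ^ (1 - 1 / q + δ) = t'
        simp only [div_eq_mul_inv]
        ring
    _ = _ := by
        rw [← h2]
        generalize ((b / γ) ^ q / u) ^ (1 / q) = z
        ring

/-- The part of a sparse form in one nested family that is Carleson with respect to `w ^ q`. The
terms with `z > 1` vanish because `G` avoids the corresponding cubes. -/
theorem sum_formTerm_le_of_carleson {ι : Type*} {n : ℕ} {α p₀ p q s δ : ℝ} (hn : n ≠ 0)
    (hp₀ : 1 ≤ p₀) (hp : p₀ ≤ p) (hpq : p ≤ q) (hs : 1 ≤ s) (hα : 1 / p - 1 / q = α / (n * s))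
    (hδ : 0 < δ) (hδ1 : δ ≤ 1) {w : Rn n → ℝ≥0} (hw : Measurable w) (hpos : ∀ᵐ x, w x ≠ 0)
    (hA : aRConst (p / p₀) (q / p₀) (fun x => w x ^ p₀) < ∞) {f : Rn n → ℝ} (hf : ∀ x, 0 ≤ f x)
    (hfm : Measurable f) {g : Rn n → ℝ≥0∞} {Cg K : ℝ≥0∞} {G : Set (Rn n)} (P : ι → Set (Rn n))
    (I : Finset ι) (hPc : ∀ i ∈ I, IsCube (P i)) (hG : MeasurableSet G)
    (hP : ∀ i ∈ I, ∀ j ∈ I, Disjoint (P i) (P j) ∨ P i ⊆ P j ∨ P j ⊆ P i)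
    (hK : ∀ J ⊆ I, ∑ i ∈ J, wMeasure (fun x => w x ^ q) (P i) ≤
      K * wMeasure (fun x => w x ^ q) (⋃ i ∈ J, P i))
    {γ : ℝ≥0∞} (hγ0 : γ ≠ 0) (hγt : γ ≠ ∞)
    (hg : ∀ i ∈ I, (∫⁻ x in P i, g x ^ s) ^ (1 / s) * volume (P i) ^ (1 - 1 / s) ≤
      Cg * (wMeasure (fun x => w x ^ q) (P i) * (wMeasure (fun x => w x ^ q) (G ∩ P i) /
        wMeasure (fun x => w x ^ q) (P i)) ^ (1 - 1 / q + δ)))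
    (hω : ∀ i ∈ I, γ * wMeasure (fun x => w x ^ q) (P i) ^ (1 / q) <
      lorentzIntegral p ((wMeasure fun x => w x ^ p).restrict (P i)) f →
        wMeasure (fun x => w x ^ q) (G ∩ P i) = 0) :
    ∑ i ∈ I, formTerm α p₀ s (fun x => ENNReal.ofReal (f x)) g (P i) ≤
      ENNReal.ofReal p₀ * aRConst (p / p₀) (q / p₀) (fun x => w x ^ p₀) ^ (1 / p₀) * Cg * γ *
        (ENNReal.ofReal (2 / δ) * (K * ((lorentzIntegral p (wMeasure fun x => w x ^ p) f / γ) ^ q +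
          wMeasure (fun x => w x ^ q) G))) := by
  classical
  have hp₀' : 0 < p₀ := by linarith
  have hp' : 0 < p := by linarith
  have hq' : 0 < q := by linarith
  have hq1 : 1 / q ≤ 1 := by
    rw [div_le_one hq']
    linarith
  set u := wMeasure (fun x => w x ^ q) with hu
  set v := wMeasure (fun x => w x ^ p) with hv
  have hu0 : ∀ i ∈ I, u (P i) ≠ 0 := fun i hi =>
    wMeasure_ne_zero hw hpos q (hPc i hi).volume_ne_zero
  have hut : ∀ i ∈ I, u (P i) ≠ ∞ := fun i hi => wMeasure_ne_top hp₀' hp' hq' hw hA (hPc i hi)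
  set b : ι → ℝ≥0∞ := fun i => lorentzIntegral p (v.restrict (P i)) f with hb
  set B := lorentzIntegral p v f with hB
  set z : ι → ℝ≥0∞ := fun i => (b i / γ) ^ q / u (P i) with hz
  set t : ι → ℝ≥0∞ := fun i => u (G ∩ P i) / u (P i) with ht
  set I' := I.filter fun i => z i ≤ 1 with hI'
  have hI'I : I' ⊆ I := Finset.filter_subset _ _
  have hterm : ∀ i ∈ I, formTerm α p₀ s (fun x => ENNReal.ofReal (f x)) g (P i) ≤
      ENNReal.ofReal p₀ * aRConst (p / p₀) (q / p₀) (fun x => w x ^ p₀) ^ (1 / p₀) * Cg * γ *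
        (z i ^ (1 / q) * t i ^ (1 - 1 / q + δ) * u (P i)) := fun i hi =>
    formTerm_le hn hp₀ hp hpq hs hα hw hpos hA hf hfm (hPc i hi) hγ0 hγt (hg i hi)
  have hzero : ∀ i ∈ I, i ∉ I' → z i ^ (1 / q) * t i ^ (1 - 1 / q + δ) * u (P i) = 0 := by
    intro i hi hiI'
    have h1 : 1 < z i := not_le.1 fun h => hiI' (Finset.mem_filter.2 ⟨hi, h⟩)
    have h2 : u (G ∩ P i) = 0 := by
      refine hω i hi ?_
      by_contra h3
      refine absurd h1 (not_lt.2 ?_)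
      refine ENNReal.div_le_of_le_mul ?_
      rw [one_mul]
      calc (b i / γ) ^ q ≤ (u (P i) ^ (1 / q)) ^ q := by
            refine ENNReal.rpow_le_rpow (ENNReal.div_le_of_le_mul ?_) hq'.le
            rw [mul_comm]
            exact not_lt.1 h3
        _ = u (P i) := by
            rw [← ENNReal.rpow_mul, one_div_mul_cancel hq'.ne', ENNReal.rpow_one]
    have h4 : t i = 0 := by simp [ht, h2]
    rw [h4, ENNReal.zero_rpow_of_pos (by linarith)]
    simp
  have hmain : ∑ i ∈ I', z i ^ (1 / q) * t i ^ (1 - 1 / q + δ) * u (P i) ≤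
      ENNReal.ofReal (2 / δ) * (K * ((B / γ) ^ q + u G)) := by
    refine sum_rpow_mul_rpow_mul_measure_le u P I' (fun i hi j hj => hP i (hI'I hi) j (hI'I hj))
      K _ _ (fun J hJ => hK J (hJ.trans hI'I)) z t (fun i hi => (Finset.mem_filter.1 hi).2) ?_ ?_ ?_
      (by positivity) hq1 hδ hδ1
    · intro i hi
      refine ENNReal.div_le_of_le_mul ?_
      rw [one_mul]
      exact measure_mono inter_subset_right
    · intro J hJ hd
      calc ∑ i ∈ J, z i * u (P i) = ∑ i ∈ J, (b i) ^ q / γ ^ q := by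
            refine Finset.sum_congr rfl fun i hi => ?_
            rw [hz]
            simp only
            rw [ENNReal.div_mul_cancel (hu0 i (hI'I (hJ hi))) (hut i (hI'I (hJ hi))),
              ENNReal.div_rpow_of_nonneg _ _ hq'.le]
        _ = (∑ i ∈ J, b i ^ q) / γ ^ q := by
            simp only [div_eq_mul_inv]
            rw [Finset.sum_mul]
        _ ≤ B ^ q / γ ^ q := by
            gcongr
            exact sum_lorentzIntegral_rpow_le (hp₀.trans hp) hpq v f P J hd
              fun i hi => (hPc i (hI'I (hJ hi))).measurableSet
        _ = _ := (ENNReal.div_rpow_of_nonneg _ _ hq'.le).symm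
    · intro J hJ hd
      calc ∑ i ∈ J, t i * u (P i) = ∑ i ∈ J, u (G ∩ P i) := by
            refine Finset.sum_congr rfl fun i hi => ?_
            exact ENNReal.div_mul_cancel (hu0 i (hI'I (hJ hi))) (hut i (hI'I (hJ hi)))
        _ = u (⋃ i ∈ J, G ∩ P i) := by
            rw [measure_biUnion_finset]
            · exact hd.mono_on fun i _ => inter_subset_right
            · exact fun i hi => hG.inter (hPc i (hI'I (hJ hi))).measurableSet
        _ ≤ u G := measure_mono (iUnion₂_subset fun i _ => inter_subset_left)
  calc _ ≤ ∑ i ∈ I, ENNReal.ofReal p₀ * aRConst (p / p₀) (q / p₀) (fun x => w x ^ p₀) ^ (1 / p₀) *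
        Cg * γ * (z i ^ (1 / q) * t i ^ (1 - 1 / q + δ) * u (P i)) := Finset.sum_le_sum hterm
    _ = ENNReal.ofReal p₀ * aRConst (p / p₀) (q / p₀) (fun x => w x ^ p₀) ^ (1 / p₀) * Cg * γ *
        ∑ i ∈ I', z i ^ (1 / q) * t i ^ (1 - 1 / q + δ) * u (P i) := by
        rw [← Finset.mul_sum, Finset.sum_subset hI'I hzero]
    _ ≤ _ := by gcongr

/-- The sparse form over an almost everywhere disjoint family. Hölder's inequality replaces the
Carleson embedding, so neither a gain `δ` nor the exceptional set is needed. -/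
theorem sum_formTerm_le_of_disjoint {ι : Type*} {n : ℕ} {α p₀ p q s : ℝ} (hn : n ≠ 0)
    (hp₀ : 1 ≤ p₀) (hp : p₀ ≤ p) (hpq : p ≤ q) (hs : 1 ≤ s) (hα : 1 / p - 1 / q = α / (n * s))
    {w : Rn n → ℝ≥0} (hw : Measurable w) (hpos : ∀ᵐ x, w x ≠ 0)
    (hA : aRConst (p / p₀) (q / p₀) (fun x => w x ^ p₀) < ∞) {f : Rn n → ℝ} (hf : ∀ x, 0 ≤ f x)
    (hfm : Measurable f) {g : Rn n → ℝ≥0∞} {Cg : ℝ≥0∞} {G : Set (Rn n)} (P E : ι → Set (Rn n))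
    (I : Finset ι) (hPc : ∀ i ∈ I, IsCube (P i)) (hG : MeasurableSet G)
    (hE : (I : Set ι).PairwiseDisjoint E) (hEm : ∀ i ∈ I, MeasurableSet (E i))
    (hEP : ∀ i ∈ I, E i ⊆ P i) (hv : ∀ i ∈ I, volume (P i) ≤ volume (E i))
    {γ : ℝ≥0∞} (hγ0 : γ ≠ 0) (hγt : γ ≠ ∞)
    (hg : ∀ i ∈ I, (∫⁻ x in P i, g x ^ s) ^ (1 / s) * volume (P i) ^ (1 - 1 / s) ≤
      Cg * (wMeasure (fun x => w x ^ q) (P i) * (wMeasure (fun x => w x ^ q) (G ∩ P i) /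
        wMeasure (fun x => w x ^ q) (P i)) ^ (1 - 1 / q + 0))) :
    ∑ i ∈ I, formTerm α p₀ s (fun x => ENNReal.ofReal (f x)) g (P i) ≤
      ENNReal.ofReal p₀ * aRConst (p / p₀) (q / p₀) (fun x => w x ^ p₀) ^ (1 / p₀) * Cg * γ *
        ((lorentzIntegral p (wMeasure fun x => w x ^ p) f / γ) ^ q +
          wMeasure (fun x => w x ^ q) G) := by
  have hp₀' : 0 < p₀ := by linarith
  have hp' : 0 < p := by linarith
  have hq' : 0 < q := by linarith
  have hq1 : 0 ≤ 1 - 1 / q := by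
    rw [sub_nonneg, div_le_one hq']
    linarith
  set u := wMeasure (fun x => w x ^ q) with hu
  set v := wMeasure (fun x => w x ^ p) with hvdef
  have hae : ∀ i ∈ I, E i =ᵐ[volume] P i := fun i hi =>
    ae_eq_of_subset_of_measure_ge (hEP i hi) (hv i hi) (hEm i hi).nullMeasurableSet
      (hPc i hi).volume_ne_top
  have hu0 : ∀ i ∈ I, u (P i) ≠ 0 := fun i hi =>
    wMeasure_ne_zero hw hpos q (hPc i hi).volume_ne_zero
  have hut : ∀ i ∈ I, u (P i) ≠ ∞ := fun i hi => wMeasure_ne_top hp₀' hp' hq' hw hA (hPc i hi)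
  set b : ι → ℝ≥0∞ := fun i => lorentzIntegral p (v.restrict (P i)) f with hb
  set B := lorentzIntegral p v f with hB
  have hbE : ∀ i ∈ I, b i = lorentzIntegral p (v.restrict (E i)) f := by
    intro i hi
    rw [hb]
    simp only
    rw [Measure.restrict_congr_set ((wMeasure_absolutelyContinuous _).ae_le (hae i hi))]
  have huE : ∀ i ∈ I, u (G ∩ P i) = u (G ∩ E i) := by
    intro i hi
    refine measure_congr ((wMeasure_absolutelyContinuous _).ae_le ?_)
    exact (Filter.EventuallyEq.refl _ G).inter (hae i hi).symm
  have hterm : ∀ i ∈ I, formTerm α p₀ s (fun x => ENNReal.ofReal (f x)) g (P i) ≤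
      ENNReal.ofReal p₀ * aRConst (p / p₀) (q / p₀) (fun x => w x ^ p₀) ^ (1 / p₀) * Cg * γ *
        ((b i / γ) ^ q + u (G ∩ P i)) := by
    intro i hi
    refine (formTerm_le hn hp₀ hp hpq hs hα hw hpos hA hf hfm (hPc i hi) hγ0 hγt (hg i hi)).trans ?_
    rw [add_zero]
    refine mul_le_mul_right ?_ _
    set z := (b i / γ) ^ q / u (P i) with hz
    set t := u (G ∩ P i) / u (P i) with ht
    have h1 : z ^ (1 / q) * t ^ (1 - 1 / q) ≤ z + t := by
      calc z ^ (1 / q) * t ^ (1 - 1 / q) ≤ max z t ^ (1 / q) * max z t ^ (1 - 1 / q) :=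
            mul_le_mul' (ENNReal.rpow_le_rpow (le_max_left _ _) (by positivity))
              (ENNReal.rpow_le_rpow (le_max_right _ _) hq1)
        _ = max z t := by
            rw [← ENNReal.rpow_add_of_nonneg _ _ (by positivity) hq1, add_sub_cancel,
              ENNReal.rpow_one]
        _ ≤ z + t := max_le le_self_add le_add_self
    calc z ^ (1 / q) * t ^ (1 - 1 / q) * u (P i) ≤ (z + t) * u (P i) := by gcongr
      _ = _ := by
          rw [add_mul, hz, ht, ENNReal.div_mul_cancel (hu0 i hi) (hut i hi),
            ENNReal.div_mul_cancel (hu0 i hi) (hut i hi)]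
  refine (Finset.sum_le_sum hterm).trans ?_
  rw [← Finset.mul_sum, Finset.sum_add_distrib]
  refine mul_le_mul_right (add_le_add ?_ ?_) _
  · calc ∑ i ∈ I, (b i / γ) ^ q = (∑ i ∈ I, b i ^ q) / γ ^ q := by
          simp only [div_eq_mul_inv]
          rw [Finset.sum_mul]
          refine Finset.sum_congr rfl fun i _ => ?_
          rw [ENNReal.mul_rpow_of_nonneg _ _ hq'.le, ENNReal.inv_rpow]
      _ ≤ B ^ q / γ ^ q := by
          gcongr
          calc ∑ i ∈ I, b i ^ q = ∑ i ∈ I, lorentzIntegral p (v.restrict (E i)) f ^ q :=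
                Finset.sum_congr rfl fun i hi => by rw [hbE i hi]
            _ ≤ _ := sum_lorentzIntegral_rpow_le (hp₀.trans hp) hpq v f E I hE hEm
      _ = _ := (ENNReal.div_rpow_of_nonneg _ _ hq'.le).symm
  · calc ∑ i ∈ I, u (G ∩ P i) = ∑ i ∈ I, u (G ∩ E i) := Finset.sum_congr rfl huE
      _ = u (⋃ i ∈ I, G ∩ E i) := by
          rw [measure_biUnion_finset]
          · exact hE.mono_on fun i _ => inter_subset_right
          · exact fun i hi => hG.inter (hEm i hi)
      _ ≤ u G := measure_mono (iUnion₂_subset fun i _ => inter_subset_left)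

theorem exists_nat_carleson {η : ℝ} (hη : 0 < η) (hη1 : η < 1) (n : ℕ) :
    ∃ m : ℕ, (4 ^ n / ENNReal.ofReal η : ℝ≥0∞) ≤ (1 - ENNReal.ofReal η) * (m + 1) := by
  obtain ⟨m, hm⟩ := exists_nat_ge (4 ^ n / η / (1 - η))
  refine ⟨m, ?_⟩
  have h1 : 0 < 1 - η := by linarith
  rw [div_le_iff₀ h1] at hm
  have e : (4 ^ n / ENNReal.ofReal η : ℝ≥0∞) = ENNReal.ofReal (4 ^ n / η) := by
    rw [ENNReal.ofReal_div_of_pos hη, ENNReal.ofReal_pow (by norm_num)]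
    simp
  have e2 : (1 - ENNReal.ofReal η) * (m + 1) = ENNReal.ofReal ((1 - η) * (m + 1)) := by
    rw [ENNReal.ofReal_mul h1.le, ENNReal.ofReal_sub _ hη.le, ENNReal.ofReal_one,
      ENNReal.ofReal_add (by positivity) (by positivity)]
    simp
  rw [e, e2]
  exact ENNReal.ofReal_le_ofReal (by nlinarith)

/-- The weighted bound for sparse forms. For `η < 1` the cubes are enlarged to shifted dyadic cubes;
for `η = 1` they are almost everywhere disjoint, and no doubling is needed. -/
theorem exists_tsum_formTerm_le {n : ℕ} (hn : n ≠ 0) {η : ℝ} (hη : 0 < η) (hη1 : η ≤ 1) :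
    ∃ c : ℝ≥0, ∀ {α p₀ p q s δ : ℝ}, 1 ≤ p₀ → p₀ ≤ p → p ≤ q → 1 ≤ s → 0 ≤ α → α < n →
      1 / p - 1 / q = α / (n * s) → 0 < δ → δ ≤ 1 → ∀ {w : Rn n → ℝ≥0}, Measurable w →
      (∀ᵐ x, w x ≠ 0) → aRConst (p / p₀) (q / p₀) (fun x => w x ^ p₀) < ∞ →
      ∀ {f : Rn n → ℝ}, (∀ x, 0 ≤ f x) → Measurable f → ∀ {g : Rn n → ℝ≥0∞} {Cg : ℝ≥0∞}
        {G : Set (Rn n)}, MeasurableSet G → ∀ {γ : ℝ≥0∞}, γ ≠ 0 → γ ≠ ∞ →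
      (∀ a k m, (∫⁻ x in gridCube a k m, g x ^ s) ^ (1 / s) *
        volume (gridCube a k m) ^ (1 - 1 / s) ≤ Cg * (wMeasure (fun x => w x ^ q) (gridCube a k m) *
          (wMeasure (fun x => w x ^ q) (G ∩ gridCube a k m) /
            wMeasure (fun x => w x ^ q) (gridCube a k m)) ^ (1 - 1 / q + δ))) →
      (∀ Q, IsCube Q → (∫⁻ x in Q, g x ^ s) ^ (1 / s) * volume Q ^ (1 - 1 / s) ≤
        Cg * (wMeasure (fun x => w x ^ q) Q * (wMeasure (fun x => w x ^ q) (G ∩ Q) /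
          wMeasure (fun x => w x ^ q) Q) ^ (1 - 1 / q + 0))) →
      (∀ a k m, γ * wMeasure (fun x => w x ^ q) (gridCube a k m) ^ (1 / q) <
        lorentzIntegral p ((wMeasure fun x => w x ^ p).restrict (gridCube a k m)) f →
          wMeasure (fun x => w x ^ q) (G ∩ gridCube a k m) = 0) →
      ∀ {D : Set (Set (Rn n))}, IsDyadicGrid D → ∀ {S : Set (Set (Rn n))}, S ⊆ D → IsSparse η S →
      ∑' Q : S, formTerm α p₀ s (fun x => ENNReal.ofReal (f x)) g Q ≤
        c * (aRConst (p / p₀) (q / p₀) (fun x => w x ^ p₀) ^ (1 / p₀) * Cg *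
          ENNReal.ofReal (1 / δ) * doublingConst η (fun x => w x ^ q)) * ENNReal.ofReal p₀ * γ *
          ((lorentzIntegral p (wMeasure fun x => w x ^ p) f / γ) ^ q +
            wMeasure (fun x => w x ^ q) G) := by
  classical
  -- for `η = 1`, `doublingConst` sees no proper parts of cubes, so the enlargement is not available
  rcases hη1.lt_or_eq with hlt | rfl
  · obtain ⟨M, hM⟩ := exists_nat_carleson hη hlt n
    refine ⟨4 ^ n * 4 ^ n * 3 ^ n * 2 * M, ?_⟩
    intro α p₀ p q s δ hp₀ hp hpq hs hα0 hαn hα hδ hδ1 w hw hpos hA f hf hfm g Cg G hG γ hγ0 hγt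
      hg _ hω D hD S hSD hS
    obtain ⟨E, hEd, hE⟩ := hS
    have hp₀' : 0 < p₀ := by linarith
    have hut : ∀ Q, IsCube Q → wMeasure (fun x => w x ^ q) Q ≠ ∞ := fun Q hQ =>
      wMeasure_ne_top hp₀' (by linarith) (by linarith) hw hA hQ
    -- the shifted dyadic cubes that contain the members of the family
    have hex : ∀ Q : S, ∃ (a : Fin n → Fin 3) (k : ℤ) (m : Fin n → ℤ),
        (Q : Set (Rn n)) ⊆ gridCube a k m ∧
        volume (gridCube a k m) = 4 ^ n * volume (Q : Set (Rn n)) := by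
      intro Q
      obtain ⟨j, b, hQ⟩ := hD.scale Q (hSD Q.2)
      obtain ⟨a, m, hs⟩ := exists_gridCube_superset b j
      exact ⟨a, _, m, hQ ▸ hs, hQ ▸ volume_gridCube_eq a j m b⟩
    choose a k m hsub hvol using hex
    rw [ENNReal.tsum_eq_iSup_sum]
    refine iSup_le fun I => ?_
    set X := ENNReal.ofReal p₀ * aRConst (p / p₀) (q / p₀) (fun x => w x ^ p₀) ^ (1 / p₀) * Cg * γ *
        (ENNReal.ofReal (2 / δ) * ((doublingConst η (fun x => w x ^ q) * M) *
          ((lorentzIntegral p (wMeasure fun x => w x ^ p) f / γ) ^ q +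
          wMeasure (fun x => w x ^ q) G))) with hX
    have hone : ∀ a₀ : Fin n → Fin 3, ∑ Q ∈ I with a Q = a₀,
        formTerm α p₀ s (fun x => ENNReal.ofReal (f x)) g (gridCube (a Q) (k Q) (m Q)) ≤ X := by
      intro a₀
      have hnest : ∀ i ∈ I.filter fun Q => a Q = a₀, ∀ j ∈ I.filter fun Q => a Q = a₀,
          Disjoint (gridCube (a i) (k i) (m i)) (gridCube (a j) (k j) (m j)) ∨
          gridCube (a i) (k i) (m i) ⊆ gridCube (a j) (k j) (m j) ∨
          gridCube (a j) (k j) (m j) ⊆ gridCube (a i) (k i) (m i) := by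
        intro i hi j hj
        rw [(Finset.mem_filter.1 hi).2, (Finset.mem_filter.1 hj).2]
        exact gridCube_nested a₀ _ _ _ _
      refine sum_formTerm_le_of_carleson hn hp₀ hp hpq hs hα hδ hδ1 hw hpos hA hf hfm
        (fun Q => gridCube (a Q) (k Q) (m Q)) _ (fun Q _ => isCube_gridCube _ _ _) hG hnest ?_
        hγ0 hγt (fun Q _ => hg _ _ _) (fun Q _ => hω _ _ _)
      refine sum_measure_le_of_doubling volume _ _ (fun Q : S => E Q) _ (4 ^ n / ENNReal.ofReal η) _
        (ENNReal.ofReal η) M (ENNReal.ofReal_le_one.2 hη1) hnest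
        (fun Q _ => measurableSet_gridCube _ _ _) (fun Q _ => (isCube_gridCube _ _ _).volume_ne_top)
        ?_ (fun Q _ => (hE Q Q.2).1) (fun Q _ => (hE Q Q.2).2.1.trans (hsub Q)) ?_ hM ?_
      · intro Q _ Q' _ hne
        exact hEd Q.2 Q'.2 fun h => hne (Subtype.ext h)
      · intro Q _
        have hη0 : ENNReal.ofReal η ≠ 0 := by simpa using hη
        calc volume (gridCube (a Q) (k Q) (m Q)) = 4 ^ n * volume (Q : Set (Rn n)) := hvol Q
          _ = 4 ^ n / ENNReal.ofReal η * (ENNReal.ofReal η * volume (Q : Set (Rn n))) := by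
              rw [← mul_assoc, ENNReal.div_mul_cancel hη0 ENNReal.ofReal_ne_top]
          _ ≤ _ := by
              gcongr
              exact (hE Q Q.2).2.2
      · intro Q _ F hF hFP hl
        exact wMeasure_le_doublingConst_mul hη hw hpos hut
          (isShiftedDyadicCube_gridCube _ _ _) hF hFP hl
    calc ∑ Q ∈ I, formTerm α p₀ s (fun x => ENNReal.ofReal (f x)) g (Q : Set (Rn n))
        ≤ ∑ Q ∈ I, (4 ^ n * 4 ^ n) *
          formTerm α p₀ s (fun x => ENNReal.ofReal (f x)) g (gridCube (a Q) (k Q) (m Q)) :=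
          Finset.sum_le_sum fun Q _ => formTerm_le_of_subset hα0 hαn hp₀ hs _ _ (hsub Q) (hvol Q)
      _ = (4 ^ n * 4 ^ n) * ∑ a₀ : Fin n → Fin 3, ∑ Q ∈ I with a Q = a₀,
          formTerm α p₀ s (fun x => ENNReal.ofReal (f x)) g (gridCube (a Q) (k Q) (m Q)) := by
          rw [← Finset.mul_sum, Finset.sum_fiberwise]
      _ ≤ (4 ^ n * 4 ^ n) * ∑ a₀ : Fin n → Fin 3, X := by
          gcongr with a₀
          exact hone a₀
      _ = _ := by
          rw [Finset.sum_const, Finset.card_univ, Fintype.card_fun, Fintype.card_fin,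
            Fintype.card_fin, nsmul_eq_mul, hX, show 2 / δ = 2 * (1 / δ) by ring,
            ENNReal.ofReal_mul (by norm_num)]
          push_cast
          rw [ENNReal.ofReal_ofNat]
          generalize aRConst (p / p₀) (q / p₀) (fun x => w x ^ p₀) ^ (1 / p₀) = A
          ring
  · refine ⟨1, ?_⟩
    intro α p₀ p q s δ hp₀ hp hpq hs hα0 hαn hα hδ hδ1 w hw hpos hA f hf hfm g Cg G hG γ hγ0 hγt
      _ hg _ D hD S hSD hS
    obtain ⟨E, hEd, hE⟩ := hS
    have hp₀' : 0 < p₀ := by linarith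
    have hut : ∀ Q, IsCube Q → wMeasure (fun x => w x ^ q) Q ≠ ∞ := fun Q hQ =>
      wMeasure_ne_top hp₀' (by linarith) (by linarith) hw hA hQ
    rw [ENNReal.tsum_eq_iSup_sum]
    refine iSup_le fun I => ?_
    have hc : ∀ Q : S, IsCube (Q : Set (Rn n)) := by
      intro Q
      obtain ⟨j, b, hQ⟩ := hD.scale Q (hSD Q.2)
      exact ⟨b, _, by positivity, hQ⟩
    refine (sum_formTerm_le_of_disjoint hn hp₀ hp hpq hs hα hw hpos hA hf hfm
      (fun Q : S => (Q : Set (Rn n))) (fun Q : S => E Q) I (fun Q _ => hc Q) hG ?_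
      (fun Q _ => (hE Q Q.2).1) (fun Q _ => (hE Q Q.2).2.1) ?_ hγ0 hγt
      (fun Q _ => hg _ (hc Q))).trans ?_
    · intro Q _ Q' _ hne
      exact hEd Q.2 Q'.2 fun h => hne (Subtype.ext h)
    · intro Q _
      simpa using (hE Q Q.2).2.2
    · have h1 : (1 : ℝ≥0∞) ≤ ENNReal.ofReal (1 / δ) := by
        rw [← ENNReal.ofReal_one]
        exact ENNReal.ofReal_le_ofReal ((one_le_div hδ).2 hδ1)
      have h2 := one_le_doublingConst hη1 hw hpos hut
      gcongr ?_ * _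
      generalize aRConst (p / p₀) (q / p₀) (fun x => w x ^ p₀) ^ (1 / p₀) = A
      calc ENNReal.ofReal p₀ * A * Cg * γ = 1 * (A * Cg * 1 * 1) * ENNReal.ofReal p₀ * γ := by ring
        _ ≤ _ := by
            push_cast
            gcongr

/-! ### Sparse forms of bounded functions with small integrals -/

/-- A term of the sparse form for `f ≤ M χ_F` and `e ≤ b`: the density of `F` in `Q` may be lowered
to any power `a ≤ 1 / q`, because `1 / p₀ - (1 / p - 1 / q) ≥ 1 / q`. -/
theorem formTerm_le_of_bounded {n : ℕ} {α p₀ p q s a : ℝ} (hn : n ≠ 0) (hp₀ : 1 ≤ p₀) (hp : p₀ ≤ p)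
    (hpq : p ≤ q) (hs : 1 ≤ s) (hα : 1 / p - 1 / q = α / (n * s)) (ha0 : 0 ≤ a) (ha : a ≤ 1 / q)
    {f e : Rn n → ℝ≥0∞} {F Q : Set (Rn n)} {M b : ℝ≥0∞} (hF : MeasurableSet F)
    (hf : ∀ x, f x ≤ F.indicator (fun _ => M) x) (hQ : IsCube Q) (hb0 : b ≠ 0) (hbt : b ≠ ∞) :
    formTerm α p₀ s f e Q ≤ M * volume F ^ (1 / p - 1 / q) * b *
      ((volume (F ∩ Q) / volume Q) ^ a *
        ((∫⁻ x in Q, e x ^ s) / b ^ s / volume Q) ^ (1 / s) * volume Q) := by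
  have hp₀' : 0 < p₀ := by linarith
  have hp' : 0 < p := by linarith
  have hq' : 0 < q := by linarith
  have hs' : 0 < s := by linarith
  have hV0 := hQ.volume_ne_zero
  have hVt := hQ.volume_ne_top
  have hβ : 0 ≤ 1 / p - 1 / q := sub_nonneg.2 (one_div_le_one_div_of_le hp' hpq)
  have hp₀p : 1 / p ≤ 1 / p₀ := one_div_le_one_div_of_le hp₀' hp
  rw [formTerm_eq hp₀' hs' hn _ _ hQ, ← hα]
  set β := 1 / p - 1 / q with hβdef
  set V := volume Q with hV
  set x := volume (F ∩ Q) / V with hx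
  set Y := (∫⁻ x in Q, e x ^ s) / b ^ s / V with hY
  have hx1 : x ≤ 1 := by
    refine ENNReal.div_le_of_le_mul ?_
    rw [one_mul]
    exact measure_mono inter_subset_right
  have hxV : x * V = volume (F ∩ Q) := ENNReal.div_mul_cancel hV0 hVt
  have hbs0 : b ^ s ≠ 0 := by simp [hb0, hbt]
  have hbst : b ^ s ≠ ∞ := ENNReal.rpow_ne_top_of_nonneg hs'.le hbt
  have hYV : ∫⁻ x in Q, e x ^ s = Y * V * b ^ s := by
    rw [hY, ENNReal.div_mul_cancel hV0 hVt, ENNReal.div_mul_cancel hbs0 hbst]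
  have h1 : ∫⁻ x in Q, f x ^ p₀ ≤ M ^ p₀ * (x * V) := by
    rw [hxV]
    calc ∫⁻ x in Q, f x ^ p₀ ≤ ∫⁻ x in Q, F.indicator (fun _ => M ^ p₀) x := by
          refine lintegral_mono fun y => ?_
          refine (ENNReal.rpow_le_rpow (hf y) hp₀'.le).trans ?_
          by_cases hy : y ∈ F <;> simp [hy, hp₀']
      _ = M ^ p₀ * volume (F ∩ Q) := by
          rw [lintegral_indicator hF, setLIntegral_const, Measure.restrict_apply hF]
  have h2 : (∫⁻ x in Q, f x ^ p₀) ^ (1 / p₀) * V ^ (β - 1 / p₀) ≤ M * volume F ^ β * x ^ a := by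
    calc (∫⁻ x in Q, f x ^ p₀) ^ (1 / p₀) * V ^ (β - 1 / p₀) ≤
          (M ^ p₀ * (x * V)) ^ (1 / p₀) * V ^ (β - 1 / p₀) := by gcongr
      _ = M * (x ^ (1 / p₀) * (V ^ (1 / p₀) * V ^ (β - 1 / p₀))) := by
          rw [ENNReal.mul_rpow_of_nonneg _ _ (by positivity),
            ENNReal.mul_rpow_of_nonneg _ _ (by positivity), ← ENNReal.rpow_mul,
            mul_one_div_cancel hp₀'.ne', ENNReal.rpow_one]
          ring
      _ = M * ((x * V) ^ β * x ^ (1 / p₀ - β)) := by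
          rw [← ENNReal.rpow_add _ _ hV0 hVt, ENNReal.mul_rpow_of_nonneg _ _ hβ, mul_right_comm,
            ← ENNReal.rpow_add_of_nonneg _ _ hβ (by rw [hβdef]; linarith),
            show 1 / p₀ + (β - 1 / p₀) = β by ring, show β + (1 / p₀ - β) = 1 / p₀ by ring]
      _ ≤ M * (volume F ^ β * x ^ a) := by
          rw [hxV]
          have h4 : x ^ (1 / p₀ - β) ≤ x ^ a :=
            ENNReal.rpow_le_rpow_of_exponent_ge hx1 (by rw [hβdef]; linarith)
          gcongr
          exact inter_subset_left
      _ = _ := by ring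
  have h3 : (∫⁻ x in Q, e x ^ s) ^ (1 / s) * V ^ (1 - 1 / s) = b * (Y ^ (1 / s) * V) := by
    rw [hYV, ENNReal.mul_rpow_of_nonneg _ _ (by positivity),
      ENNReal.mul_rpow_of_nonneg _ _ (by positivity), ← ENNReal.rpow_mul,
      mul_one_div_cancel hs'.ne', ENNReal.rpow_one]
    have h4 : V = V ^ (1 / s) * V ^ (1 - 1 / s) := by
      rw [← ENNReal.rpow_add _ _ hV0 hVt, show 1 / s + (1 - 1 / s) = 1 by ring, ENNReal.rpow_one]
    calc _ = b * (Y ^ (1 / s) * (V ^ (1 / s) * V ^ (1 - 1 / s))) := by ring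
      _ = _ := by rw [← h4]
  rw [h3]
  calc _ ≤ M * volume F ^ β * x ^ a * (b * (Y ^ (1 / s) * V)) := by gcongr
    _ = _ := by ring

/-- The sparse form of two bounded functions, one of which lives on a set of finite measure; the
free parameter `κ` makes the form small as soon as the other function is small in `L ^ s`. -/
theorem tsum_formTerm_le_of_bounded {n : ℕ} {α p₀ p q s η a : ℝ} (hn : n ≠ 0) (hp₀ : 1 ≤ p₀)
    (hp : p₀ ≤ p) (hpq : p ≤ q) (hs : 1 ≤ s) (hα : 1 / p - 1 / q = α / (n * s)) (hη : 0 < η)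
    (ha0 : 0 ≤ a) (ha : a ≤ 1 / q) (has : 1 - 1 / s < a)
    {f e : Rn n → ℝ≥0∞} {F : Set (Rn n)} {M b : ℝ≥0∞} (hF : MeasurableSet F)
    (hf : ∀ x, f x ≤ F.indicator (fun _ => M) x) (hb0 : b ≠ 0) (hbt : b ≠ ∞)
    (he : ∀ x, e x ≤ b) {κ : ℝ≥0∞} (hκ0 : κ ≠ 0) (hκ : κ ≤ 1)
    {D : Set (Set (Rn n))} (hD : IsDyadicGrid D) {S : Set (Set (Rn n))} (hSD : S ⊆ D)
    (hS : IsSparse η S) :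
    ∑' Q : S, formTerm α p₀ s f e Q ≤
      M * volume F ^ (1 / p - 1 / q) * b * κ ^ (-a) * (ENNReal.ofReal (2 / (1 / s - 1 + a)) *
        ((ENNReal.ofReal η)⁻¹ * (κ * volume F + (∫⁻ x, e x ^ s) / b ^ s))) := by
  classical
  have hs' : 0 < s := by linarith
  have hq' : 0 < q := by linarith
  have hκt : κ ≠ ∞ := ne_top_of_le_ne_top ENNReal.one_ne_top hκ
  have hη' : ENNReal.ofReal η ≠ 0 := by simpa using hη
  have hcube : ∀ Q : S, IsCube (Q : Set (Rn n)) := by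
    intro Q
    obtain ⟨k, c, hc⟩ := hD.scale Q (hSD Q.2)
    exact ⟨c, _, by positivity, hc⟩
  have hq1 : 1 / q ≤ 1 := by
    rw [div_le_one hq']
    linarith
  have hs1 : 1 / s ≤ 1 := by
    rw [div_le_one hs']
    exact hs
  obtain ⟨E, hEd, hE⟩ := hS
  have hbs0 : b ^ s ≠ 0 := by simp [hb0, hbt]
  have hbst : b ^ s ≠ ∞ := ENNReal.rpow_ne_top_of_nonneg hs'.le hbt
  set β := 1 / p - 1 / q with hβdef
  rw [ENNReal.tsum_eq_iSup_sum]
  refine iSup_le fun I => ?_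
  set t : S → ℝ≥0∞ := fun Q => (∫⁻ x in (Q : Set (Rn n)), e x ^ s) / b ^ s / volume (Q : Set (Rn n))
    with ht
  set z : S → ℝ≥0∞ := fun Q => κ * (volume (F ∩ Q) / volume (Q : Set (Rn n))) with hz
  have hmain : ∑ Q ∈ I, z Q ^ a * t Q ^ (1 - a + (1 / s - 1 + a)) * volume (Q : Set (Rn n)) ≤
      ENNReal.ofReal (2 / (1 / s - 1 + a)) *
        ((ENNReal.ofReal η)⁻¹ * (κ * volume F + (∫⁻ x, e x ^ s) / b ^ s)) := by
    refine sum_rpow_mul_rpow_mul_measure_le volume (fun Q : S => (Q : Set (Rn n))) I ?_ _ _ _ ?_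
      z t ?_ ?_ ?_ ?_ ha0 (ha.trans hq1) (by linarith) (by linarith)
    · intro Q _ Q' _
      rcases hD.nested Q (hSD Q.2) Q' (hSD Q'.2) with h | h | h
      · exact Or.inl (disjoint_iff_inter_eq_empty.2 h)
      · exact Or.inr (Or.inl (inter_eq_left.1 h))
      · exact Or.inr (Or.inr (inter_eq_right.1 h))
    · refine sum_measure_le_of_sparse volume _ (fun Q : S => E Q) I _ ?_ (fun Q _ => (hE Q Q.2).1)
        (fun Q _ => (hE Q Q.2).2.1) ?_
      · intro Q _ Q' _ hne
        exact hEd Q.2 Q'.2 fun h => hne (Subtype.ext h)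
      · intro Q _
        rw [← ENNReal.div_eq_inv_mul, ENNReal.le_div_iff_mul_le (Or.inl hη')
          (Or.inl ENNReal.ofReal_ne_top), mul_comm]
        exact (hE Q Q.2).2.2
    · intro Q _
      refine (mul_le_mul' hκ (ENNReal.div_le_of_le_mul ?_)).trans_eq (one_mul 1)
      rw [one_mul]
      exact measure_mono inter_subset_right
    · intro Q _
      refine ENNReal.div_le_of_le_mul (ENNReal.div_le_of_le_mul ?_)
      calc ∫⁻ x in (Q : Set (Rn n)), e x ^ s ≤ ∫⁻ x in (Q : Set (Rn n)), b ^ s :=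
            lintegral_mono fun x => ENNReal.rpow_le_rpow (he x) hs'.le
        _ = _ := by rw [setLIntegral_const, one_mul, mul_comm]
    · intro J _ hd
      calc ∑ Q ∈ J, z Q * volume (Q : Set (Rn n)) = ∑ Q ∈ J, κ * volume (F ∩ Q) := by
            refine Finset.sum_congr rfl fun Q _ => ?_
            rw [hz]
            simp only
            rw [mul_assoc, ENNReal.div_mul_cancel (hcube Q).volume_ne_zero (hcube Q).volume_ne_top]
        _ = κ * volume (⋃ Q ∈ J, F ∩ Q) := by
            rw [← Finset.mul_sum, measure_biUnion_finset]
            · exact hd.mono_on fun Q _ => inter_subset_right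
            · exact fun Q _ => hF.inter (hcube Q).measurableSet
        _ ≤ κ * volume F := by
            gcongr
            exact iUnion₂_subset fun Q _ => inter_subset_left
    · intro J _ hd
      calc ∑ Q ∈ J, t Q * volume (Q : Set (Rn n)) =
            (∑ Q ∈ J, ∫⁻ x in (Q : Set (Rn n)), e x ^ s) / b ^ s := by
            simp only [ENNReal.div_eq_inv_mul (b := b ^ s), Finset.mul_sum]
            refine Finset.sum_congr rfl fun Q _ => ?_
            rw [ht]
            simp only
            rw [ENNReal.div_mul_cancel (hcube Q).volume_ne_zero (hcube Q).volume_ne_top,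
              ENNReal.div_eq_inv_mul]
        _ = (∫⁻ x in ⋃ Q ∈ J, (Q : Set (Rn n)), e x ^ s) / b ^ s := by
            rw [lintegral_biUnion_finset]
            · exact hd
            · exact fun Q _ => (hcube Q).measurableSet
        _ ≤ _ := by
            gcongr
            exact Measure.restrict_le_self
  calc ∑ Q ∈ I, formTerm α p₀ s f e Q ≤ ∑ Q ∈ I, M * volume F ^ β * b * κ ^ (-a) *
        (z Q ^ a * t Q ^ (1 - a + (1 / s - 1 + a)) * volume (Q : Set (Rn n))) := by
        refine Finset.sum_le_sum fun Q _ => ?_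
        refine (formTerm_le_of_bounded hn hp₀ hp hpq hs hα ha0 ha hF hf (hcube Q) hb0 hbt).trans_eq
          ?_
        rw [hz, ht]
        simp only
        rw [ENNReal.mul_rpow_of_nonneg _ _ ha0, show 1 - a + (1 / s - 1 + a) = 1 / s by ring,
          ← hβdef]
        have h1 : κ ^ (-a) * κ ^ a = 1 := by
          rw [← ENNReal.rpow_add _ _ hκ0 hκt, neg_add_cancel, ENNReal.rpow_zero]
        generalize κ ^ (-a) = k1 at h1 ⊢
        generalize κ ^ a = k2 at h1 ⊢
        generalize (volume (F ∩ Q) / volume (Q : Set (Rn n))) ^ a = y1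
        generalize ((∫⁻ x in (Q : Set (Rn n)), e x ^ s) / b ^ s / volume (Q : Set (Rn n))) ^ (1 / s)
          = y2
        calc M * volume F ^ β * b * (y1 * y2 * volume (Q : Set (Rn n))) =
              M * volume F ^ β * b * (y1 * y2 * volume (Q : Set (Rn n))) * 1 := by rw [mul_one]
          _ = _ := by
            rw [← h1]
            ring
    _ = M * volume F ^ β * b * κ ^ (-a) * ∑ Q ∈ I,
        (z Q ^ a * t Q ^ (1 - a + (1 / s - 1 + a)) * volume (Q : Set (Rn n))) := by
        rw [← Finset.mul_sum]
    _ ≤ _ := by gcongr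

/-- Sparse forms are continuous in their second entry, uniformly in the sparse family, along bounded
sequences that are small in `L ^ s`. -/
theorem exists_tsum_formTerm_le_of_bounded {n : ℕ} {α p₀ p q s η : ℝ} (hn : n ≠ 0) (hp₀ : 1 ≤ p₀)
    (hp : p₀ ≤ p) (hpq : p ≤ q) (hs : 1 ≤ s) (hqs : 1 - 1 / s < 1 / q)
    (hα : 1 / p - 1 / q = α / (n * s)) (hη : 0 < η)
    {f : Rn n → ℝ≥0∞} {F : Set (Rn n)} {M b : ℝ≥0∞} (hF : MeasurableSet F) (hFt : volume F ≠ ∞)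
    (hM : M ≠ ∞) (hf : ∀ x, f x ≤ F.indicator (fun _ => M) x) (hb0 : b ≠ 0) (hbt : b ≠ ∞)
    {ε : ℝ≥0∞} (hε : ε ≠ 0) :
    ∃ ρ : ℝ≥0∞, ρ ≠ 0 ∧ ∀ {e : Rn n → ℝ≥0∞}, (∀ x, e x ≤ b) → ∫⁻ x, e x ^ s ≤ ρ →
      ∀ {D : Set (Set (Rn n))}, IsDyadicGrid D → ∀ {S : Set (Set (Rn n))}, S ⊆ D → IsSparse η S →
        ∑' Q : S, formTerm α p₀ s f e Q ≤ ε := by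
  have hs' : 0 < s := by linarith
  have hp' : 0 < p := by linarith
  have hq' : 0 < q := by linarith
  have hβ : 0 ≤ 1 / p - 1 / q := sub_nonneg.2 (one_div_le_one_div_of_le hp' hpq)
  have hs1 : 0 ≤ 1 - 1 / s := by
    rw [sub_nonneg, div_le_one hs']
    exact hs
  have hq1 : 1 / q ≤ 1 := by
    rw [div_le_one hq']
    linarith
  -- an exponent strictly above `1 - 1 / s` leaves a gain in the Carleson embedding
  set a := ((1 - 1 / s) + 1 / q) / 2 with ha
  have ha0 : 0 ≤ a := by positivity
  have ha1 : a < 1 := by rw [ha]; linarith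
  have haq : a ≤ 1 / q := by rw [ha]; linarith
  have has : 1 - 1 / s < a := by rw [ha]; linarith
  set C : ℝ≥0∞ := M * volume F ^ (1 / p - 1 / q) * b * (ENNReal.ofReal (2 / (1 / s - 1 + a)) *
    (ENNReal.ofReal η)⁻¹) with hC
  have hη' : ENNReal.ofReal η ≠ 0 := by simpa using hη
  have hCt : C ≠ ∞ := by
    refine ENNReal.mul_ne_top (ENNReal.mul_ne_top (ENNReal.mul_ne_top hM
      (ENNReal.rpow_ne_top_of_nonneg hβ hFt)) hbt) (ENNReal.mul_ne_top ENNReal.ofReal_ne_top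
      (ENNReal.inv_ne_top.2 hη'))
  have hbs0 : b ^ s ≠ 0 := by simp [hb0, hbt]
  have hbst : b ^ s ≠ ∞ := ENNReal.rpow_ne_top_of_nonneg hs'.le hbt
  have hε2 : 0 < ε / 2 := ENNReal.half_pos hε
  -- `κ` makes the contribution of `F` small; the smallness of `e` is chosen afterwards
  obtain ⟨κ, hκ0, hκ1, hκ⟩ : ∃ κ : ℝ≥0∞, κ ≠ 0 ∧ κ ≤ 1 ∧ C * volume F * κ ^ (1 - a) ≤ ε / 2 := by
    have hlim : Filter.Tendsto (fun κ : ℝ≥0∞ => C * volume F * κ ^ (1 - a))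
        (nhdsWithin 0 (Ioi 0)) (nhds 0) := by
      have h1 : Filter.Tendsto (fun κ : ℝ≥0∞ => κ ^ (1 - a)) (nhdsWithin 0 (Ioi 0)) (nhds 0) := by
        have := (ENNReal.continuous_rpow_const (y := 1 - a)).tendsto 0
        rw [ENNReal.zero_rpow_of_pos (by linarith)] at this
        exact this.mono_left nhdsWithin_le_nhds
      simpa using ENNReal.Tendsto.const_mul h1 (Or.inr (ENNReal.mul_ne_top hCt hFt))
    obtain ⟨κ, hκ⟩ := ((hlim.eventually (ge_mem_nhds hε2)).and (Filter.Eventually.and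
      (self_mem_nhdsWithin) (mem_nhdsWithin_of_mem_nhds (ge_mem_nhds zero_lt_one)))).exists
    exact ⟨κ, (mem_Ioi.1 hκ.2.1).ne', hκ.2.2, hκ.1⟩
  have hκt : κ ≠ ∞ := ne_top_of_le_ne_top ENNReal.one_ne_top hκ1
  have hκa : κ ^ (-a) ≠ ∞ := by
    rw [ENNReal.rpow_neg]
    refine ENNReal.inv_ne_top.2 ?_
    simp [hκ0, hκt]
  have hCκ : C * κ ^ (-a) / b ^ s ≠ ∞ := ENNReal.div_ne_top (ENNReal.mul_ne_top hCt hκa) hbs0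
  refine ⟨ε / 2 / (C * κ ^ (-a) / b ^ s + 1), ?_, ?_⟩
  · exact (ENNReal.div_pos hε2.ne' (by simpa using hCκ)).ne'
  intro e he heρ D hD S hSD hS
  refine (tsum_formTerm_le_of_bounded hn hp₀ hp hpq hs hα hη ha0 haq has hF hf hb0 hbt he hκ0 hκ1 hD
    hSD hS).trans ?_
  calc _ = C * κ ^ (-a) * (κ * volume F + (∫⁻ x, e x ^ s) / b ^ s) := by
        rw [hC]
        ring
    _ = C * volume F * κ ^ (1 - a) + C * κ ^ (-a) / b ^ s * ∫⁻ x, e x ^ s := by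
        rw [show (1 - a) = -a + 1 by ring, ENNReal.rpow_add _ _ hκ0 hκt, ENNReal.rpow_one]
        simp only [div_eq_mul_inv]
        generalize κ ^ (-a) = k
        ring
    _ ≤ ε / 2 + (C * κ ^ (-a) / b ^ s + 1) * (ε / 2 / (C * κ ^ (-a) / b ^ s + 1)) := by
        gcongr
        exact le_self_add
    _ = ε := by
        rw [ENNReal.mul_div_cancel (by simp) (by simpa using hCκ), ENNReal.add_halves]

/-! ### Approximation by test functions -/

/-- A bounded function of bounded support is an almost everywhere limit of test functions with the
same bound whose supports stay in a fixed ball. -/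
theorem exists_testFun_tendsto {𝕜 : Type*} [RCLike 𝕜] {n : ℕ} {h : Rn n → 𝕜}
    (hh : AEStronglyMeasurable h volume) {M ρ : ℝ} (hM : ∀ x, ‖h x‖ ≤ M)
    (hρ : ∀ x, x ∉ Metric.closedBall (0 : Rn n) ρ → h x = 0) :
    ∃ g : ℕ → Rn n → 𝕜, (∀ j, g j ∈ testFun 𝕜 n) ∧ (∀ j x, ‖g j x‖ ≤ M) ∧
      (∀ j x, x ∉ Metric.closedBall (0 : Rn n) (ρ + 1) → g j x = 0) ∧
      ∀ᵐ x, Filter.Tendsto (fun j => g j x) Filter.atTop (nhds (h x)) := by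
  have hint : Integrable h volume := by
    have h1 : IntegrableOn h (Metric.closedBall (0 : Rn n) ρ) volume :=
      Measure.integrableOn_of_bounded (measure_closedBall_lt_top).ne hh
        (Filter.Eventually.of_forall hM)
    refine h1.integrable_of_forall_notMem_eq_zero fun x hx => hρ x hx
  have hloc := hint.locallyIntegrable
  have hrad : ∀ j : ℕ, (0 : ℝ) < 1 / (2 * ((j : ℝ) + 1)) := fun j => by positivity
  let φ : ℕ → ContDiffBump (0 : Rn n) := fun j =>
    ⟨1 / (2 * ((j : ℝ) + 1)), 1 / ((j : ℝ) + 1), hrad j, by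
      apply one_div_lt_one_div_of_lt <;> linarith [(Nat.cast_nonneg j : (0:ℝ) ≤ j)]⟩
  set g : ℕ → Rn n → 𝕜 := fun j =>
    convolution ((φ j).normed volume) h (ContinuousLinearMap.lsmul ℝ ℝ) volume with hg
  have hsupp : ∀ j x, x ∉ Metric.closedBall (0 : Rn n) (ρ + 1) → g j x = 0 := by
    intro j x hx
    by_contra hne
    have h1 := support_convolution_subset (L := ContinuousLinearMap.lsmul ℝ ℝ) (μ := volume)
      (f := (φ j).normed volume) (g := h) (Function.mem_support.2 hne)
    obtain ⟨y, hy, z, hz, rfl⟩ := h1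
    rw [(φ j).support_normed_eq] at hy
    have hz' : z ∈ Metric.closedBall (0 : Rn n) ρ := by
      by_contra hz'
      exact hz (hρ z hz')
    have hy' : ‖y‖ < 1 / ((j : ℝ) + 1) := mem_ball_zero_iff.1 hy
    have hj : 1 / ((j : ℝ) + 1) ≤ 1 := by
      rw [div_le_one (by positivity)]
      linarith [(Nat.cast_nonneg j : (0:ℝ) ≤ j)]
    rw [mem_closedBall_zero_iff] at hz' hx
    exact hx ((norm_add_le y z).trans (by linarith))
  refine ⟨g, fun j => ⟨?_, ?_⟩, ?_, hsupp, ?_⟩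
  · exact (φ j).hasCompactSupport_normed.contDiff_convolution_left _
      ((φ j).contDiff_normed) hloc
  · exact HasCompactSupport.intro (isCompact_closedBall (0 : Rn n) (ρ + 1)) (hsupp j)
  · intro j x
    rw [hg]
    simp only [convolution_def, ContinuousLinearMap.lsmul_apply]
    refine (norm_integral_le_of_norm_le ((φ j).integrable_normed.mul_const M)
      (Filter.Eventually.of_forall fun y => ?_)).trans_eq ?_
    · rw [norm_smul, Real.norm_of_nonneg ((φ j).nonneg_normed y)]
      exact mul_le_mul_of_nonneg_left (hM _) ((φ j).nonneg_normed y)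
    · rw [integral_mul_const, (φ j).integral_normed, one_mul]
  · refine ContDiffBump.ae_convolution_tendsto_right_of_locallyIntegrable (φ := φ) (K := 2) ?_
      (Filter.Eventually.of_forall fun j => ?_) hloc
    · exact tendsto_one_div_add_atTop_nhds_zero_nat
    · change 1 / ((j : ℝ) + 1) ≤ 2 * (1 / (2 * ((j : ℝ) + 1)))
      rw [mul_one_div, mul_comm 2 ((j : ℝ) + 1), ← div_div]
      field_simp
      exact le_rfl

/-- The sparse domination extends from test functions to bounded measurable second entries of
bounded support, provided the sparse forms are bounded uniformly in the sparse family. -/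
theorem SparselyDominated.enorm_integral_mul_le {𝕜 : Type*} [RCLike 𝕜] {n : ℕ}
    {α p₀ p q s η : ℝ} {q₀ : ℝ≥0∞} {N : ℕ} {B : ℝ≥0} {T : (Rn n → 𝕜) → Rn n → 𝕜}
    (hT : SparselyDominated α p₀ q₀ η N B T) (hsq : s = (ENNReal.conjExponent q₀).toReal)
    (hn : n ≠ 0) (hp₀ : 1 ≤ p₀) (hp : p₀ ≤ p) (hpq : p ≤ q) (hs : 1 ≤ s) (hqs : 1 - 1 / s < 1 / q)
    (hα : 1 / p - 1 / q = α / (n * s)) (hη : 0 < η) {f : Rn n → 𝕜} (hf : f ∈ testFun 𝕜 n)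
    {h : Rn n → 𝕜} (hh : StronglyMeasurable h) {M ρ : ℝ} (hM : ∀ x, ‖h x‖ ≤ M)
    (hρ : ∀ x, x ∉ Metric.closedBall (0 : Rn n) ρ → h x = 0) {X : ℝ≥0∞}
    (hX : ∀ {D : Set (Set (Rn n))}, IsDyadicGrid D → ∀ {S : Set (Set (Rn n))}, S ⊆ D →
      IsSparse η S → ∑' Q : S, formTerm α p₀ s (fun x => ‖f x‖ₑ) (fun x => ‖h x‖ₑ) Q ≤ X) :
    ‖∫ x, T f x * h x‖ₑ ≤ B * (N * X) := by
  have hs0 : 0 < s := by linarith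
  obtain ⟨g, hg, hgM, hgρ, hgh⟩ := exists_testFun_tendsto hh.aestronglyMeasurable hM hρ
  have hM0 : 0 ≤ M := (norm_nonneg _).trans (hM 0)
  have hTf := hT.locallyIntegrable f hf
  set K := Metric.closedBall (0 : Rn n) (ρ + 1) with hK
  have hρK : ∀ x, x ∉ K → h x = 0 := fun x hx => hρ x fun hx' =>
    hx (Metric.closedBall_subset_closedBall (by linarith) hx')
  have hTK : IntegrableOn (T f) K volume := hTf.integrableOn_isCompact (isCompact_closedBall _ _)
  have hbound : Integrable (K.indicator fun x => ‖T f x‖ * M) volume :=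
    (integrable_indicator_iff Metric.isClosed_closedBall.measurableSet).2
      (Integrable.mul_const (Integrable.norm hTK) M)
  have hgmeas : ∀ j, Continuous (g j) := fun j => (hg j).1.continuous
  have hlim : Filter.Tendsto (fun j => ∫ x, T f x * g j x) Filter.atTop
      (nhds (∫ x, T f x * h x)) := by
    refine tendsto_integral_of_dominated_convergence (K.indicator fun x => ‖T f x‖ * M) ?_ hbound
      ?_ ?_
    · exact fun j => hTf.aestronglyMeasurable.mul (hgmeas j).aestronglyMeasurable
    · refine fun j => Filter.Eventually.of_forall fun x => ?_
      by_cases hx : x ∈ K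
      · rw [indicator_of_mem hx, norm_mul]
        exact mul_le_mul_of_nonneg_left (hgM j x) (norm_nonneg _)
      · rw [indicator_of_notMem hx, hgρ j x hx, mul_zero, norm_zero]
    · filter_upwards [hgh] with x hx using hx.const_mul _
  set b : ℝ≥0∞ := ENNReal.ofReal (2 * M + 1) with hb
  have hb0 : b ≠ 0 := by
    rw [hb]
    simp only [ne_eq, ENNReal.ofReal_eq_zero, not_le]
    linarith
  have hbt : b ≠ ∞ := ENNReal.ofReal_ne_top
  have he : ∀ j x, ‖g j x - h x‖ₑ ≤ b := by
    intro j x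
    rw [← ofReal_norm]
    refine ENNReal.ofReal_le_ofReal ((norm_sub_le _ _).trans ?_)
    linarith [hgM j x, hM x]
  have helim : Filter.Tendsto (fun j => ∫⁻ x, ‖g j x - h x‖ₑ ^ s) Filter.atTop (nhds 0) := by
    have h1 : Filter.Tendsto (fun j => ∫⁻ x, ‖g j x - h x‖ₑ ^ s) Filter.atTop
        (nhds (∫⁻ _x : Rn n, 0)) := by
      refine tendsto_lintegral_of_dominated_convergence (K.indicator fun _ => b ^ s) ?_ ?_ ?_ ?_
      · exact fun j => ((hgmeas j).measurable.sub hh.measurable).enorm.pow_const s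
      · refine fun j => Filter.Eventually.of_forall fun x => ?_
        by_cases hx : x ∈ K
        · rw [indicator_of_mem hx]
          exact ENNReal.rpow_le_rpow (he j x) hs0.le
        · simp only [indicator_of_notMem hx, hgρ j x hx, hρK x hx]
          simp [hs0]
      · rw [lintegral_indicator Metric.isClosed_closedBall.measurableSet, setLIntegral_const]
        exact ENNReal.mul_ne_top (ENNReal.rpow_ne_top_of_nonneg hs0.le hbt)
          measure_closedBall_lt_top.ne
      · filter_upwards [hgh] with x hx
        have h2 : Filter.Tendsto (fun j => ‖g j x - h x‖ₑ) Filter.atTop (nhds 0) := by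
          have := (hx.sub_const (h x)).enorm
          simpa using this
        have h3 := (ENNReal.continuous_rpow_const (y := s)).tendsto 0
        rw [ENNReal.zero_rpow_of_pos hs0] at h3
        exact h3.comp h2
    simpa using h1
  obtain ⟨Mf, hMf⟩ := hf.2.exists_bound_of_continuous hf.1.continuous
  have hfF : ∀ x, ‖f x‖ₑ ≤ (tsupport f).indicator (fun _ => ENNReal.ofReal Mf) x := by
    intro x
    by_cases hx : x ∈ tsupport f
    · rw [indicator_of_mem hx, ← ofReal_norm]
      exact ENNReal.ofReal_le_ofReal (hMf x)
    · rw [image_eq_zero_of_notMem_tsupport hx]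
      simp
  have hFm : MeasurableSet (tsupport f) := (isClosed_tsupport f).measurableSet
  have hFt : volume (tsupport f) ≠ ∞ := hf.2.measure_lt_top.ne
  have key : ∀ ε : ℝ≥0∞, ε ≠ 0 → ‖∫ x, T f x * h x‖ₑ ≤ B * (N * (X + ε)) := by
    intro ε hε
    obtain ⟨κ, hκ0, hκ⟩ := exists_tsum_formTerm_le_of_bounded hn hp₀ hp hpq hs hqs hα hη hFm hFt
      (ENNReal.ofReal_ne_top (r := Mf)) hfF hb0 hbt hε
    refine le_of_tendsto (hlim.enorm) ?_
    filter_upwards [helim.eventually (ge_mem_nhds (pos_iff_ne_zero.2 hκ0))] with j hj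
    obtain ⟨S, hS, hdom⟩ := hT.domination f hf (g j) (hg j)
    refine hdom.trans ?_
    gcongr
    rw [← hsq]
    have h1 : ∀ i ∈ (Finset.univ : Finset (Fin N)), ∑' Q : S i, fracAvg 0 p₀ Q (fun x => ‖f x‖ₑ) *
        fracAvg α s Q (fun x => ‖g j x‖ₑ) * volume (Q : Set (Rn n)) ≤ X + ε := by
      intro i _
      obtain ⟨⟨D, hD, hSD⟩, hSp⟩ := hS i
      calc _ ≤ ∑' Q : S i, (formTerm α p₀ s (fun x => ‖f x‖ₑ) (fun x => ‖h x‖ₑ) Q +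
            formTerm α p₀ s (fun x => ‖f x‖ₑ) (fun x => ‖g j x - h x‖ₑ) Q) := by
            refine ENNReal.tsum_le_tsum fun Q => ?_
            refine le_trans ?_ (formTerm_add_le hs _ hh.measurable.enorm
              ((hgmeas j).measurable.sub hh.measurable).enorm Q)
            refine formTerm_mono (g := fun x => ‖g j x‖ₑ) hs0.le (fun x => ?_) (Q : Set (Rn n))
            calc ‖g j x‖ₑ = ‖h x + (g j x - h x)‖ₑ := by rw [add_sub_cancel]
              _ ≤ _ := enorm_add_le _ _
        _ ≤ X + ε := by
            rw [ENNReal.tsum_add]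
            exact add_le_add (hX hD hSD hSp) (hκ (he j) hj hD hSD hSp)
    refine (Finset.sum_le_sum h1).trans ?_
    rw [Finset.sum_const, Finset.card_univ, Fintype.card_fin, nsmul_eq_mul]
  rcases eq_or_ne X ∞ with hXt | hXt
  · simpa [hXt] using key 1 one_ne_zero
  · have hcont : Filter.Tendsto (fun ε : ℝ≥0∞ => (B : ℝ≥0∞) * (N * (X + ε)))
        (nhdsWithin 0 (Ioi 0)) (nhds (B * (N * (X + 0)))) := by
      have h1 : Filter.Tendsto (fun ε : ℝ≥0∞ => X + ε) (nhdsWithin 0 (Ioi 0)) (nhds (X + 0)) :=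
        (tendsto_const_nhds.add Filter.tendsto_id).mono_left nhdsWithin_le_nhds
      exact ENNReal.Tendsto.const_mul (ENNReal.Tendsto.const_mul h1 (Or.inr (by simp)))
        (Or.inr (by simp))
    rw [add_zero] at hcont
    refine ge_of_tendsto hcont ?_
    filter_upwards [self_mem_nhdsWithin] with ε hε using key ε (mem_Ioi.1 hε).ne'

/-! ### The weak-type bound on test functions -/

theorem one_le_rhConst {n : ℕ} {r q : ℝ} (hr : 1 < r) {w : Rn n → ℝ≥0} (hw : Measurable w)
    (hpos : ∀ᵐ x, w x ≠ 0) (hut : ∀ Q, IsCube Q → wMeasure (fun x => w x ^ q) Q ≠ ∞) :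
    1 ≤ rhConst r (fun x => w x ^ q) := by
  have hr0 : 0 < r := by linarith
  set Q : Set (Rn n) := cube 0 1 with hQdef
  have hQ : IsCube Q := ⟨0, 1, one_pos, rfl⟩
  have hV0 := hQ.volume_ne_zero
  have hVt := hQ.volume_ne_top
  have h1 := lintegral_rpow_le_rhConst hr hw hpos hut hQ
  have hu0 := wMeasure_ne_zero hw hpos q hV0
  have hut' := hut Q hQ
  rw [wMeasure_apply] at hu0 hut'
  set U : Rn n → ℝ≥0∞ := fun x => ((w x ^ q : ℝ≥0) : ℝ≥0∞) with hU
  have hUm : Measurable U := (hw.pow_const q).coe_nnreal_ennreal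
  have h2 : ∫⁻ x in Q, U x ≤ (∫⁻ x in Q, U x ^ r) ^ (1 / r) * volume Q ^ (1 - 1 / r) := by
    have hconj : r.HolderConjugate (Real.conjExponent r) := Real.HolderConjugate.conjExponent hr
    have h3 := ENNReal.lintegral_mul_le_Lp_mul_Lq (volume.restrict Q) hconj
      (f := U) (g := fun _ => 1) hUm.aemeasurable aemeasurable_const
    simp only [Pi.mul_apply, mul_one, ENNReal.one_rpow, lintegral_const, one_mul,
      Measure.restrict_apply_univ] at h3
    rwa [show 1 / r.conjExponent = 1 - 1 / r by
      have := hconj.inv_add_inv_eq_one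
      rw [one_div, one_div]
      linarith] at h3
  set I := ∫⁻ x in Q, U x with hI
  set R := rhConst r (fun x => w x ^ q) with hR
  have h4 : I ^ r ≤ R ^ r * I ^ r := by
    calc I ^ r ≤ ((∫⁻ x in Q, U x ^ r) ^ (1 / r) * volume Q ^ (1 - 1 / r)) ^ r :=
          ENNReal.rpow_le_rpow h2 hr0.le
      _ = (∫⁻ x in Q, U x ^ r) * volume Q ^ (r - 1) := by
          rw [ENNReal.mul_rpow_of_nonneg _ _ hr0.le, ← ENNReal.rpow_mul, ← ENNReal.rpow_mul,
            one_div_mul_cancel hr0.ne', ENNReal.rpow_one]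
          congr 2
          field_simp
      _ ≤ (R ^ r * (I / volume Q) ^ r * volume Q) * volume Q ^ (r - 1) := by gcongr
      _ = R ^ r * I ^ r := by
          rw [ENNReal.div_rpow_of_nonneg _ _ hr0.le, mul_assoc, mul_assoc]
          congr 1
          have h5 : volume Q * volume Q ^ (r - 1) = volume Q ^ r := by
            nth_rw 1 [← ENNReal.rpow_one (volume Q)]
            rw [← ENNReal.rpow_add _ _ hV0 hVt, add_sub_cancel]
          rw [h5]
          exact ENNReal.div_mul_cancel (ENNReal.rpow_pos (pos_iff_ne_zero.2 hV0) hVt).ne'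
            (ENNReal.rpow_ne_top_of_nonneg hr0.le hVt)
  by_contra hlt
  have hIr0 : I ^ r ≠ 0 := (ENNReal.rpow_pos (pos_iff_ne_zero.2 hu0) hut').ne'
  have hIrt : I ^ r ≠ ∞ := ENNReal.rpow_ne_top_of_nonneg hr0.le hut'
  have h5 : R ^ r < 1 := ENNReal.rpow_lt_one (not_le.1 hlt) hr0
  refine absurd h4 (not_le.2 ?_)
  calc R ^ r * I ^ r < 1 * I ^ r := by
        rw [mul_comm, mul_comm 1]
        exact (ENNReal.mul_lt_mul_iff_right hIr0 hIrt).2 h5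
    _ = I ^ r := one_mul _

theorem locallyIntegrable_of_wMeasure_ne_top {n : ℕ} {U : Rn n → ℝ≥0} (hU : Measurable U)
    (h : ∀ Q, IsCube Q → wMeasure U Q ≠ ∞) :
    LocallyIntegrable (fun x => (U x : ℝ)) volume := by
  rw [locallyIntegrable_iff]
  intro K hK
  obtain ⟨ρ, hρ⟩ := hK.isBounded.subset_closedBall 0
  obtain ⟨Q, hQ, hQρ⟩ := exists_cube_superset_closedBall (n := n) ρ
  refine IntegrableOn.mono_set ?_ (hρ.trans hQρ)
  refine ⟨hU.coe_nnreal_real.aestronglyMeasurable, ?_⟩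
  have h1 := h Q hQ
  rw [wMeasure_apply] at h1
  rw [hasFiniteIntegral_iff_enorm]
  simpa [Real.enorm_of_nonneg] using h1.lt_top

/-- The testing bounds for the density of `w ^ q` that the reverse Hölder condition gives: on grid
cubes with a gain `δ` in the exponent, on all cubes without. -/
theorem exists_testing_bound (n : ℕ) {q r s : ℝ} (hq : 1 ≤ q) (hr : 1 ≤ r) (hs : 1 ≤ s)
    (hsq : s / (q * r) + s * (1 - 1 / q) = 1) : ∃ c : ℝ≥0, ∀ {p₀ p : ℝ}, 0 < p₀ → 0 < p →
      ∀ {w : Rn n → ℝ≥0}, Measurable w → (∀ᵐ x, w x ≠ 0) →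
      aRConst (p / p₀) (q / p₀) (fun x => w x ^ p₀) < ∞ → rhConst r (fun x => w x ^ q) < ∞ →
      ∃ (δ : ℝ) (Cg : ℝ≥0∞), 0 < δ ∧ δ ≤ 1 ∧
        Cg * ENNReal.ofReal (1 / δ) ≤ c * rhConst r (fun x => w x ^ q) ^ (r + 1 / q) ∧
        ∀ {g : Rn n → ℝ≥0∞} {G : Set (Rn n)}, MeasurableSet G →
          (∀ x, g x ≤ G.indicator (fun x => ((w x ^ q : ℝ≥0) : ℝ≥0∞)) x) →
          (∀ a k m, (∫⁻ x in gridCube a k m, g x ^ s) ^ (1 / s) *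
            volume (gridCube a k m) ^ (1 - 1 / s) ≤
              Cg * (wMeasure (fun x => w x ^ q) (gridCube a k m) *
                (wMeasure (fun x => w x ^ q) (G ∩ gridCube a k m) /
                  wMeasure (fun x => w x ^ q) (gridCube a k m)) ^ (1 - 1 / q + δ))) ∧
          ∀ Q, IsCube Q → (∫⁻ x in Q, g x ^ s) ^ (1 / s) * volume Q ^ (1 - 1 / s) ≤
            Cg * (wMeasure (fun x => w x ^ q) Q * (wMeasure (fun x => w x ^ q) (G ∩ Q) /
              wMeasure (fun x => w x ^ q) Q) ^ (1 - 1 / q + 0)) := by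
  have hq0 : 0 < q := by linarith
  have hq1 : 1 / q ≤ 1 := by
    rw [div_le_one hq0]
    exact hq
  have hq1' : 0 < 1 / q := by positivity
  rcases hr.eq_or_lt with rfl | hr1
  · have hs1 : s = 1 := by
      rw [mul_one] at hsq
      rw [← hsq]
      ring
    subst hs1
    refine ⟨q.toNNReal, fun hp₀ hp w hw hpos hA hR => ⟨1 / q, 1, hq1', hq1, ?_, ?_⟩⟩
    · rw [rhConst, if_pos rfl, one_mul, ENNReal.one_rpow, mul_one, one_div_one_div]
      rfl
    · intro g G hG hg
      have key : ∀ Q, IsCube Q → ∀ t : ℝ, 0 ≤ t → t ≤ 1 →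
          (∫⁻ x in Q, g x ^ (1 : ℝ)) ^ (1 / (1 : ℝ)) * volume Q ^ (1 - 1 / (1 : ℝ)) ≤
            1 * (wMeasure (fun x => w x ^ q) Q * (wMeasure (fun x => w x ^ q) (G ∩ Q) /
              wMeasure (fun x => w x ^ q) Q) ^ t) := by
        intro Q hQ t ht0 ht1
        have hu0 := wMeasure_ne_zero hw hpos q hQ.volume_ne_zero
        have hut := wMeasure_ne_top hp₀ hp hq0 hw hA hQ
        have h1 : ∫⁻ x in Q, g x ≤ wMeasure (fun x => w x ^ q) (G ∩ Q) := by
          rw [wMeasure_apply, ← setLIntegral_indicator hG]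
          exact lintegral_mono hg
        simp only [ENNReal.rpow_one, div_one, sub_self, ENNReal.rpow_zero, mul_one, one_mul]
        set u := wMeasure (fun x => w x ^ q) Q with hu
        set x := wMeasure (fun x => w x ^ q) (G ∩ Q) / u with hx
        have hx1 : x ≤ 1 := by
          refine ENNReal.div_le_of_le_mul ?_
          rw [one_mul]
          exact measure_mono inter_subset_right
        calc _ ≤ u * x := by
              rw [hx, ENNReal.mul_div_cancel hu0 hut]
              exact h1
          _ ≤ u * x ^ t := by
              have h2 := ENNReal.rpow_le_rpow_of_exponent_ge hx1 ht1
              rw [ENNReal.rpow_one] at h2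
              gcongr
      exact ⟨fun a k m => key _ (isCube_gridCube a k m) _ (by linarith) (by linarith),
        fun Q hQ => key Q hQ _ (by linarith) (by linarith)⟩
  · obtain ⟨c, hc, hgeh⟩ := exists_gehring n hr1
    have hr0 : 0 < r := by linarith
    refine ⟨(4 * (q * r * c)).toNNReal, fun hp₀ hp w hw hpos hA hR => ?_⟩
    have hut : ∀ Q, IsCube Q → wMeasure (fun x => w x ^ q) Q ≠ ∞ := fun Q hQ =>
      wMeasure_ne_top hp₀ hp hq0 hw hA hQ
    have hR1 := one_le_rhConst hr1 hw hpos hut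
    set R := rhConst r (fun x => w x ^ q) with hRdef
    have hUm : Measurable fun x => w x ^ q := hw.pow_const q
    have hu0 : ∀ Q, IsCube Q → ∫⁻ x in Q, ((w x ^ q : ℝ≥0) : ℝ≥0∞) ≠ 0 := by
      intro Q hQ
      have := wMeasure_ne_zero hw hpos q hQ.volume_ne_zero
      rwa [wMeasure_apply] at this
    have hut' : ∀ Q, IsCube Q → ∫⁻ x in Q, ((w x ^ q : ℝ≥0) : ℝ≥0∞) ≠ ∞ := by
      intro Q hQ
      have := hut Q hQ
      rwa [wMeasure_apply] at this
    have hRc : (R.toNNReal : ℝ≥0∞) = R := ENNReal.coe_toNNReal hR.ne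
    obtain ⟨δ, hδ, hδ1, hδR, hG⟩ := hgeh (fun x => w x ^ q) R.toNNReal hUm
      (locallyIntegrable_of_wMeasure_ne_top hUm hut)
      (by
        have h1 : ((1 : ℝ≥0) : ℝ≥0∞) ≤ R.toNNReal := by rw [hRc]; exact_mod_cast hR1
        exact_mod_cast h1)
      (fun a k m => hu0 _ (isCube_gridCube a k m))
      (fun a k m => by
        have := lintegral_rpow_le_rhConst hr1 hw hpos hut (isCube_gridCube a k m)
        rw [hRc]
        exact this)
    have hδqr : δ / (q * r) ≤ 1 := by
      rw [div_le_one (by positivity)]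
      nlinarith
    refine ⟨δ / (q * r), 4 * R ^ (1 / q), by positivity, hδqr, ?_, ?_⟩
    · have h1 : ENNReal.ofReal (1 / (δ / (q * r))) ≤ ENNReal.ofReal (q * r * c) * R ^ r := by
        rw [← hRc, ← ENNReal.coe_rpow_of_nonneg _ hr0.le, ← ENNReal.ofReal_coe_nnreal,
          ← ENNReal.ofReal_mul (by positivity)]
        refine ENNReal.ofReal_le_ofReal ?_
        rw [one_div_div, NNReal.coe_rpow, div_eq_mul_one_div, mul_assoc (q * r)]
        exact mul_le_mul_of_nonneg_left hδR (by positivity)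
      have hR0 : R ≠ 0 := (zero_lt_one.trans_le hR1).ne'
      calc 4 * R ^ (1 / q) * ENNReal.ofReal (1 / (δ / (q * r))) ≤
            4 * R ^ (1 / q) * (ENNReal.ofReal (q * r * c) * R ^ r) := by gcongr
        _ = ENNReal.ofReal (4 * (q * r * c)) * (R ^ r * R ^ (1 / q)) := by
            rw [ENNReal.ofReal_mul (by norm_num : (0 : ℝ) ≤ 4)]
            simp only [ENNReal.ofReal_ofNat]
            ring
        _ = _ := by
            rw [← ENNReal.rpow_add _ _ hR0 hR.ne]
            rfl
    · intro g G hGm hg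
      constructor
      · intro a k m
        have h1 := hG a k m (G ∩ gridCube a k m) (hGm.inter (measurableSet_gridCube a k m))
          inter_subset_right
        have h2 := lintegral_rpow_indicator_le hq hr1 hs hδ.le hsq hUm (isCube_gridCube a k m) hGm
          (hu0 _ (isCube_gridCube a k m)) (hut' _ (isCube_gridCube a k m))
          (lintegral_rpow_le_rhConst hr1 hw hpos hut (isCube_gridCube a k m)) h1 hg
        simpa only [wMeasure_apply] using h2
      · intro Q hQ
        have h1 : ∫⁻ x in G ∩ Q, ((w x ^ q : ℝ≥0) : ℝ≥0∞) ^ r ≤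
            4 * ((∫⁻ x in G ∩ Q, ((w x ^ q : ℝ≥0) : ℝ≥0∞)) /
              ∫⁻ x in Q, ((w x ^ q : ℝ≥0) : ℝ≥0∞)) ^ (0 : ℝ) *
              ∫⁻ x in Q, ((w x ^ q : ℝ≥0) : ℝ≥0∞) ^ r := by
          rw [ENNReal.rpow_zero, mul_one]
          calc _ ≤ 1 * ∫⁻ x in Q, ((w x ^ q : ℝ≥0) : ℝ≥0∞) ^ r := by
                rw [one_mul]
                exact lintegral_mono_set inter_subset_right
            _ ≤ _ := by
                gcongr
                norm_num
        have h2 := lintegral_rpow_indicator_le hq hr1 hs le_rfl hsq hUm hQ hGm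
          (hu0 Q hQ) (hut' Q hQ) (lintegral_rpow_le_rhConst hr1 hw hpos hut hQ) h1 hg
        rw [zero_div] at h2
        simpa only [wMeasure_apply] using h2

/-- The exceptional set: the union of the grid cubes on which the localized Lorentz norm of `f` is
large. -/
theorem measure_iUnion_gridCube_le {n : ℕ} {p q : ℝ} (hp : 1 ≤ p) (hpq : p ≤ q)
    (μ ν : Measure (Rn n)) (f : Rn n → ℝ) {γ : ℝ≥0∞} (hγ0 : γ ≠ 0) (hγt : γ ≠ ∞) :
    ν (⋃ a, ⋃ i ∈ {i : ℤ × (Fin n → ℤ) | γ * ν (gridCube a i.1 i.2) ^ (1 / q) <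
      lorentzIntegral p (μ.restrict (gridCube a i.1 i.2)) f}, gridCube a i.1 i.2) ≤
      3 ^ n * (lorentzIntegral p μ f / γ) ^ q := by
  classical
  have hq0 : 0 < q := by linarith
  have key : ∀ a : Fin n → Fin 3, ν (⋃ i ∈ {i : ℤ × (Fin n → ℤ) |
      γ * ν (gridCube a i.1 i.2) ^ (1 / q) <
        lorentzIntegral p (μ.restrict (gridCube a i.1 i.2)) f}, gridCube a i.1 i.2) ≤
      (lorentzIntegral p μ f / γ) ^ q := by
    intro a
    set bad := {i : ℤ × (Fin n → ℤ) | γ * ν (gridCube a i.1 i.2) ^ (1 / q) <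
        lorentzIntegral p (μ.restrict (gridCube a i.1 i.2)) f} with hbad
    have hfin : ∀ I : Finset bad, ν (⋃ i ∈ I, gridCube a i.1.1 i.1.2) ≤
        (lorentzIntegral p μ f / γ) ^ q := by
      intro I
      obtain ⟨J, hJI, hJd, hJ⟩ := exists_disjoint_subfamily
        (fun i : bad => gridCube a i.1.1 i.1.2) I
        (fun i _ j _ => gridCube_nested a _ _ _ _)
      calc ν (⋃ i ∈ I, gridCube a i.1.1 i.1.2) ≤ ν (⋃ i ∈ J, gridCube a i.1.1 i.1.2) := by
            refine measure_mono (iUnion₂_subset fun i hi => ?_)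
            obtain ⟨j, hj, hij⟩ := hJ i hi
            exact hij.trans (subset_biUnion_of_mem (u := fun i : bad => gridCube a i.1.1 i.1.2) hj)
        _ ≤ ∑ i ∈ J, ν (gridCube a i.1.1 i.1.2) := measure_biUnion_finset_le _ _
        _ ≤ ∑ i ∈ J, lorentzIntegral p (μ.restrict (gridCube a i.1.1 i.1.2)) f ^ q / γ ^ q := by
            refine Finset.sum_le_sum fun i _ => ?_
            have h1 : ν (gridCube a i.1.1 i.1.2) ^ (1 / q) ≤
                lorentzIntegral p (μ.restrict (gridCube a i.1.1 i.1.2)) f / γ := by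
              rw [ENNReal.le_div_iff_mul_le (Or.inl hγ0) (Or.inl hγt), mul_comm]
              exact i.2.le
            rw [← ENNReal.div_rpow_of_nonneg _ _ hq0.le]
            calc _ = (ν (gridCube a i.1.1 i.1.2) ^ (1 / q)) ^ q := by
                  rw [← ENNReal.rpow_mul, one_div_mul_cancel hq0.ne', ENNReal.rpow_one]
              _ ≤ _ := ENNReal.rpow_le_rpow h1 hq0.le
        _ = (∑ i ∈ J, lorentzIntegral p (μ.restrict (gridCube a i.1.1 i.1.2)) f ^ q) / γ ^ q := by
            simp only [div_eq_mul_inv]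
            rw [Finset.sum_mul]
        _ ≤ _ := by
            rw [ENNReal.div_rpow_of_nonneg _ _ hq0.le]
            gcongr
            exact sum_lorentzIntegral_rpow_le hp hpq μ f _ J hJd
              fun i _ => measurableSet_gridCube a _ _
    have hU : ⋃ i ∈ bad, gridCube a i.1 i.2 =
        ⋃ I : Finset bad, ⋃ i ∈ I, gridCube a i.1.1 i.1.2 := by
      rw [biUnion_eq_iUnion]
      exact iUnion_eq_iUnion_finset _
    rw [hU, Directed.measure_iUnion]
    · exact iSup_le hfin
    · refine Monotone.directed_le fun I J hIJ => ?_
      exact biUnion_mono hIJ fun _ _ => le_rfl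
  refine (measure_iUnion_le _).trans ?_
  rw [tsum_fintype]
  refine (Finset.sum_le_sum fun a _ => key a).trans_eq ?_
  simp

/-- Level sets by duality: if the pairing of `τ` with `U` times any unimodular function on any set
`G` off `ω` is controlled, then so is the part off `ω` of the level set of `τ`. -/
theorem wMeasure_level_le {𝕜 : Type*} [RCLike 𝕜] {n : ℕ} {τ : Rn n → 𝕜}
    (hτ : LocallyIntegrable τ volume) {U : Rn n → ℝ≥0} (hU : Measurable U) {y : ℝ} (hy : 0 < y)
    {ω : Set (Rn n)} (hω : MeasurableSet ω) {Z : ℝ≥0∞}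
    (H : ∀ {G : Set (Rn n)}, MeasurableSet G → Disjoint G ω → ∀ {h : Rn n → 𝕜},
      StronglyMeasurable h → (∀ x, ‖h x‖ₑ = G.indicator (fun x => (U x : ℝ≥0∞)) x) →
      ∀ {M ρ : ℝ}, (∀ x, ‖h x‖ ≤ M) → (∀ x, x ∉ Metric.closedBall (0 : Rn n) ρ → h x = 0) →
      ‖∫ x, τ x * h x‖ₑ ≤ ENNReal.ofReal y / 2 * (Z + wMeasure U G)) :
    wMeasure U {x | y < ‖τ x‖} ≤ Z + wMeasure U ω := by
  set τ' := hτ.aestronglyMeasurable.mk τ with hτ'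
  have hτm : StronglyMeasurable τ' := hτ.aestronglyMeasurable.stronglyMeasurable_mk
  have hττ : τ =ᵐ[volume] τ' := hτ.aestronglyMeasurable.ae_eq_mk
  have hlev : MeasurableSet {x | y < ‖τ' x‖} :=
    measurableSet_lt measurable_const hτm.norm.measurable
  set S := {x | y < ‖τ' x‖} \ ω with hS
  have hSm : MeasurableSet S := hlev.diff hω
  -- exhaust the level set by bounded sets on which the density is bounded
  set G : ℕ → Set (Rn n) := fun j =>
    S ∩ (Metric.closedBall (0 : Rn n) j ∩ {x | U x ≤ (j : ℝ≥0)}) with hG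
  have hGm : ∀ j, MeasurableSet (G j) := fun j =>
    hSm.inter (Metric.isClosed_closedBall.measurableSet.inter (hU measurableSet_Iic))
  have hGmono : Monotone G := by
    intro i j hij x hx
    have hij' : (i : ℝ≥0) ≤ j := by exact_mod_cast hij
    refine ⟨hx.1, Metric.closedBall_subset_closedBall (by exact_mod_cast hij) hx.2.1, ?_⟩
    exact le_trans (mem_ofPred.1 hx.2.2) hij'
  have hGU : ⋃ j, G j = S := by
    refine subset_antisymm (iUnion_subset fun j => inter_subset_left) fun x hx => ?_
    obtain ⟨j, hj⟩ := exists_nat_ge (max ‖x‖ (U x))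
    refine mem_iUnion.2 ⟨j, hx, ?_, ?_⟩
    · rw [mem_closedBall_zero_iff]
      exact (le_max_left _ _).trans hj
    · exact_mod_cast (le_max_right _ _).trans hj
  have hGZ : ∀ j, wMeasure U (G j) ≤ Z := by
    intro j
    have hGt : wMeasure U (G j) ≠ ∞ := by
      rw [wMeasure_apply]
      refine ne_top_of_le_ne_top ?_ (setLIntegral_mono measurable_const
        (g := fun _ => ((j : ℝ≥0) : ℝ≥0∞)) fun x hx => ENNReal.coe_le_coe.2 hx.2.2)
      rw [setLIntegral_const]
      refine ENNReal.mul_ne_top ENNReal.coe_ne_top (ne_top_of_le_ne_top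
        (measure_closedBall_lt_top (x := (0 : Rn n)) (r := j)).ne (measure_mono fun x hx => hx.2.1))
    -- the unimodular function with `τ' * σ = |τ'|` on `G j`
    set σ : Rn n → 𝕜 := fun x => (starRingEnd 𝕜) (τ' x) / ((‖τ' x‖ : ℝ) : 𝕜) with hσ
    have hσm : Measurable σ := by
      refine Measurable.div ?_ ?_
      · exact (RCLike.continuous_conj.measurable).comp hτm.measurable
      · exact RCLike.continuous_ofReal.measurable.comp hτm.norm.measurable
    set h : Rn n → 𝕜 := (G j).indicator fun x => (((U x : ℝ≥0) : ℝ) : 𝕜) * σ x with hh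
    have hτ0 : ∀ x ∈ G j, ‖τ' x‖ ≠ 0 := fun x hx => (hy.trans hx.1.1).ne'
    have hσ1 : ∀ x ∈ G j, ‖σ x‖ = 1 := by
      intro x hx
      rw [hσ]
      simp only [norm_div, RCLike.norm_conj, RCLike.norm_ofReal, abs_norm]
      exact div_self (hτ0 x hx)
    have hhm : Measurable h :=
      ((RCLike.continuous_ofReal.measurable.comp hU.coe_nnreal_real).mul hσm).indicator (hGm j)
    have hhn : ∀ x, ‖h x‖ = (G j).indicator (fun x => ((U x : ℝ≥0) : ℝ)) x := by
      intro x
      by_cases hx : x ∈ G j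
      · rw [hh, indicator_of_mem hx, indicator_of_mem hx, norm_mul, hσ1 x hx, mul_one,
          RCLike.norm_ofReal, abs_of_nonneg (NNReal.coe_nonneg _)]
      · rw [hh, indicator_of_notMem hx, indicator_of_notMem hx, norm_zero]
    have h1 := H (hGm j) (disjoint_sdiff_left.mono_left inter_subset_left) (h := h)
      hhm.stronglyMeasurable (fun x => by
        rw [← ofReal_norm, hhn]
        by_cases hx : x ∈ G j
        · rw [indicator_of_mem hx, indicator_of_mem hx, ENNReal.ofReal_coe_nnreal]
        · rw [indicator_of_notMem hx, indicator_of_notMem hx, ENNReal.ofReal_zero])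
      (M := j) (ρ := j) (fun x => by
        rw [hhn]
        by_cases hx : x ∈ G j
        · rw [indicator_of_mem hx]
          exact_mod_cast hx.2.2
        · rw [indicator_of_notMem hx]
          positivity) (fun x hx => by
        rw [hh, indicator_of_notMem fun hx' => hx hx'.2.1])
    set ψ : Rn n → ℝ := (G j).indicator fun x => (U x : ℝ) * ‖τ' x‖ with hψ
    have hψ0 : ∀ x, 0 ≤ ψ x := fun x => indicator_nonneg (fun x _ => by positivity) x
    have hint : Integrable ψ volume := by
      rw [hψ, integrable_indicator_iff (hGm j)]
      have hτK : IntegrableOn τ (Metric.closedBall (0 : Rn n) j) volume :=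
        hτ.integrableOn_isCompact (isCompact_closedBall _ _)
      have hτG : IntegrableOn τ' (G j) volume :=
        (hτK.mono_set fun x hx => hx.2.1).congr (ae_restrict_of_ae hττ)
      refine Integrable.mono' (Integrable.const_mul (Integrable.norm hτG) (j : ℝ)) ?_ ?_
      · exact (hU.coe_nnreal_real.mul hτm.norm.measurable).aestronglyMeasurable
      · refine (ae_restrict_iff' (hGm j)).2 (Filter.Eventually.of_forall fun x hx => ?_)
        rw [Real.norm_of_nonneg (by positivity)]
        have : (U x : ℝ) ≤ j := by exact_mod_cast hx.2.2
        gcongr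
    have h2 : ∫ x, τ x * h x = ((∫ x, ψ x : ℝ) : 𝕜) := by
      rw [← integral_ofReal]
      refine integral_congr_ae ?_
      filter_upwards [hττ] with x hx
      rw [hx, hh, hψ]
      by_cases hxG : x ∈ G j
      · rw [indicator_of_mem hxG, indicator_of_mem hxG]
        have h3 : ((‖τ' x‖ : ℝ) : 𝕜) ≠ 0 := by exact_mod_cast hτ0 x hxG
        simp only [hσ]
        rw [mul_left_comm, ← mul_div_assoc, RCLike.mul_conj, RCLike.ofReal_mul]
        congr 1
        field_simp
      · rw [indicator_of_notMem hxG, indicator_of_notMem hxG]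
        simp
    have h3 : ‖∫ x, τ x * h x‖ₑ = ∫⁻ x, ENNReal.ofReal (ψ x) := by
      rw [h2, ← ofReal_norm, RCLike.norm_ofReal, abs_of_nonneg (integral_nonneg hψ0),
        ofReal_integral_eq_lintegral_ofReal hint (Filter.Eventually.of_forall hψ0)]
    have h4 : ENNReal.ofReal y * wMeasure U (G j) ≤ ‖∫ x, τ x * h x‖ₑ := by
      rw [h3, wMeasure_apply, ← lintegral_indicator (hGm j), ← lintegral_const_mul' _ _
        ENNReal.ofReal_ne_top]
      refine lintegral_mono fun x => ?_
      by_cases hx : x ∈ G j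
      · simp only [hψ, indicator_of_mem hx]
        rw [mul_comm (U x : ℝ), ENNReal.ofReal_mul (norm_nonneg _), ENNReal.ofReal_coe_nnreal]
        gcongr
        exact (mem_ofPred.1 hx.1.1).le
      · simp [hψ, hx]
    have h5 := h4.trans h1
    have hy0 : ENNReal.ofReal y / 2 ≠ 0 := (ENNReal.half_pos (by simpa using hy)).ne'
    have hyt : ENNReal.ofReal y / 2 ≠ ∞ := ENNReal.div_ne_top ENNReal.ofReal_ne_top (by norm_num)
    have h6 : ENNReal.ofReal y / 2 * (wMeasure U (G j) + wMeasure U (G j)) ≤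
        ENNReal.ofReal y / 2 * (Z + wMeasure U (G j)) := by
      refine le_trans (le_of_eq ?_) h5
      rw [← two_mul, ← mul_assoc, ENNReal.div_mul_cancel (by norm_num) (by norm_num)]
    have h7 := (ENNReal.mul_le_mul_iff_right hy0 hyt).1 h6
    exact (ENNReal.add_le_add_iff_right hGt).1 h7
  have hSZ : wMeasure U S ≤ Z := by
    rw [← hGU, hGmono.measure_iUnion]
    exact iSup_le hGZ
  have h8 : wMeasure U {x | y < ‖τ x‖} = wMeasure U {x | y < ‖τ' x‖} := by
    refine measure_congr ?_
    filter_upwards [(wMeasure_absolutelyContinuous U).ae_eq hττ] with x hx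
    change (y < ‖τ x‖) = (y < ‖τ' x‖)
    rw [hx]
  rw [h8]
  calc _ ≤ wMeasure U (S ∪ ω) := measure_mono (by rw [hS, sdiff_union_self]; exact subset_union_left)
    _ ≤ wMeasure U S + wMeasure U ω := measure_union_le _ _
    _ ≤ _ := by gcongr

/-- The weak-type bound on test functions. The level set `{|T f| > y}` is split into the exceptional
set, where the localized Lorentz norms of `f` are large, and a remainder, on subsets `G` of which
`T f` is tested against `w ^ q` times a unimodular function. The sparse form is then at most
`y / 2 * ((b / γ) ^ q + u(G))` for a suitable `γ`, and the term `u(G)` is absorbed. -/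
theorem exists_weakNorm_le {𝕜 : Type*} [RCLike 𝕜] {n : ℕ} (hn : n ≠ 0)
    {α p₀ p q r s η : ℝ} {q₀ : ℝ≥0∞} {N : ℕ} {B : ℝ≥0} (hs₀ : s = (ENNReal.conjExponent q₀).toReal)
    (hp₀ : 1 ≤ p₀) (hp : p₀ ≤ p) (hpq : p ≤ q) (hr : 1 ≤ r) (hs : 1 ≤ s)
    (hsq : s / (q * r) + s * (1 - 1 / q) = 1) (hα₀ : 0 ≤ α) (hαn : α < n)
    (hα : 1 / p - 1 / q = α / (n * s)) (hη : 0 < η) (hη1 : η ≤ 1) :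
    ∃ C : ℝ≥0, ∀ {T : (Rn n → 𝕜) → Rn n → 𝕜} {w : Rn n → ℝ≥0},
      SparselyDominated α p₀ q₀ η N B T → Measurable w → (∀ᵐ x, w x ≠ 0) →
      aRConst (p / p₀) (q / p₀) (fun x => w x ^ p₀) < ∞ → rhConst r (fun x => w x ^ q) < ∞ →
      ∀ f ∈ testFun 𝕜 n, weakNorm q (wMeasure fun x => w x ^ q) (T f) ≤
        C * (aRConst (p / p₀) (q / p₀) (fun x => w x ^ p₀) ^ (1 / p₀) *
          rhConst r (fun x => w x ^ q) ^ (r + 1 / q) * doublingConst η (fun x => w x ^ q)) *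
          lorentzOneNorm p (wMeasure fun x => w x ^ p) f := by
  have hp₀' : 0 < p₀ := by linarith
  have hp' : 0 < p := by linarith
  have hq' : 0 < q := by linarith
  have hs' : 0 < s := by linarith
  have hr' : 0 < r := by linarith
  have hq1 : 1 / q ≤ 1 := by
    rw [div_le_one hq']
    linarith
  have hqs : 1 - 1 / s < 1 / q := by
    have h1 : 0 < 1 / (q * r) := by positivity
    have h2 : 1 / s = 1 / (q * r) + (1 - 1 / q) := by
      rw [eq_comm, ← mul_right_inj' hs'.ne', mul_one_div_cancel hs'.ne']
      calc _ = s / (q * r) + s * (1 - 1 / q) := by ring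
        _ = 1 := hsq
    linarith
  obtain ⟨c₁, hc₁⟩ := exists_testing_bound n (hp₀.trans (hp.trans hpq)) hr hs hsq
  obtain ⟨c₂, hc₂⟩ := exists_tsum_formTerm_le hn hη hη1
  refine ⟨(3 ^ n + 1) * (2 * ((B * N + 1) * ((c₂ + 1) * ((c₁ + 1) * p₀.toNNReal)))),
    fun {T w} hT hw hpos hA hR f hf => ?_⟩
  obtain ⟨δ, Cg, hδ, hδ1, hCg, htest⟩ := hc₁ hp₀' hp' hw hpos hA hR
  have hut : ∀ Q, IsCube Q → wMeasure (fun x => w x ^ q) Q ≠ ∞ := fun Q hQ =>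
    wMeasure_ne_top hp₀' hp' hq' hw hA hQ
  have hD1 := one_le_doublingConst hη1 hw hpos hut
  have hDle := doublingConst_le hp₀' hp hpq hη hw hA
  have hτ := hT.locallyIntegrable f hf
  have hR1 : 1 ≤ rhConst r (fun x => w x ^ q) := by
    rcases hr.eq_or_lt with rfl | hr1
    · rw [rhConst, if_pos rfl]
    · exact one_le_rhConst hr1 hw hpos hut
  set A := aRConst (p / p₀) (q / p₀) (fun x => w x ^ p₀) with hAdef
  set R := rhConst r (fun x => w x ^ q) with hRdef
  set D := doublingConst η (fun x => w x ^ q) with hDdef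
  set u := wMeasure (fun x => w x ^ q) with hu
  set v := wMeasure (fun x => w x ^ p) with hv
  set b := lorentzIntegral p v (fun x => ‖f x‖) with hb
  have hA0 : A ≠ 0 := by
    intro h0
    rw [h0, ENNReal.zero_rpow_of_pos (by positivity), mul_zero] at hDle
    exact absurd (hD1.trans hDle) (by norm_num)
  have hDt : D ≠ ∞ := ne_top_of_le_ne_top (ENNReal.mul_ne_top ENNReal.ofReal_ne_top
    (ENNReal.rpow_ne_top_of_nonneg (by positivity) hA.ne)) hDle
  have hX0 : A ^ (1 / p₀) * R ^ (r + 1 / q) * D ≠ 0 := by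
    refine mul_ne_zero (mul_ne_zero (ENNReal.rpow_pos (pos_iff_ne_zero.2 hA0) hA.ne).ne'
      (ENNReal.rpow_pos (zero_lt_one.trans_le hR1) hR.ne).ne') (zero_lt_one.trans_le hD1).ne'
  have hXt : A ^ (1 / p₀) * R ^ (r + 1 / q) * D ≠ ∞ := by
    refine ENNReal.mul_ne_top (ENNReal.mul_ne_top
      (ENNReal.rpow_ne_top_of_nonneg (by positivity) hA.ne)
      (ENNReal.rpow_ne_top_of_nonneg (by positivity) hR.ne)) hDt
  set X := A ^ (1 / p₀) * R ^ (r + 1 / q) * D with hX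
  have hp₀0 : p₀.toNNReal ≠ 0 := by simpa using hp₀'
  set k : ℝ≥0 := (B * N + 1) * ((c₂ + 1) * ((c₁ + 1) * p₀.toNNReal)) with hk
  have hk0 : k ≠ 0 := by
    have := pos_iff_ne_zero.2 hp₀0
    positivity
  set Θ : ℝ≥0∞ := k * X with hΘ
  have hΘ0 : Θ ≠ 0 := mul_ne_zero (by exact_mod_cast hk0) hX0
  have hΘt : Θ ≠ ∞ := ENNReal.mul_ne_top ENNReal.coe_ne_top hXt
  refine iSup₂_le fun y hy => ?_
  have hy0 : ENNReal.ofReal y ≠ 0 := by simpa using hy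
  -- the height at which the terms of the form add up to at most half of `y * u G`
  set γ : ℝ≥0∞ := ENNReal.ofReal y / 2 / Θ with hγ
  have hγ0 : γ ≠ 0 := (ENNReal.div_pos (ENNReal.half_pos hy0).ne' hΘt).ne'
  have hγt : γ ≠ ∞ := ENNReal.div_ne_top
    (ENNReal.div_ne_top ENNReal.ofReal_ne_top (by norm_num)) hΘ0
  have hΘγ : Θ * γ = ENNReal.ofReal y / 2 := ENNReal.mul_div_cancel hΘ0 hΘt
  set ω : Set (Rn n) := ⋃ a, ⋃ i ∈ {i : ℤ × (Fin n → ℤ) | γ * u (gridCube a i.1 i.2) ^ (1 / q) <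
      lorentzIntegral p (v.restrict (gridCube a i.1 i.2)) fun x => ‖f x‖}, gridCube a i.1 i.2
    with hω
  have hωm : MeasurableSet ω := MeasurableSet.iUnion fun a =>
    MeasurableSet.biUnion (to_countable _) fun i _ => measurableSet_gridCube a _ _
  have hωle : u ω ≤ 3 ^ n * (b / γ) ^ q :=
    measure_iUnion_gridCube_le (hp₀.trans hp) hpq v u _ hγ0 hγt
  have hfm : Measurable fun x => ‖f x‖ := hf.1.continuous.norm.measurable
  have hlevel : u {x | y < ‖T f x‖} ≤ (b / γ) ^ q + u ω := by
    refine wMeasure_level_le hτ (hw.pow_const q) hy hωm ?_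
    intro G hG hGω h hh hhU M ρ hM hρ
    obtain ⟨hgrid, hcube⟩ := htest (g := fun x => ‖h x‖ₑ) hG fun x => (hhU x).le
    have hform : ∀ {D' : Set (Set (Rn n))}, IsDyadicGrid D' → ∀ {S : Set (Set (Rn n))}, S ⊆ D' →
        IsSparse η S → ∑' Q : S, formTerm α p₀ s (fun x => ‖f x‖ₑ) (fun x => ‖h x‖ₑ) Q ≤
          c₂ * (A ^ (1 / p₀) * Cg * ENNReal.ofReal (1 / δ) * D) * ENNReal.ofReal p₀ * γ *
            ((b / γ) ^ q + u G) := by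
      intro D' hD' S hSD hS
      have := hc₂ hp₀ hp hpq hs hα₀ hαn hα hδ hδ1 hw hpos hA (f := fun x => ‖f x‖)
        (fun x => norm_nonneg _) hfm hG hγ0 hγt hgrid hcube (fun a k m hlt => ?_) hD' hSD hS
      · simpa only [ofReal_norm] using this
      · have hsub : gridCube a k m ⊆ ω := by
          refine subset_iUnion_of_subset a ?_
          exact subset_biUnion_of_mem (u := fun i : ℤ × (Fin n → ℤ) => gridCube a i.1 i.2)
            (x := (k, m)) hlt
        rw [(hGω.mono_right hsub).inter_eq, measure_empty]
    refine (hT.enorm_integral_mul_le hs₀ hn hp₀ hp hpq hs hqs hα hη hf hh hM hρ hform).trans ?_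
    rw [← hΘγ]
    calc B * (N * (c₂ * (A ^ (1 / p₀) * Cg * ENNReal.ofReal (1 / δ) * D) * ENNReal.ofReal p₀ * γ *
          ((b / γ) ^ q + u G))) = (B * N : ℝ≥0∞) * (c₂ * ((Cg * ENNReal.ofReal (1 / δ)) *
            ENNReal.ofReal p₀)) * (A ^ (1 / p₀) * D) * γ * ((b / γ) ^ q + u G) := by
          generalize A ^ (1 / p₀) = A'
          generalize (b / γ) ^ q = b'
          ring
      _ ≤ (B * N : ℝ≥0∞) * (c₂ * ((c₁ * R ^ (r + 1 / q)) *
            ENNReal.ofReal p₀)) * (A ^ (1 / p₀) * D) * γ * ((b / γ) ^ q + u G) := by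
          gcongr _ * (_ * (?_ * _)) * _ * _ * _
      _ ≤ ((B * N + 1 : ℝ≥0) : ℝ≥0∞) * ((c₂ + 1 : ℝ≥0) * (((c₁ + 1 : ℝ≥0) * R ^ (r + 1 / q)) *
            ENNReal.ofReal p₀)) * (A ^ (1 / p₀) * D) * γ * ((b / γ) ^ q + u G) := by
          gcongr
          · push_cast
            exact le_self_add
          · exact le_self_add
          · exact le_self_add
      _ = Θ * γ * ((b / γ) ^ q + u G) := by
          rw [hΘ, hX, hk]
          simp only [ENNReal.coe_mul]
          rw [show ENNReal.ofReal p₀ = (p₀.toNNReal : ℝ≥0∞) from rfl]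
          generalize A ^ (1 / p₀) = A'
          generalize (b / γ) ^ q = b'
          generalize R ^ (r + 1 / q) = R'
          ring
  have h3 : (1 : ℝ≥0∞) ≤ 3 ^ n + 1 := le_add_self
  have h4 : u {x | y < ‖T f x‖} ^ (1 / q) ≤ (3 ^ n + 1) * (b / γ) := by
    calc _ ≤ ((3 ^ n + 1) * (b / γ) ^ q) ^ (1 / q) := by
          refine ENNReal.rpow_le_rpow (hlevel.trans ?_) (by positivity)
          calc _ ≤ (b / γ) ^ q + 3 ^ n * (b / γ) ^ q := by gcongr
            _ = _ := by ring
      _ = (3 ^ n + 1) ^ (1 / q) * (b / γ) := by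
          rw [ENNReal.mul_rpow_of_nonneg _ _ (by positivity), ← ENNReal.rpow_mul,
            mul_one_div_cancel hq'.ne', ENNReal.rpow_one]
      _ ≤ _ := by
          have h5 := ENNReal.rpow_le_rpow_of_exponent_le h3 hq1
          rw [ENNReal.rpow_one] at h5
          gcongr
  calc ENNReal.ofReal y * u {x | y < ‖T f x‖} ^ (1 / q) ≤
        ENNReal.ofReal y * ((3 ^ n + 1) * (b / γ)) := by gcongr
    _ = (2 * (Θ * γ)) * ((3 ^ n + 1) * (b / γ)) := by
        rw [hΘγ, ENNReal.mul_div_cancel (by norm_num) (by norm_num)]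
    _ = (3 ^ n + 1) * (2 * Θ) * (γ * (b / γ)) := by ring
    _ = (3 ^ n + 1) * (2 * Θ) * b := by rw [ENNReal.mul_div_cancel hγ0 hγt]
    _ ≤ (3 ^ n + 1) * (2 * Θ) * lorentzOneNorm p v f := by
        gcongr
        have h6 : 1 ≤ ENNReal.ofReal p := by
          rw [ENNReal.one_le_ofReal]
          exact hp₀.trans hp
        calc b = 1 * b := (one_mul b).symm
          _ ≤ ENNReal.ofReal p * b := by gcongr
    _ = _ := by
        rw [hΘ]
        push_cast
        ring

/-! ### Lorentz norms -/

theorem lorentzOneNorm_mono {𝕜 : Type*} [RCLike 𝕜] {n : ℕ} {p : ℝ} (hp : 0 ≤ p) {μ : Measure (Rn n)}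
    {f g : Rn n → 𝕜} (h : ∀ᵐ x ∂μ, ‖f x‖ ≤ ‖g x‖) :
    lorentzOneNorm p μ f ≤ lorentzOneNorm p μ g := by
  unfold lorentzOneNorm
  refine mul_le_mul_right (lintegral_mono fun y => ENNReal.rpow_le_rpow ?_ (by positivity)) _
  refine measure_mono_ae ?_
  filter_upwards [h] with x hx hy
  exact lt_of_lt_of_le (show y < ‖f x‖ from hy) hx

theorem lintegral_Ioi_div {c : ℝ} (hc : 0 < c) {F : ℝ → ℝ≥0∞} (hF : Measurable F) :
    ∫⁻ y in Ioi (0 : ℝ), F (y / c) = ENNReal.ofReal c * ∫⁻ y in Ioi (0 : ℝ), F y := by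
  have h1 : ∫⁻ y, (Ioi (0 : ℝ)).indicator (fun y => F (y / c)) y =
      ENNReal.ofReal c * ∫⁻ y, (Ioi (0 : ℝ)).indicator (fun y => F (y / c)) (c * y) := by
    conv_lhs => rw [← Real.smul_map_volume_mul_left hc.ne']
    rw [lintegral_smul_measure, smul_eq_mul, abs_of_pos hc, lintegral_map _ (by fun_prop)]
    exact (hF.comp (by fun_prop)).indicator measurableSet_Ioi
  rw [← lintegral_indicator measurableSet_Ioi, h1, ← lintegral_indicator measurableSet_Ioi]
  congr 2
  ext y
  by_cases hy : 0 < y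
  · rw [indicator_of_mem (show c * y ∈ Ioi (0 : ℝ) from mul_pos hc hy), indicator_of_mem
      (show y ∈ Ioi (0 : ℝ) from hy), mul_div_cancel_left₀ _ hc.ne']
  · have hcy : c * y ∉ Ioi (0 : ℝ) := fun h => hy (pos_of_mul_pos_right (mem_Ioi.1 h) hc.le)
    rw [indicator_of_notMem hcy, indicator_of_notMem (show y ∉ Ioi (0 : ℝ) from hy)]

theorem lorentzOneNorm_const_mul {𝕜 : Type*} [RCLike 𝕜] {n : ℕ} {p : ℝ} (hp : 0 < p)
    (μ : Measure (Rn n)) (c : 𝕜) (f : Rn n → 𝕜) :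
    lorentzOneNorm p μ (c • f) = ‖c‖ₑ * lorentzOneNorm p μ f := by
  rcases eq_or_ne c 0 with rfl | hc
  · simp only [lorentzOneNorm, zero_smul, Pi.zero_apply, norm_zero, enorm_zero, zero_mul]
    rw [setLIntegral_congr_fun measurableSet_Ioi (g := fun _ => 0)]
    · simp
    · intro y hy
      have : {x : Rn n | y < 0} = ∅ := by
        ext x
        simpa using (mem_Ioi.1 hy).le
      simp [this, hp]
  · have hc' : 0 < ‖c‖ := norm_pos_iff.2 hc
    have h1 := lintegral_Ioi_div hc' (measurable_measure_lt hp.le μ fun x => ‖f x‖)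
    unfold lorentzOneNorm
    rw [mul_left_comm, ← ofReal_norm, ← h1]
    congr 2
    ext y
    congr 2
    ext x
    simp only [mem_ofPred_eq, Pi.smul_apply, smul_eq_mul, norm_mul]
    rw [div_lt_iff₀' hc']

/-- The quasi-triangle inequality; the constant `2` comes from splitting the level `y` into halves. -/
theorem lorentzOneNorm_add_le {𝕜 : Type*} [RCLike 𝕜] {n : ℕ} {p : ℝ} (hp : 1 ≤ p)
    (μ : Measure (Rn n)) (f g : Rn n → 𝕜) :
    lorentzOneNorm p μ (f + g) ≤ 2 * (lorentzOneNorm p μ f + lorentzOneNorm p μ g) := by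
  have hp0 : 0 < p := by linarith
  have hp1 : 1 / p ≤ 1 := by
    rw [div_le_one hp0]
    exact hp
  have hf := measurable_measure_lt hp0.le μ fun x => ‖f x‖
  have hg := measurable_measure_lt hp0.le μ fun x => ‖g x‖
  have h1 : ∫⁻ y in Ioi (0 : ℝ), μ {x | y < ‖(f + g) x‖} ^ (1 / p) ≤
      ∫⁻ y in Ioi (0 : ℝ), (μ {x | y / 2 < ‖f x‖} ^ (1 / p) + μ {x | y / 2 < ‖g x‖} ^ (1 / p)) := by
    refine lintegral_mono fun y => ?_
    refine le_trans (ENNReal.rpow_le_rpow ?_ (by positivity))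
      (ENNReal.rpow_add_le_add_rpow _ _ (by positivity) hp1)
    refine (measure_mono fun x hx => ?_).trans (measure_union_le _ _)
    by_contra h
    simp only [mem_union, mem_ofPred_eq, not_or, not_lt] at h
    refine absurd (show y < ‖(f + g) x‖ from hx) (not_lt.2 ((norm_add_le _ _).trans ?_))
    linarith [h.1, h.2]
  have hf2 := lintegral_Ioi_div two_pos hf
  have hg2 := lintegral_Ioi_div two_pos hg
  have hf' : Measurable fun y : ℝ => μ {x | y / 2 < ‖f x‖} ^ (1 / p) :=
    hf.comp (by fun_prop : Measurable fun y : ℝ => y / 2)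
  rw [lintegral_add_left hf', hf2, hg2] at h1
  unfold lorentzOneNorm
  calc _ ≤ ENNReal.ofReal p * (ENNReal.ofReal 2 * (∫⁻ y in Ioi (0 : ℝ), μ {x | y < ‖f x‖} ^ (1 / p))
        + ENNReal.ofReal 2 * ∫⁻ y in Ioi (0 : ℝ), μ {x | y < ‖g x‖} ^ (1 / p)) := by gcongr
    _ = _ := by
        simp only [ENNReal.ofReal_ofNat]
        ring

theorem lorentzOneNorm_lt_top_of_bounded {𝕜 : Type*} [RCLike 𝕜] {n : ℕ} {p : ℝ} (hp : 0 < p)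
    {μ : Measure (Rn n)} {f : Rn n → 𝕜} {M : ℝ} {K : Set (Rn n)} (hM : ∀ x, ‖f x‖ ≤ M)
    (hK : ∀ x, x ∉ K → f x = 0) (hμK : μ K ≠ ∞) : lorentzOneNorm p μ f < ∞ := by
  refine ENNReal.mul_lt_top ENNReal.ofReal_lt_top ?_
  calc ∫⁻ y in Ioi (0 : ℝ), μ {x | y < ‖f x‖} ^ (1 / p) ≤
        ∫⁻ y in Ioi (0 : ℝ), (Iio M).indicator (fun _ => μ K ^ (1 / p)) y := by
        refine setLIntegral_mono (measurable_const.indicator measurableSet_Iio) fun y hy => ?_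
        by_cases hyM : y < M
        · rw [indicator_of_mem (show y ∈ Iio M from hyM)]
          refine ENNReal.rpow_le_rpow (measure_mono fun x hx => ?_) (by positivity)
          by_contra hxK
          have h1 : y < ‖f x‖ := hx
          rw [hK x hxK, norm_zero] at h1
          exact absurd h1 (not_lt.2 (mem_Ioi.1 hy).le)
        · have : {x | y < ‖f x‖} = ∅ := by
            ext x
            simpa using (hM x).trans (not_lt.1 hyM)
          rw [this, measure_empty, ENNReal.zero_rpow_of_pos (by positivity)]
          exact zero_le
    _ = μ K ^ (1 / p) * ENNReal.ofReal M := by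
        rw [setLIntegral_indicator measurableSet_Iio, setLIntegral_const, inter_comm, Ioi_inter_Iio,
          Real.volume_Ioo, sub_zero]
    _ < ∞ := ENNReal.mul_lt_top (ENNReal.rpow_lt_top_of_nonneg (by positivity) hμK)
        ENNReal.ofReal_lt_top

/-- Dominated convergence in the Lorentz norm. -/
theorem tendsto_lorentzOneNorm_zero {𝕜 : Type*} [RCLike 𝕜] {n : ℕ} {p : ℝ} (hp : 0 < p)
    {μ : Measure (Rn n)} {F : ℕ → Rn n → 𝕜} {f : Rn n → 𝕜}
    (hF : ∀ j, AEStronglyMeasurable (F j) μ) (hFf : ∀ j x, ‖F j x‖ ≤ ‖f x‖)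
    (hf : lorentzOneNorm p μ f ≠ ∞) (hf' : AEStronglyMeasurable f μ)
    (hlim : ∀ᵐ x ∂μ, Filter.Tendsto (fun j => F j x) Filter.atTop (nhds 0)) :
    Filter.Tendsto (fun j => lorentzOneNorm p μ (F j)) Filter.atTop (nhds 0) := by
  have hp' : ENNReal.ofReal p ≠ 0 := by simpa using hp
  have hfI : ∫⁻ y in Ioi (0 : ℝ), μ {x | y < ‖f x‖} ^ (1 / p) ≠ ∞ := fun h =>
    hf (by rw [lorentzOneNorm, h, ENNReal.mul_top hp'])
  have hfm := measurable_measure_lt hp.le μ fun x => ‖f x‖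
  have hnull : ∀ {h : Rn n → 𝕜}, AEStronglyMeasurable h μ → ∀ y : ℝ,
      NullMeasurableSet {x | y < ‖h x‖} μ := fun hh y =>
    nullMeasurableSet_lt aemeasurable_const hh.norm.aemeasurable
  have hlev : ∀ᵐ y ∂(volume.restrict (Ioi (0 : ℝ))),
      Filter.Tendsto (fun j => μ {x | y < ‖F j x‖} ^ (1 / p)) Filter.atTop (nhds 0) := by
    have hfin : ∀ᵐ y ∂(volume.restrict (Ioi (0 : ℝ))), μ {x | y < ‖f x‖} ^ (1 / p) < ∞ :=
      ae_lt_top hfm hfI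
    filter_upwards [hfin, ae_restrict_mem measurableSet_Ioi] with y hy hy0
    have hyt : μ {x | y < ‖f x‖} ≠ ∞ := by
      intro h
      rw [h, ENNReal.top_rpow_of_pos (by positivity)] at hy
      exact lt_irrefl _ hy
    have h1 : Filter.Tendsto (fun j => ∫⁻ x, {x | y < ‖F j x‖}.indicator 1 x ∂μ) Filter.atTop
        (nhds (∫⁻ _x, 0 ∂μ)) := by
      refine tendsto_lintegral_of_dominated_convergence' ({x | y < ‖f x‖}.indicator 1)
        (fun j => ?_) (fun j => Filter.Eventually.of_forall fun x => ?_) ?_ ?_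
      · exact aemeasurable_one.indicator₀ (hnull (hF j) y)
      · refine indicator_le_indicator_of_subset (fun x hx => ?_) (fun _ => zero_le) x
        exact lt_of_lt_of_le (show y < ‖F j x‖ from hx) (hFf j x)
      · rwa [lintegral_indicator_one₀ (hnull hf' y)]
      · filter_upwards [hlim] with x hx
        have h2 : ∀ᶠ j in Filter.atTop, ‖F j x‖ < y := by
          have h3 := hx.norm
          rw [norm_zero] at h3
          exact h3.eventually (gt_mem_nhds hy0)
        refine tendsto_const_nhds.congr' ?_
        filter_upwards [h2] with j hj
        rw [indicator_of_notMem]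
        exact fun h => lt_asymm hj h
    simp only [lintegral_zero] at h1
    have h2 : Filter.Tendsto (fun j => μ {x | y < ‖F j x‖}) Filter.atTop (nhds 0) := by
      refine h1.congr fun j => ?_
      exact lintegral_indicator_one₀ (hnull (hF j) y)
    have h3 := (ENNReal.continuous_rpow_const (y := 1 / p)).tendsto 0
    rw [ENNReal.zero_rpow_of_pos (by positivity)] at h3
    exact h3.comp h2
  have h4 : Filter.Tendsto (fun j => ∫⁻ y in Ioi (0 : ℝ), μ {x | y < ‖F j x‖} ^ (1 / p)) Filter.atTop
      (nhds (∫⁻ _y in Ioi (0 : ℝ), 0)) := by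
    refine tendsto_lintegral_of_dominated_convergence (fun y => μ {x | y < ‖f x‖} ^ (1 / p))
      (fun j => measurable_measure_lt hp.le μ fun x => ‖F j x‖)
      (fun j => Filter.Eventually.of_forall fun y => ?_) hfI hlev
    refine ENNReal.rpow_le_rpow (measure_mono fun x hx => ?_) (by positivity)
    exact lt_of_lt_of_le (show y < ‖F j x‖ from hx) (hFf j x)
  simp only [lintegral_zero] at h4
  simpa [lorentzOneNorm] using ENNReal.Tendsto.const_mul h4 (Or.inr ENNReal.ofReal_ne_top)

/-- Test functions are dense in the Lorentz space. -/
theorem exists_testFun_lorentzOneNorm_le {𝕜 : Type*} [RCLike 𝕜] {n : ℕ} {p : ℝ} (hp : 1 ≤ p)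
    {μ : Measure (Rn n)} (hμ : μ ≪ volume)
    (hfin : ∀ ρ : ℝ, μ (Metric.closedBall 0 ρ) ≠ ∞) {f : Rn n → 𝕜} (hf : f ∈ LorentzOne 𝕜 p μ)
    {ε : ℝ≥0∞} (hε : ε ≠ 0) : ∃ φ ∈ testFun 𝕜 n, lorentzOneNorm p μ (f - φ) ≤ ε := by
  have hp0 : 0 < p := by linarith
  obtain ⟨hfm, hfl⟩ := hf
  set f' := hfm.mk f with hf'
  have hf'm : StronglyMeasurable f' := hfm.stronglyMeasurable_mk
  have hff' : f =ᵐ[μ] f' := hfm.ae_eq_mk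
  have hf'l : lorentzOneNorm p μ f' ≠ ∞ := by
    refine ne_top_of_le_ne_top hfl.ne (lorentzOneNorm_mono hp0.le ?_)
    filter_upwards [hff'] with x hx using by rw [hx]
  have hε4 : 0 < ε / 4 := ENNReal.div_pos hε (by norm_num)
  -- truncate `f`, both in size and in space
  set G : ℕ → Set (Rn n) := fun j => Metric.closedBall 0 j ∩ {x | ‖f' x‖ ≤ j} with hG
  have hGm : ∀ j, MeasurableSet (G j) := fun j => Metric.isClosed_closedBall.measurableSet.inter
    (measurableSet_le hf'm.norm.measurable measurable_const)
  have h1 : Filter.Tendsto (fun j => lorentzOneNorm p μ (f' - (G j).indicator f')) Filter.atTop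
      (nhds 0) := by
    refine tendsto_lorentzOneNorm_zero hp0 (f := f') (fun j => ?_) (fun j x => ?_) hf'l
      hf'm.aestronglyMeasurable (Filter.Eventually.of_forall fun x => ?_)
    · exact (hf'm.sub (hf'm.indicator (hGm j))).aestronglyMeasurable
    · by_cases hx : x ∈ G j
      · simp [hx]
      · simp [hx]
    · refine tendsto_const_nhds.congr' ?_
      obtain ⟨j₀, hj₀⟩ := exists_nat_ge (max ‖x‖ ‖f' x‖)
      filter_upwards [Filter.eventually_ge_atTop j₀] with j hj
      have hj' : (j₀ : ℝ) ≤ j := by exact_mod_cast hj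
      have hxG : x ∈ G j := by
        refine ⟨?_, ?_⟩
        · rw [mem_closedBall_zero_iff]
          exact ((le_max_left _ _).trans hj₀).trans hj'
        · exact ((le_max_right _ _).trans hj₀).trans hj'
      simp [hxG]
  obtain ⟨j, hj⟩ := (h1.eventually (ge_mem_nhds hε4)).exists
  set h := (G j).indicator f' with hh
  have hhm : StronglyMeasurable h := hf'm.indicator (hGm j)
  have hhM : ∀ x, ‖h x‖ ≤ j := by
    intro x
    by_cases hx : x ∈ G j
    · rw [hh, indicator_of_mem hx]
      exact hx.2
    · rw [hh, indicator_of_notMem hx, norm_zero]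
      positivity
  have hhρ : ∀ x, x ∉ Metric.closedBall (0 : Rn n) j → h x = 0 := fun x hx =>
    indicator_of_notMem (fun hx' => hx hx'.1) _
  -- mollify the truncation, which is bounded and of bounded support
  obtain ⟨g, hg, hgM, hgρ, hgh⟩ := exists_testFun_tendsto hhm.aestronglyMeasurable hhM hhρ
  set K := Metric.closedBall (0 : Rn n) ((j : ℝ) + 1) with hK
  set b : Rn n → 𝕜 := K.indicator fun _ => (((2 * j : ℝ)) : 𝕜) with hb
  have hKm : MeasurableSet K := Metric.isClosed_closedBall.measurableSet
  have hbnorm : ∀ x ∈ K, ‖b x‖ = 2 * j := by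
    intro x hx
    rw [hb, indicator_of_mem hx, RCLike.norm_ofReal, abs_of_nonneg (by positivity)]
  have h2 : Filter.Tendsto (fun k => lorentzOneNorm p μ (h - g k)) Filter.atTop (nhds 0) := by
    refine tendsto_lorentzOneNorm_zero hp0 (f := b) (fun k => ?_) (fun k x => ?_) ?_ ?_ ?_
    · exact hhm.aestronglyMeasurable.sub (hg k).1.continuous.aestronglyMeasurable
    · by_cases hx : x ∈ K
      · rw [hbnorm x hx]
        refine (norm_sub_le _ _).trans ?_
        linarith [hhM x, hgM k x]
      · have hx' : x ∉ Metric.closedBall (0 : Rn n) j := fun hx' =>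
          hx (Metric.closedBall_subset_closedBall (by linarith) hx')
        rw [Pi.sub_apply, hgρ k x hx, hhρ x hx', sub_zero, norm_zero]
        exact norm_nonneg _
    · refine (lorentzOneNorm_lt_top_of_bounded hp0 (M := 2 * j) (K := K) (fun x => ?_)
        (fun x hx => indicator_of_notMem hx _) (hfin _)).ne
      by_cases hx : x ∈ K
      · exact (hbnorm x hx).le
      · rw [indicator_of_notMem hx, norm_zero]
        positivity
    · exact (stronglyMeasurable_const.indicator hKm).aestronglyMeasurable
    · filter_upwards [hμ.ae_le hgh] with x hx
      have := hx.const_sub (h x)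
      simpa using this
  obtain ⟨k, hk⟩ := (h2.eventually (ge_mem_nhds hε4)).exists
  refine ⟨g k, hg k, ?_⟩
  calc lorentzOneNorm p μ (f - g k) ≤ lorentzOneNorm p μ ((f' - h) + (h - g k)) := by
        refine lorentzOneNorm_mono hp0.le ?_
        filter_upwards [hff'] with x hx
        simp [hx]
    _ ≤ 2 * (lorentzOneNorm p μ (f' - h) + lorentzOneNorm p μ (h - g k)) :=
        lorentzOneNorm_add_le hp μ _ _
    _ ≤ 2 * (ε / 4 + ε / 4) := by gcongr
    _ = ε := by
        rw [← two_mul, ← mul_assoc, show (2 : ℝ≥0∞) * 2 = 4 by norm_num]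
        exact ENNReal.mul_div_cancel (by norm_num) (by norm_num)

/-! ### Limits in weak Lebesgue spaces -/

theorem weakNorm_mono {𝕜 : Type*} [RCLike 𝕜] {n : ℕ} {q : ℝ} (hq : 0 < q) {ν : Measure (Rn n)}
    {f g : Rn n → 𝕜} (h : ∀ᵐ x ∂ν, ‖f x‖ ≤ ‖g x‖) : weakNorm q ν f ≤ weakNorm q ν g := by
  unfold weakNorm
  refine iSup₂_mono fun y _ => mul_le_mul_right (ENNReal.rpow_le_rpow ?_ (by positivity)) _
  refine measure_mono_ae ?_
  filter_upwards [h] with x hx hy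
  exact lt_of_lt_of_le (show y < ‖f x‖ from hy) hx

theorem measure_lt_norm_le {𝕜 : Type*} [RCLike 𝕜] {n : ℕ} {q : ℝ} (hq : 0 < q) (ν : Measure (Rn n))
    (f : Rn n → 𝕜) {y : ℝ} (hy : 0 < y) :
    ν {x | y < ‖f x‖} ≤ (weakNorm q ν f / ENNReal.ofReal y) ^ q := by
  have hy0 : ENNReal.ofReal y ≠ 0 := by simpa using hy
  have h1 : ENNReal.ofReal y * ν {x | y < ‖f x‖} ^ (1 / q) ≤ weakNorm q ν f :=
    le_iSup₂ (f := fun (y : ℝ) (_ : 0 < y) => ENNReal.ofReal y * ν {x | y < ‖f x‖} ^ (1 / q)) y hy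
  calc ν {x | y < ‖f x‖} = (ν {x | y < ‖f x‖} ^ (1 / q)) ^ q := by
        rw [← ENNReal.rpow_mul, one_div_mul_cancel hq.ne', ENNReal.rpow_one]
    _ ≤ _ := by
        refine ENNReal.rpow_le_rpow ?_ hq.le
        rw [ENNReal.le_div_iff_mul_le (Or.inl hy0) (Or.inl ENNReal.ofReal_ne_top), mul_comm]
        exact h1

/-- Fatou's lemma for the weak norm. -/
theorem weakNorm_le_of_tendsto {𝕜 : Type*} [RCLike 𝕜] {n : ℕ} {q : ℝ} (hq : 0 < q)
    {ν : Measure (Rn n)} {F : ℕ → Rn n → 𝕜} {f : Rn n → 𝕜} {c : ℕ → ℝ≥0∞} {C : ℝ≥0∞}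
    (hF : ∀ᵐ x ∂ν, Filter.Tendsto (fun j => F j x) Filter.atTop (nhds (f x)))
    (hc : ∀ j, weakNorm q ν (F j) ≤ c j) (hcC : Filter.Tendsto c Filter.atTop (nhds C)) :
    weakNorm q ν f ≤ C := by
  refine iSup₂_le fun y hy => ?_
  have hy0 : ENNReal.ofReal y ≠ 0 := by simpa using hy
  set A : ℕ → Set (Rn n) := fun k => ⋂ j ∈ Ici k, {x | y < ‖F j x‖} with hA
  have hAmono : Monotone A := fun k l hkl => biInter_subset_biInter_left (Ici_subset_Ici.2 hkl)
  have h1 : ν {x | y < ‖f x‖} ≤ ν (⋃ k, A k) := by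
    refine measure_mono_ae ?_
    filter_upwards [hF] with x hx hxy
    have h2 : ∀ᶠ j in Filter.atTop, y < ‖F j x‖ := hx.norm.eventually (lt_mem_nhds hxy)
    obtain ⟨k, hk⟩ := Filter.eventually_atTop.1 h2
    exact mem_iUnion.2 ⟨k, mem_iInter₂.2 fun j hj => hk j hj⟩
  have h3 : ∀ k, ν (A k) ≤ (C / ENNReal.ofReal y) ^ q := by
    intro k
    have h4 : ∀ j ≥ k, ENNReal.ofReal y * ν (A k) ^ (1 / q) ≤ c j := by
      intro j hj
      refine le_trans ?_ (hc j)
      refine le_trans ?_ (le_iSup₂ (f := fun (y : ℝ) (_ : 0 < y) =>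
        ENNReal.ofReal y * ν {x | y < ‖F j x‖} ^ (1 / q)) y hy)
      gcongr
      exact biInter_subset_of_mem hj
    have h5 : ENNReal.ofReal y * ν (A k) ^ (1 / q) ≤ C :=
      ge_of_tendsto hcC (Filter.eventually_atTop.2 ⟨k, h4⟩)
    calc ν (A k) = (ν (A k) ^ (1 / q)) ^ q := by
          rw [← ENNReal.rpow_mul, one_div_mul_cancel hq.ne', ENNReal.rpow_one]
      _ ≤ _ := by
          refine ENNReal.rpow_le_rpow ?_ hq.le
          rw [ENNReal.le_div_iff_mul_le (Or.inl hy0) (Or.inl ENNReal.ofReal_ne_top), mul_comm]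
          exact h5
  have h6 : ν {x | y < ‖f x‖} ≤ (C / ENNReal.ofReal y) ^ q := by
    refine h1.trans ?_
    rw [hAmono.measure_iUnion]
    exact iSup_le h3
  calc ENNReal.ofReal y * ν {x | y < ‖f x‖} ^ (1 / q) ≤
        ENNReal.ofReal y * ((C / ENNReal.ofReal y) ^ q) ^ (1 / q) := by gcongr
    _ = C := by
        rw [← ENNReal.rpow_mul, mul_one_div_cancel hq.ne', ENNReal.rpow_one]
        exact ENNReal.mul_div_cancel hy0 ENNReal.ofReal_ne_top

/-- By the Borel–Cantelli lemma, functions with weak norms of the order of `4 ^ (-k)` are almost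
everywhere bounded by `2 ^ (-k)` for large `k`. -/
theorem ae_eventually_norm_le {𝕜 : Type*} [RCLike 𝕜] {n : ℕ} {q : ℝ} (hq : 1 ≤ q)
    {ν : Measure (Rn n)} {F : ℕ → Rn n → 𝕜} {c : ℝ≥0∞} (hc : c ≠ ∞)
    (hF : ∀ k, weakNorm q ν (F k) ≤ c * (4⁻¹ : ℝ≥0∞) ^ k) :
    ∀ᵐ x ∂ν, ∀ᶠ k in Filter.atTop, ‖F k x‖ ≤ (1 / 2 : ℝ) ^ k := by
  have hq0 : 0 < q := by linarith
  have h1 : ∑' k : ℕ, ν {x | (1 / 2 : ℝ) ^ k < ‖F k x‖} ≠ ∞ := by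
    have h2 : ∀ k : ℕ, ν {x | (1 / 2 : ℝ) ^ k < ‖F k x‖} ≤ c ^ q * (2⁻¹ : ℝ≥0∞) ^ k := by
      intro k
      refine (measure_lt_norm_le hq0 ν (F k) (by positivity)).trans ?_
      have h3 : ENNReal.ofReal ((1 / 2 : ℝ) ^ k) = (2⁻¹ : ℝ≥0∞) ^ k := by
        rw [ENNReal.ofReal_pow (by norm_num)]
        congr 1
        rw [one_div, ENNReal.ofReal_inv_of_pos two_pos, ENNReal.ofReal_ofNat]
      have h4 : weakNorm q ν (F k) / ENNReal.ofReal ((1 / 2 : ℝ) ^ k) ≤ c * (2⁻¹ : ℝ≥0∞) ^ k := by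
        refine ENNReal.div_le_of_le_mul ((hF k).trans_eq ?_)
        rw [h3, mul_assoc, ← mul_pow, ← ENNReal.mul_inv (by norm_num) (by norm_num)]
        norm_num
      calc _ ≤ (c * (2⁻¹ : ℝ≥0∞) ^ k) ^ q := ENNReal.rpow_le_rpow h4 hq0.le
        _ = c ^ q * ((2⁻¹ : ℝ≥0∞) ^ k) ^ q := ENNReal.mul_rpow_of_nonneg _ _ hq0.le
        _ ≤ c ^ q * (2⁻¹ : ℝ≥0∞) ^ k := by
            have h5 : (2⁻¹ : ℝ≥0∞) ^ k ≤ 1 := pow_le_one' (ENNReal.inv_le_one.2 (by norm_num)) k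
            have h6 := ENNReal.rpow_le_rpow_of_exponent_ge h5 hq
            rw [ENNReal.rpow_one] at h6
            gcongr
    refine ne_top_of_le_ne_top ?_ (ENNReal.tsum_le_tsum h2)
    rw [ENNReal.tsum_mul_left, ENNReal.tsum_geometric]
    refine ENNReal.mul_ne_top (ENNReal.rpow_ne_top_of_nonneg hq0.le hc) (ENNReal.inv_ne_top.2 ?_)
    rw [ENNReal.one_sub_inv_two]
    norm_num
  filter_upwards [ae_eventually_notMem h1] with x hx
  filter_upwards [hx] with k hk
  exact not_lt.1 hk

/-! ### Extension by density -/

theorem add_mem_testFun {𝕜 : Type*} [RCLike 𝕜] {n : ℕ} {f g : Rn n → 𝕜} (hf : f ∈ testFun 𝕜 n)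
    (hg : g ∈ testFun 𝕜 n) : f + g ∈ testFun 𝕜 n :=
  ⟨hf.1.add hg.1, hf.2.add hg.2⟩

theorem smul_mem_testFun {𝕜 : Type*} [RCLike 𝕜] {n : ℕ} (c : 𝕜) {f : Rn n → 𝕜}
    (hf : f ∈ testFun 𝕜 n) : c • f ∈ testFun 𝕜 n :=
  ⟨contDiff_const.mul hf.1, hf.2.mul_left (f := fun _ => c)⟩

theorem lorentzOneNorm_sub_le {𝕜 : Type*} [RCLike 𝕜] {n : ℕ} {p : ℝ} (hp : 1 ≤ p)
    (μ : Measure (Rn n)) (f g : Rn n → 𝕜) :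
    lorentzOneNorm p μ (f - g) ≤ 2 * (lorentzOneNorm p μ f + lorentzOneNorm p μ g) := by
  have h1 : lorentzOneNorm p μ (-g) = lorentzOneNorm p μ g := by simp [lorentzOneNorm]
  rw [← h1, sub_eq_add_neg]
  exact lorentzOneNorm_add_le hp μ f (-g)

theorem add_mem_lorentzOne {𝕜 : Type*} [RCLike 𝕜] {n : ℕ} {p : ℝ} (hp : 1 ≤ p) {μ : Measure (Rn n)}
    {f g : Rn n → 𝕜} (hf : f ∈ LorentzOne 𝕜 p μ) (hg : g ∈ LorentzOne 𝕜 p μ) :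
    f + g ∈ LorentzOne 𝕜 p μ :=
  ⟨hf.1.add hg.1, (lorentzOneNorm_add_le hp μ f g).trans_lt
    (ENNReal.mul_lt_top (by norm_num) (ENNReal.add_lt_top.2 ⟨hf.2, hg.2⟩))⟩

theorem smul_mem_lorentzOne {𝕜 : Type*} [RCLike 𝕜] {n : ℕ} {p : ℝ} (hp : 1 ≤ p)
    {μ : Measure (Rn n)} (c : 𝕜) {f : Rn n → 𝕜} (hf : f ∈ LorentzOne 𝕜 p μ) :
    c • f ∈ LorentzOne 𝕜 p μ := by
  refine ⟨hf.1.const_smul c, ?_⟩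
  rw [lorentzOneNorm_const_mul (by linarith)]
  exact ENNReal.mul_lt_top enorm_lt_top hf.2

theorem testFun_subset_lorentzOne {𝕜 : Type*} [RCLike 𝕜] {n : ℕ} {p : ℝ} (hp : 1 ≤ p)
    {μ : Measure (Rn n)} (hfin : ∀ ρ : ℝ, μ (Metric.closedBall 0 ρ) ≠ ∞) :
    testFun 𝕜 n ⊆ LorentzOne 𝕜 p μ := by
  intro f hf
  obtain ⟨M, hM⟩ := hf.2.exists_bound_of_continuous hf.1.continuous
  obtain ⟨ρ, hρ⟩ := hf.2.isBounded.subset_closedBall 0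
  refine ⟨hf.1.continuous.aestronglyMeasurable, lorentzOneNorm_lt_top_of_bounded (by linarith) hM
    (K := Metric.closedBall 0 ρ) (fun x hx => ?_) (hfin ρ)⟩
  exact image_eq_zero_of_notMem_tsupport fun h => hx (hρ h)

/-- The extension by continuity of an operator on test functions that is Lipschitz from the Lorentz
space to the weak space. It is characterized by convergence along sequences of test functions that
converge geometrically. -/
theorem exists_limit_operator {𝕜 : Type*} [RCLike 𝕜] {n : ℕ} {p q : ℝ} (hp : 1 ≤ p) (hq : 1 ≤ q)
    {μ ν : Measure (Rn n)} (hμ : μ ≪ volume) (hfin : ∀ ρ : ℝ, μ (Metric.closedBall 0 ρ) ≠ ∞)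
    {U : (Rn n → 𝕜) → Rn n → 𝕜} {K : ℝ≥0∞} (hK : K ≠ ∞)
    (hU : ∀ φ ∈ testFun 𝕜 n, AEStronglyMeasurable (U φ) ν)
    (hUb : ∀ φ ∈ testFun 𝕜 n, weakNorm q ν (U φ) ≤ K * lorentzOneNorm p μ φ)
    (hUd : ∀ φ ∈ testFun 𝕜 n, ∀ ψ ∈ testFun 𝕜 n,
      weakNorm q ν (U φ - U ψ) ≤ K * lorentzOneNorm p μ (φ - ψ)) :
    ∃ L : (Rn n → 𝕜) → Rn n → 𝕜, ∀ f ∈ LorentzOne 𝕜 p μ, AEStronglyMeasurable (L f) ν ∧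
      weakNorm q ν (L f) ≤ 2 * K * lorentzOneNorm p μ f ∧
      ∀ (ψ : ℕ → Rn n → 𝕜) (c : ℝ≥0∞), c ≠ ∞ → (∀ k, ψ k ∈ testFun 𝕜 n) →
        (∀ k, lorentzOneNorm p μ (f - ψ k) ≤ c * (4⁻¹ : ℝ≥0∞) ^ k) →
        ∀ᵐ x ∂ν, Filter.Tendsto (fun k => U (ψ k) x) Filter.atTop (nhds (L f x)) := by
  have hq0 : 0 < q := by linarith
  suffices h : ∀ f : Rn n → 𝕜, ∃ F : Rn n → 𝕜, f ∈ LorentzOne 𝕜 p μ →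
      AEStronglyMeasurable F ν ∧ weakNorm q ν F ≤ 2 * K * lorentzOneNorm p μ f ∧
      ∀ (ψ : ℕ → Rn n → 𝕜) (c : ℝ≥0∞), c ≠ ∞ → (∀ k, ψ k ∈ testFun 𝕜 n) →
        (∀ k, lorentzOneNorm p μ (f - ψ k) ≤ c * (4⁻¹ : ℝ≥0∞) ^ k) →
        ∀ᵐ x ∂ν, Filter.Tendsto (fun k => U (ψ k) x) Filter.atTop (nhds (F x)) by
    choose L hL using h
    exact ⟨L, hL⟩
  intro f
  by_cases hf : f ∈ LorentzOne 𝕜 p μ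
  swap
  · exact ⟨0, fun h => absurd h hf⟩
  choose φ hφ hφf using fun k : ℕ => exists_testFun_lorentzOneNorm_le hp hμ hfin hf
    (ε := (4⁻¹ : ℝ≥0∞) ^ k) (pow_ne_zero k (by norm_num))
  have hdist : ∀ {a b : Rn n → 𝕜}, a ∈ testFun 𝕜 n → b ∈ testFun 𝕜 n →
      weakNorm q ν (U a - U b) ≤
        K * (2 * (lorentzOneNorm p μ (f - b) + lorentzOneNorm p μ (f - a))) := by
    intro a b ha hb
    refine (hUd a ha b hb).trans ?_
    gcongr
    have h1 := lorentzOneNorm_sub_le hp μ (f - b) (f - a)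
    rwa [sub_sub_sub_cancel_left] at h1
  have hconv : ∀ᵐ x ∂ν, ∃ z, Filter.Tendsto (fun k => U (φ k) x) Filter.atTop (nhds z) := by
    have h1 : ∀ k, weakNorm q ν (U (φ (k + 1)) - U (φ k)) ≤ (K * 4) * (4⁻¹ : ℝ≥0∞) ^ k := by
      intro k
      refine (hdist (hφ (k + 1)) (hφ k)).trans ?_
      calc _ ≤ K * (2 * ((4⁻¹ : ℝ≥0∞) ^ k + (4⁻¹ : ℝ≥0∞) ^ k)) := by
            gcongr
            · exact hφf k
            · refine (hφf (k + 1)).trans ?_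
              exact pow_le_pow_right_of_le_one' (ENNReal.inv_le_one.2 (by norm_num)) (Nat.le_succ k)
        _ = _ := by ring
    filter_upwards [ae_eventually_norm_le hq (ENNReal.mul_ne_top hK (by norm_num)) h1] with x hx
    refine cauchySeq_tendsto_of_complete (cauchySeq_of_summable_dist ?_)
    refine Summable.of_norm_bounded_eventually_nat summable_geometric_two ?_
    filter_upwards [hx] with k hk
    rw [Real.norm_of_nonneg dist_nonneg, dist_comm, dist_eq_norm]
    exact hk
  obtain ⟨F, hlim⟩ : ∃ F : Rn n → 𝕜,
      ∀ᵐ x ∂ν, Filter.Tendsto (fun k => U (φ k) x) Filter.atTop (nhds (F x)) := Filter.skolem.1 hconv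
  refine ⟨F, fun _ => ⟨?_, ?_, ?_⟩⟩
  · exact aestronglyMeasurable_of_tendsto_ae Filter.atTop (fun k => hU _ (hφ k)) hlim
  · have h1 : Filter.Tendsto (fun k : ℕ => K * (2 * (lorentzOneNorm p μ f + (4⁻¹ : ℝ≥0∞) ^ k)))
        Filter.atTop (nhds (K * (2 * (lorentzOneNorm p μ f + 0)))) := by
      refine ENNReal.Tendsto.const_mul (ENNReal.Tendsto.const_mul (tendsto_const_nhds.add ?_)
        (Or.inr (by norm_num))) (Or.inr hK)
      exact ENNReal.tendsto_pow_atTop_nhds_zero_of_lt_one (ENNReal.inv_lt_one.2 (by norm_num))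
    refine (weakNorm_le_of_tendsto hq0 hlim (fun k => ?_) h1).trans_eq (by ring)
    refine (hUb _ (hφ k)).trans ?_
    gcongr
    have h2 := lorentzOneNorm_sub_le hp μ f (f - φ k)
    rw [sub_sub_cancel] at h2
    refine h2.trans ?_
    gcongr
    exact hφf k
  · intro ψ c hc hψ hψf
    have h1 : ∀ k, weakNorm q ν (U (ψ k) - U (φ k)) ≤ (K * (2 * (1 + c))) * (4⁻¹ : ℝ≥0∞) ^ k := by
      intro k
      refine (hdist (hψ k) (hφ k)).trans ?_
      calc _ ≤ K * (2 * ((4⁻¹ : ℝ≥0∞) ^ k + c * (4⁻¹ : ℝ≥0∞) ^ k)) := by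
            gcongr
            · exact hφf k
            · exact hψf k
        _ = _ := by ring
    have hc' : K * (2 * (1 + c)) ≠ ∞ := ENNReal.mul_ne_top hK (ENNReal.mul_ne_top (by norm_num)
      (ENNReal.add_ne_top.2 ⟨by norm_num, hc⟩))
    filter_upwards [ae_eventually_norm_le hq hc' h1, hlim] with x hx hx'
    have h2 : Filter.Tendsto (fun k => (U (ψ k) - U (φ k)) x) Filter.atTop (nhds 0) :=
      squeeze_zero_norm' hx (tendsto_pow_atTop_nhds_zero_of_lt_one (by norm_num) (by norm_num))
    have h3 := h2.add hx'
    simpa using h3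

/-- A (sub)linear operator on test functions that is bounded from the Lorentz space to the weak
space extends boundedly. A sublinear operator is extended through `‖T f‖`, which depends on `f` in
a Lipschitz way, whereas `T f` itself need not. -/
theorem extendsBoundedly_of_weakNorm_le {𝕜 : Type*} [RCLike 𝕜] {n : ℕ} {p q : ℝ} (hp : 1 ≤ p)
    (hq : 1 ≤ q) {μ ν : Measure (Rn n)} (hμ : μ ≪ volume) (hν : ν ≪ volume)
    (hfin : ∀ ρ : ℝ, μ (Metric.closedBall 0 ρ) ≠ ∞) {T : (Rn n → 𝕜) → Rn n → 𝕜}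
    (hT : SublinearOn volume (testFun 𝕜 n) T)
    (hTm : ∀ φ ∈ testFun 𝕜 n, AEStronglyMeasurable (T φ) volume) {K K' : ℝ≥0∞} (hK : K ≠ ∞)
    (hTb : ∀ φ ∈ testFun 𝕜 n, weakNorm q ν (T φ) ≤ K * lorentzOneNorm p μ φ) (hKK' : 2 * K ≤ K') :
    ExtendsBoundedly p q μ ν K' T := by
  classical
  have hp0 : 0 < p := by linarith
  have hq0 : 0 < q := by linarith
  have htest : testFun 𝕜 n ⊆ LorentzOne 𝕜 p μ := testFun_subset_lorentzOne hp hfin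
  have hsub : ∀ φ ∈ testFun 𝕜 n, ∀ ψ ∈ testFun 𝕜 n, φ - ψ ∈ testFun 𝕜 n := by
    intro φ hφ ψ hψ
    have := add_mem_testFun hφ (smul_mem_testFun (-1) hψ)
    rwa [neg_smul, one_smul, ← sub_eq_add_neg] at this
  -- the Lipschitz operator that is extended
  set U : (Rn n → 𝕜) → Rn n → 𝕜 := if LinearOn volume (testFun 𝕜 n) T then T else
    fun φ x => ((‖T φ x‖ : ℝ) : 𝕜) with hUdef
  have hUlin : LinearOn volume (testFun 𝕜 n) T → U = T := fun h => by rw [hUdef, if_pos h]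
  have hUT : ∀ φ x, ‖U φ x‖ = ‖T φ x‖ := by
    intro φ x
    rw [hUdef]
    split_ifs
    · rfl
    · simp
  have hUm : ∀ φ ∈ testFun 𝕜 n, AEStronglyMeasurable (U φ) ν := by
    intro φ hφ
    have h1 := (hTm φ hφ).mono_ac hν
    rw [hUdef]
    split_ifs
    · exact h1
    · exact RCLike.continuous_ofReal.comp_aestronglyMeasurable h1.norm
  have hUdiff : ∀ φ ∈ testFun 𝕜 n, ∀ ψ ∈ testFun 𝕜 n,
      ∀ᵐ x ∂ν, ‖(U φ - U ψ) x‖ ≤ ‖T (φ - ψ) x‖ := by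
    intro φ hφ ψ hψ
    refine hν.ae_le ?_
    by_cases hlin : LinearOn volume (testFun 𝕜 n) T
    · rw [hUlin hlin]
      filter_upwards [hlin.1 φ hφ _ (smul_mem_testFun (-1) hψ), hlin.2 (-1) ψ hψ] with x hx hx'
      rw [neg_smul, one_smul, ← sub_eq_add_neg] at hx
      rw [neg_smul, one_smul] at hx'
      rw [hx, hx', Pi.sub_apply, neg_one_mul, ← sub_eq_add_neg]
    · have hs := hsub φ hφ ψ hψ
      have hs' := hsub ψ hψ φ hφ
      filter_upwards [hT.1 _ hs ψ hψ, hT.1 _ hs' φ hφ, hT.2 (-1) _ hs] with x h1 h2 h3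
      rw [sub_add_cancel] at h1 h2
      rw [neg_smul, one_smul, neg_sub, norm_neg, norm_one, one_mul] at h3
      rw [hUdef, if_neg hlin, Pi.sub_apply, ← RCLike.ofReal_sub, RCLike.norm_ofReal, abs_le]
      constructor <;> linarith
  have hUsub : SublinearOn volume (testFun 𝕜 n) U := by
    refine ⟨fun f hf g hg => ?_, fun c f hf => ?_⟩
    · simp only [hUT]
      exact hT.1 f hf g hg
    · simp only [hUT]
      exact hT.2 c f hf
  obtain ⟨L, hL⟩ := exists_limit_operator hp hq hμ hfin hK hUm
    (fun φ hφ => (weakNorm_mono hq0 (Filter.Eventually.of_forall fun x => (hUT φ x).le)).trans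
      (hTb φ hφ))
    (fun φ hφ ψ hψ => (weakNorm_mono hq0 (hUdiff φ hφ ψ hψ)).trans (hTb _ (hsub φ hφ ψ hψ)))
  have happ : ∀ f ∈ LorentzOne 𝕜 p μ, ∃ φ : ℕ → Rn n → 𝕜, (∀ k, φ k ∈ testFun 𝕜 n) ∧
      ∀ k, lorentzOneNorm p μ (f - φ k) ≤ (4⁻¹ : ℝ≥0∞) ^ k := by
    intro f hf
    choose φ hφ hφf using fun k : ℕ => exists_testFun_lorentzOneNorm_le hp hμ hfin hf
      (ε := (4⁻¹ : ℝ≥0∞) ^ k) (pow_ne_zero k (by norm_num))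
    exact ⟨φ, hφ, hφf⟩
  -- sums and multiples of approximating sequences approximate
  have hadd : ∀ f ∈ LorentzOne 𝕜 p μ, ∀ g ∈ LorentzOne 𝕜 p μ, ∃ φ ψ : ℕ → Rn n → 𝕜,
      (∀ k, φ k ∈ testFun 𝕜 n) ∧ (∀ k, ψ k ∈ testFun 𝕜 n) ∧ ∀ᵐ x ∂ν,
        Filter.Tendsto (fun k => U (φ k) x) Filter.atTop (nhds (L f x)) ∧
        Filter.Tendsto (fun k => U (ψ k) x) Filter.atTop (nhds (L g x)) ∧
        Filter.Tendsto (fun k => U (φ k + ψ k) x) Filter.atTop (nhds (L (f + g) x)) := by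
    intro f hf g hg
    obtain ⟨φ, hφ, hφf⟩ := happ f hf
    obtain ⟨ψ, hψ, hψg⟩ := happ g hg
    refine ⟨φ, ψ, hφ, hψ, ?_⟩
    filter_upwards [(hL f hf).2.2 φ 1 (by norm_num) hφ (by simpa using hφf),
      (hL g hg).2.2 ψ 1 (by norm_num) hψ (by simpa using hψg),
      (hL _ (add_mem_lorentzOne hp hf hg)).2.2 (fun k => φ k + ψ k) 4 (by norm_num)
        (fun k => add_mem_testFun (hφ k) (hψ k)) (fun k => by
          rw [add_sub_add_comm]
          refine (lorentzOneNorm_add_le hp μ _ _).trans ?_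
          calc _ ≤ 2 * ((4⁻¹ : ℝ≥0∞) ^ k + (4⁻¹ : ℝ≥0∞) ^ k) := by
                gcongr
                · exact hφf k
                · exact hψg k
            _ = _ := by ring)] with x h1 h2 h3 using ⟨h1, h2, h3⟩
  have hsmul : ∀ (c : 𝕜), ∀ f ∈ LorentzOne 𝕜 p μ, ∃ φ : ℕ → Rn n → 𝕜,
      (∀ k, φ k ∈ testFun 𝕜 n) ∧ ∀ᵐ x ∂ν,
        Filter.Tendsto (fun k => U (φ k) x) Filter.atTop (nhds (L f x)) ∧
        Filter.Tendsto (fun k => U (c • φ k) x) Filter.atTop (nhds (L (c • f) x)) := by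
    intro c f hf
    obtain ⟨φ, hφ, hφf⟩ := happ f hf
    refine ⟨φ, hφ, ?_⟩
    filter_upwards [(hL f hf).2.2 φ 1 (by norm_num) hφ (by simpa using hφf),
      (hL _ (smul_mem_lorentzOne hp c hf)).2.2 (fun k => c • φ k) ‖c‖ₑ enorm_ne_top
        (fun k => smul_mem_testFun c (hφ k)) (fun k => by
          rw [← smul_sub, lorentzOneNorm_const_mul hp0]
          gcongr
          exact hφf k)] with x h1 h2 using ⟨h1, h2⟩
  have hLsub : SublinearOn ν (LorentzOne 𝕜 p μ) L := by
    refine ⟨fun f hf g hg => ?_, fun c f hf => ?_⟩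
    · obtain ⟨φ, ψ, hφ, hψ, hlim⟩ := hadd f hf g hg
      filter_upwards [hlim, ae_all_iff.2 fun k => hν.ae_le (hUsub.1 _ (hφ k) _ (hψ k))] with x hx h1
      exact le_of_tendsto_of_tendsto' hx.2.2.norm (hx.1.norm.add hx.2.1.norm) h1
    · obtain ⟨φ, hφ, hlim⟩ := hsmul c f hf
      filter_upwards [hlim, ae_all_iff.2 fun k => hν.ae_le (hUsub.2 c _ (hφ k))] with x hx h1
      exact tendsto_nhds_unique (hx.2.norm.congr h1) (hx.1.norm.const_mul _)
  have hLlin : LinearOn volume (testFun 𝕜 n) T → LinearOn ν (LorentzOne 𝕜 p μ) L := by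
    intro hlin
    rw [← hUlin hlin] at hlin
    refine ⟨fun f hf g hg => ?_, fun c f hf => ?_⟩
    · obtain ⟨φ, ψ, hφ, hψ, hlim⟩ := hadd f hf g hg
      filter_upwards [hlim, ae_all_iff.2 fun k => hν.ae_le (hlin.1 _ (hφ k) _ (hψ k))] with x hx h1
      exact tendsto_nhds_unique (hx.2.2.congr h1) (hx.1.add hx.2.1)
    · obtain ⟨φ, hφ, hlim⟩ := hsmul c f hf
      filter_upwards [hlim, ae_all_iff.2 fun k => hν.ae_le (hlin.2 c _ (hφ k))] with x hx h1
      exact tendsto_nhds_unique (hx.2.congr h1) (hx.1.const_mul _)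
  have hLU : ∀ f ∈ testFun 𝕜 n, L f =ᵐ[ν] U f := by
    intro f hf
    filter_upwards [(hL f (htest hf)).2.2 (fun _ => f) 0 (by norm_num) (fun _ => hf) (fun k => by
      have h1 := lorentzOneNorm_const_mul hp0 μ (0 : 𝕜) f
      rw [zero_smul, enorm_zero, zero_mul] at h1
      rw [sub_self, h1]
      exact zero_le)] with x hx
    exact tendsto_nhds_unique hx tendsto_const_nhds
  -- on test functions `T` itself is kept: in the sublinear case `L f` only agrees with `‖T f‖`
  set T' : (Rn n → 𝕜) → Rn n → 𝕜 := fun f => if f ∈ testFun 𝕜 n then T f else L f with hT'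
  have hT'n : ∀ f, ∀ᵐ x ∂ν, ‖T' f x‖ = ‖L f x‖ := by
    intro f
    by_cases hf : f ∈ testFun 𝕜 n
    · filter_upwards [hLU f hf] with x hx
      simp only [hT', if_pos hf]
      rw [hx, hUT]
    · simp only [hT', if_neg hf]
      exact Filter.Eventually.of_forall fun x => trivial
  refine ⟨T', fun f hf => ⟨htest hf, ?_⟩, ?_, fun hlin => ?_, fun f hf => ?_⟩
  · simp only [hT', if_pos hf]
    exact Filter.EventuallyEq.rfl
  · refine ⟨fun f hf g hg => ?_, fun c f hf => ?_⟩
    · filter_upwards [hLsub.1 f hf g hg, hT'n f, hT'n g, hT'n (f + g)] with x h1 h2 h3 h4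
      rwa [h2, h3, h4]
    · filter_upwards [hLsub.2 c f hf, hT'n f, hT'n (c • f)] with x h1 h2 h3
      rwa [h2, h3]
  · have hT'L : ∀ f, T' f =ᵐ[ν] L f := by
      intro f
      by_cases hf : f ∈ testFun 𝕜 n
      · filter_upwards [hLU f hf] with x hx
        simp only [hT', if_pos hf]
        rw [hx, hUlin hlin]
      · simp only [hT', if_neg hf]
        exact Filter.EventuallyEq.rfl
    refine ⟨fun f hf g hg => ?_, fun c f hf => ?_⟩
    · filter_upwards [(hLlin hlin).1 f hf g hg, hT'L f, hT'L g, hT'L (f + g)] with x h1 h2 h3 h4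
      rw [h2, h3, h4, h1]
    · filter_upwards [(hLlin hlin).2 c f hf, hT'L f, hT'L (c • f)] with x h1 h2 h3
      rw [h2, h3, h1]
  · have h1 : weakNorm q ν (T' f) ≤ 2 * K * lorentzOneNorm p μ f :=
      (weakNorm_mono hq0 ((hT'n f).mono fun x hx => hx.le)).trans (hL f hf).2.1
    refine ⟨⟨?_, h1.trans_lt ?_⟩, h1.trans (by gcongr)⟩
    · simp only [hT']
      split_ifs with hft
      · exact (hTm f hft).mono_ac hν
      · exact (hL f hf).1
    · exact ENNReal.mul_lt_top (ENNReal.mul_lt_top (by norm_num) hK.lt_top) hf.2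

/-! ### Exponents and null sets -/

/-- For `s = q₀'` and `r = (q₀ / q)'`, the exponent `s` lies between `1` and `q'` in such a way that
`L ^ s` averages of `U` on a set interpolate between those of `U` and of `U ^ r`. -/
theorem conjExponent_toReal_relations {q : ℝ} (hq : 1 ≤ q) {q₀ : ℝ≥0∞} (h : ENNReal.ofReal q < q₀) :
    1 ≤ (ENNReal.conjExponent q₀).toReal ∧
      1 ≤ (ENNReal.conjExponent (q₀ / ENNReal.ofReal q)).toReal ∧
      (ENNReal.conjExponent q₀).toReal /
        (q * (ENNReal.conjExponent (q₀ / ENNReal.ofReal q)).toReal) +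
        (ENNReal.conjExponent q₀).toReal * (1 - 1 / q) = 1 := by
  have hq0 : 0 < q := by linarith
  induction q₀ using ENNReal.recTopCoe with
  | top =>
    rw [ENNReal.top_div_of_ne_top ENNReal.ofReal_ne_top]
    simp [ENNReal.conjExponent]
  | coe a =>
    have ha : q < a := by
      rw [← ENNReal.ofReal_coe_nnreal] at h
      exact (ENNReal.ofReal_lt_ofReal_iff_of_nonneg hq0.le).1 h
    have key : ∀ t : ℝ, 1 < t →
        (ENNReal.conjExponent (ENNReal.ofReal t)).toReal = t / (t - 1) := by
      intro t ht
      have ht' : t - 1 ≠ 0 := by linarith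
      rw [ENNReal.conjExponent, ← ENNReal.ofReal_one, ← ENNReal.ofReal_sub _ zero_le_one,
        ← ENNReal.ofReal_inv_of_pos (by linarith), ← ENNReal.ofReal_add zero_le_one
        (inv_nonneg.2 (by linarith)), ENNReal.toReal_ofReal
        (add_nonneg zero_le_one (inv_nonneg.2 (by linarith)))]
      field_simp
      ring
    have h1 : (1 : ℝ) < a := by linarith
    have h2 : 1 < (a : ℝ) / q := by
      rw [lt_div_iff₀ hq0]
      linarith
    have hs := key a h1
    have hr := key (a / q) h2
    rw [ENNReal.ofReal_coe_nnreal] at hs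
    rw [ENNReal.ofReal_div_of_pos hq0, ENNReal.ofReal_coe_nnreal] at hr
    have h3 : (a : ℝ) - 1 ≠ 0 := by linarith
    have h4 : (a : ℝ) - q ≠ 0 := by linarith
    have h5 : (a : ℝ) / q - 1 = (a - q) / q := by field_simp
    rw [hs, hr, h5]
    refine ⟨?_, ?_, ?_⟩
    · rw [le_div_iff₀ (by linarith)]
      linarith
    · rw [div_div_div_cancel_right₀ hq0.ne', le_div_iff₀ (by linarith)]
      linarith
    · rw [div_div_div_cancel_right₀ hq0.ne']
      have h6 : (a : ℝ) ≠ 0 := by linarith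
      field_simp
      ring

theorem aRConst_congr {n : ℕ} (p q : ℝ) {w w' : Rn n → ℝ≥0} (h : w =ᵐ[volume] w') :
    aRConst p q w = aRConst p q w' := by
  have h1 : ∀ t : ℝ, wMeasure (fun x => w x ^ t) = wMeasure fun x => w' x ^ t := fun t =>
    wMeasure_congr (h.mono fun x hx => by simp only [hx])
  simp only [aRConst, h1]

theorem rhConst_congr {n : ℕ} (s : ℝ) {w w' : Rn n → ℝ≥0} (h : w =ᵐ[volume] w') :
    rhConst s w = rhConst s w' := by
  have h1 : ∀ (t : ℝ) (Q : Set (Rn n)), fracAvg 0 t Q (fun x => (w x : ℝ≥0∞)) =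
      fracAvg 0 t Q fun x => (w' x : ℝ≥0∞) := by
    intro t Q
    have h2 : ∫⁻ x in Q, (w x : ℝ≥0∞) ^ t = ∫⁻ x in Q, (w' x : ℝ≥0∞) ^ t :=
      lintegral_congr_ae (ae_restrict_of_ae (h.mono fun x hx => by simp only [hx]))
    simp only [fracAvg, h2]
  simp only [rhConst, h1]

theorem doublingConst_congr {n : ℕ} (η : ℝ) {w w' : Rn n → ℝ≥0} (h : w =ᵐ[volume] w') :
    doublingConst η w = doublingConst η w' := by
  simp only [doublingConst, wMeasure_congr h]

/-- The bounded extension and the bound of the doubling constant, for measurable weights. A weight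
with a finite restricted Muckenhoupt constant that is not positive almost everywhere vanishes almost
everywhere, and then both measures are zero. -/
theorem exists_extendsBoundedly {𝕜 : Type*} [RCLike 𝕜] {n : ℕ} (hn : n ≠ 0)
    {α p₀ p q r s η : ℝ} {q₀ : ℝ≥0∞} {N : ℕ} {B : ℝ≥0} (hs₀ : s = (ENNReal.conjExponent q₀).toReal)
    (hp₀ : 1 ≤ p₀) (hp : p₀ ≤ p) (hpq : p ≤ q) (hr : 1 ≤ r) (hs : 1 ≤ s)
    (hsq : s / (q * r) + s * (1 - 1 / q) = 1) (hα₀ : 0 ≤ α) (hαn : α < n)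
    (hα : 1 / p - 1 / q = α / (n * s)) (hη : 0 < η) (hη1 : η ≤ 1) :
    ∃ C : ℝ≥0, ∀ {T : (Rn n → 𝕜) → Rn n → 𝕜} {w : Rn n → ℝ≥0},
      SparselyDominated α p₀ q₀ η N B T → Measurable w →
      aRConst (p / p₀) (q / p₀) (fun x => w x ^ p₀) < ∞ → rhConst r (fun x => w x ^ q) < ∞ →
      ExtendsBoundedly p q (wMeasure fun x => w x ^ p) (wMeasure fun x => w x ^ q)
        (C * aRConst (p / p₀) (q / p₀) (fun x => w x ^ p₀) ^ (1 / p₀) *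
          rhConst r (fun x => w x ^ q) ^ (r + 1 / q) *
          doublingConst η (fun x => w x ^ q) *
          doublingConst ((2 : ℝ) ^ (-(n : ℝ))) (fun x => w x ^ q) ^ (1 / q)) T ∧
      doublingConst η (fun x => w x ^ q) ≤
        C * aRConst (p / p₀) (q / p₀) (fun x => w x ^ p₀) ^ (q / p₀) := by
  have hp₀' : 0 < p₀ := by linarith
  have hp' : 0 < p := by linarith
  have hq' : 0 < q := by linarith
  obtain ⟨C₁, hC₁⟩ := exists_weakNorm_le (𝕜 := 𝕜) (N := N) (B := B) hn hs₀ hp₀ hp hpq hr hs hsq hα₀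
    hαn hα hη hη1
  set C₂ : ℝ≥0 := (η ^ (-(1 - (p₀ / p - p₀ / q)) * (q / p₀))).toNNReal with hC₂
  refine ⟨2 * C₁ + C₂, fun {T w} hT hw hA hR => ?_⟩
  have hDle := doublingConst_le hp₀' hp hpq hη hw hA
  rw [show ENNReal.ofReal (η ^ (-(1 - (p₀ / p - p₀ / q)) * (q / p₀))) = (C₂ : ℝ≥0∞) from rfl] at hDle
  have hut : ∀ Q, IsCube Q → wMeasure (fun x => w x ^ q) Q ≠ ∞ := fun Q hQ =>
    wMeasure_ne_top hp₀' hp' hq' hw hA hQ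
  have hfin : ∀ ρ : ℝ, wMeasure (fun x => w x ^ p) (Metric.closedBall 0 ρ) ≠ ∞ := by
    intro ρ
    obtain ⟨Q, hQ, hρQ⟩ := exists_cube_superset_closedBall (n := n) ρ
    exact ne_top_of_le_ne_top (wMeasure_ne_top_of_le hp' hpq hQ.volume_ne_top (hut Q hQ))
      (measure_mono hρQ)
  have hTm : ∀ φ ∈ testFun 𝕜 n, AEStronglyMeasurable (T φ) volume := fun φ hφ =>
    (hT.locallyIntegrable φ hφ).aestronglyMeasurable
  refine ⟨?_, hDle.trans ?_⟩
  · rcases ae_eq_zero_or_ae_ne_zero hp₀' hp' hq' hw hA with h0 | hpos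
    · have hν : wMeasure (fun x => w x ^ q) = 0 := by
        rw [← Measure.measure_univ_eq_zero, wMeasure_apply]
        rw [Measure.restrict_univ, lintegral_eq_zero_iff (hw.pow_const q).coe_nnreal_ennreal]
        filter_upwards [h0] with x hx
        simp [hx, hq'.ne']
      refine extendsBoundedly_of_weakNorm_le (hp₀.trans hp) (hp₀.trans (hp.trans hpq))
        (wMeasure_absolutelyContinuous _) (wMeasure_absolutelyContinuous _) hfin hT.sublinear hTm
        (K := 0) (by norm_num) (fun φ _ => ?_) (by simp)
      rw [hν]
      simp [weakNorm, hq']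
    · have hD2 : 1 ≤ doublingConst ((2 : ℝ) ^ (-(n : ℝ))) (fun x => w x ^ q) := by
        refine one_le_doublingConst ?_ hw hpos hut
        exact Real.rpow_le_one_of_one_le_of_nonpos one_le_two (by simp)
      have hD2' : 1 ≤ doublingConst ((2 : ℝ) ^ (-(n : ℝ))) (fun x => w x ^ q) ^ (1 / q) :=
        ENNReal.one_le_rpow hD2 (by positivity)
      refine extendsBoundedly_of_weakNorm_le (hp₀.trans hp) (hp₀.trans (hp.trans hpq))
        (wMeasure_absolutelyContinuous _) (wMeasure_absolutelyContinuous _) hfin hT.sublinear hTm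
        ?_ (hC₁ hT hw hpos hA hR) ?_
      · refine ENNReal.mul_ne_top ENNReal.coe_ne_top (ENNReal.mul_ne_top (ENNReal.mul_ne_top
          (ENNReal.rpow_ne_top_of_nonneg (by positivity) hA.ne)
          (ENNReal.rpow_ne_top_of_nonneg (by positivity) hR.ne)) ?_)
        exact ne_top_of_le_ne_top (ENNReal.mul_ne_top ENNReal.coe_ne_top
          (ENNReal.rpow_ne_top_of_nonneg (by positivity) hA.ne)) hDle
      · calc _ = ((2 * C₁ : ℝ≥0) : ℝ≥0∞) *
              aRConst (p / p₀) (q / p₀) (fun x => w x ^ p₀) ^ (1 / p₀) *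
              rhConst r (fun x => w x ^ q) ^ (r + 1 / q) *
              doublingConst η (fun x => w x ^ q) * 1 := by
              push_cast
              generalize aRConst (p / p₀) (q / p₀) (fun x => w x ^ p₀) ^ (1 / p₀) = A'
              generalize rhConst r (fun x => w x ^ q) ^ (r + 1 / q) = R'
              ring
          _ ≤ _ := by
              gcongr
              exact le_self_add
  · gcongr
    exact le_add_self

end

end FracSparse

theorem theorem1p1 (𝕜 : Type*) [RCLike 𝕜] (n : ℕ) (p₀ p q α η : ℝ) (q₀ : ℝ≥0∞) (N : ℕ) (B : ℝ≥0)
    (hp₀ : 1 ≤ p₀) (hp : p₀ ≤ p) (hpq : p ≤ q) (hq : ENNReal.ofReal q < q₀)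
    (hα₀ : 0 ≤ α) (hαn : α < n)
    (hα : 1 / p - 1 / q = α / (n * (ENNReal.conjExponent q₀).toReal))
    (hη₀ : 0 < η) (hη₁ : η ≤ 1) :
    ∃ C : ℝ≥0, ∀ (T : (Rn n → 𝕜) → Rn n → 𝕜) (w : Rn n → ℝ≥0) (r : ℝ),
      r = (ENNReal.conjExponent (q₀ / ENNReal.ofReal q)).toReal →
      SparselyDominated α p₀ q₀ η N B T →
      AEMeasurable w volume →
      aRConst (p / p₀) (q / p₀) (fun x => w x ^ p₀) < ∞ →
      IsRH r (fun x => w x ^ q) →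
      ExtendsBoundedly p q (wMeasure fun x => w x ^ p) (wMeasure fun x => w x ^ q)
        (C * aRConst (p / p₀) (q / p₀) (fun x => w x ^ p₀) ^ (1 / p₀) *
          rhConst r (fun x => w x ^ q) ^ (r + 1 / q) *
          doublingConst η (fun x => w x ^ q) *
          doublingConst ((2 : ℝ) ^ (-(n : ℝ))) (fun x => w x ^ q) ^ (1 / q)) T ∧
      doublingConst η (fun x => w x ^ q) ≤
        C * aRConst (p / p₀) (q / p₀) (fun x => w x ^ p₀) ^ (q / p₀) := by
  have hn : n ≠ 0 := by
    rintro rfl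
    rw [Nat.cast_zero] at hαn
    exact absurd hα₀ (not_le.2 hαn)
  obtain ⟨hs, hr, hsq⟩ := conjExponent_toReal_relations (hp₀.trans (hp.trans hpq)) hq
  obtain ⟨C, hC⟩ := exists_extendsBoundedly (𝕜 := 𝕜) (N := N) (B := B) hn rfl hp₀ hp hpq hr hs hsq
    hα₀ hαn hα hη₀ hη₁
  refine ⟨C, fun T w r hr₀ hT hw hA hRH => ?_⟩
  subst hr₀
  have hR : rhConst (ENNReal.conjExponent (q₀ / ENNReal.ofReal q)).toReal (fun x => w x ^ q) < ∞ := by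
    rw [IsRH] at hRH
    split_ifs at hRH with h
    · rw [rhConst, if_pos h]
      exact ENNReal.one_lt_top
    · exact hRH
  have hpow : ∀ t : ℝ, (fun x => w x ^ t) =ᵐ[volume] fun x => hw.mk w x ^ t := fun t =>
    hw.ae_eq_mk.mono fun x hx => by simp only [← hx]
  -- all objects depend only on the class of `w` modulo null sets
  rw [aRConst_congr _ _ (hpow p₀)] at hA ⊢
  rw [rhConst_congr _ (hpow q)] at hR ⊢
  rw [doublingConst_congr _ (hpow q), doublingConst_congr _ (hpow q), wMeasure_congr (hpow p),
    wMeasure_congr (hpow q)]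
  exact hC hT hw.measurable_mk hA hR
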